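/- **Setting.** Let $\Gamma$ be a singular branch of plane curve at $0\in\mathbb C^2$ with convergent irreducible parametrization $\Gamma(t)=(t^n,\sum_{\beta\ge\beta_1}a_{\beta,\Gamma}t^\beta)$, where $n\ge 2$ is its multiplicity and the first exponent $\beta_1>n$ is not a multiple of $n$. Put $e_0=n$; as long as $e_{j-1}\neq 1$, let $\beta_j$ be the least exponent of $\Gamma$ that is not a multiple of $e_{j-1}$, and $e_j=\gcd(e_{j-1},\beta_j)$. So $e_g=1$ for the number $g$ of Puiseux characteristic exponents $\beta_1<\dots<\beta_g$. Let $\mathcal E_\Gamma=\bigcup_{1\le j\le g}\{\beta_j+ke_j:k\ge0\}$, and let $\mathfrak n(\beta)$ be the element of $\mathcal E_\Gamma$ following $\beta$. **The class $\hat\Delta^{0,j}_{\mathfrak n(\beta_j),<}$.** For $1\le j\le g$ consider the generic curve $\gamma(t)=(t^n,\sum_{\beta<\beta_j}a_{\beta,\Gamma}t^\beta+\sum_{\beta\in\mathcal E_\Gamma,\ \beta\ge\beta_j}a_\beta t^\beta)$, with the $a_\beta$ ($\beta\ge\beta_j$) as variables. A formal 1-form $\omega$ belongs to $\hat\Delta^{0,j}_{\mathfrak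 n(\beta_j),<}$ if $t\,\gamma^*\omega=g(t)\,dt$ with $$g(t)=t^k\sum_{\beta\in\mathcal E_\Gamma,\ \beta\ge\mathfrak n(\beta_j)}C_\beta t^\beta,\qquad C_\beta=\tilde c\,c_\beta\,R(a_{\beta_j})\,a_\beta+Q_\beta ,$$ where $k\ge 0$ is a multiple of $e_j$, $\tilde c\in\mathbb C^*$, $R(a_{\beta_j})=c\,a_{\beta_j}^s$ with $c\in\mathbb C^*$ and $s\in\mathbb Z_{\ge0}$, each $Q_\beta$ is a complex polynomial in the variables $a_{\beta'}$ with $\beta_j\le\beta'<\beta$, and $(c_\beta)$ is a strictly increasing sequence of positive rational numbers with first term $c_{\mathfrak n(\beta_j)}=1$. **Fanning.** A family $\{\gamma_s\}_{s\in\mathbb C^*}$ of invariant curves of a holomorphic 1-form $\omega\ne0$ (i.e. $\gamma_s^*\omega\equiv0$) *fans $\Gamma$ to genus $j$* if there is a holomorphic map $$\mathcal P(t,s)=\Big(t^n,\ \sum_{\beta<\beta_j}a_{\beta,\Gamma}t^\beta+s\,t^{\beta_j}+\sum_{k\ge1}b_k(s)\,t^{\beta_j+ke_j}\Big)$$ on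 a neighbourhood of $\{0\}\times\mathbb C^*$ in $\mathbb C^2$ such that $\mathcal P(\cdot,s)$ is a (maybe non-injective) parametrization of $\gamma_s$ for each $s\in\mathbb C^*$. If such a family exists, $\omega$ *fans $\Gamma$ to genus $j$*. **Characteristic divisors.** Let $P_0=0$. For $k\ge1$ let $\pi_k$ be the blow-up of $P_{k-1}$, $D_k=\pi_k^{-1}(P_{k-1})$, $E_k=(\pi_1\circ\dots\circ\pi_k)^{-1}(0)$, and let $P_k=P_{\Gamma,k}$ be the point where the strict transform of $\Gamma$ meets $D_k$ (and similarly for other curves). A point of $E_k$ is a *trace point* if it lies on exactly one irreducible component of $E_k$. The characteristic divisor $\mathfrak D_j$ is $D_\iota$, where $\iota$ is the first index $m\ge1$ such that the $m$-th infinitely near point of the curve $(t^n,\zeta t^{\beta_j}+\sum_\beta a_{\beta,\Gamma}t^\beta)$ depends on $\zeta$, for $\zeta$ near $0$. **Proposition.** Let $1\le j\le g$ and let $\omega$ be a germ of holomorphic 1-form at $0\in\mathbb C^2$ that belongs to $\hat\Delta^{0,j}_{\mathfrak n(\beta_j),<}$. Then $\omega$ fans $\Gamma$ to genus $j$. Moreover,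 the index $\iota$ above exists, and any family $\{\gamma_s\}_{s\in\mathbb C^*}$ of invariant curves of $\omega=0$ fanning $\Gamma$ to genus $j$ is transverse to $\mathfrak D_j=D_\iota$, in the following sense: for every $s\in\mathbb C^*$ the strict transform of $\gamma_s$ by $\pi_1\circ\dots\circ\pi_\iota$ is smooth, meets $\mathfrak D_j$ at a trace point, and is transverse to $\mathfrak D_j$ there; and every trace point of $E_\iota$ on $\mathfrak D_j$ is attained in this way by some $\gamma_s$. -/

import Mathlib

open scoped Topology PowerSeries

noncomputable section

namespace PlaneBranch

/-! ### Formal and holomorphic 1-forms, arcs and pull-backs -/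

/-- A formal 1-form `A dx + B dy` in two variables; variable `0` is `x`, variable `1` is `y`. -/
@[ext]
structure OneForm where
  A : MvPowerSeries (Fin 2) ℂ
  B : MvPowerSeries (Fin 2) ℂ

/-- A power series in two variables converges on some polydisc centred at the origin. -/
def Converges (f : MvPowerSeries (Fin 2) ℂ) : Prop :=
  ∃ r : ℝ, 0 < r ∧ Summable fun d : Fin 2 →₀ ℕ => ‖MvPowerSeries.coeff d f‖ * r ^ (d 0 + d 1)

/-- `ω` is the Taylor expansion of a germ of holomorphic 1-form at the origin. -/
def OneForm.IsHolomorphic (ω : OneForm) : Prop := Converges ω.A ∧ Converges ω.B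

/-- For `γ(t) = (x(t), y(t))` without constant terms, the series `h(t)` with `γ^* ω = h(t) dt`. -/
def OneForm.pullback {R : Type} [CommRing R] [Algebra ℂ R] (ω : OneForm) (x y : R⟦X⟧) : R⟦X⟧ :=
  (MvPowerSeries.subst ![x, y] ω.A : R⟦X⟧) * PowerSeries.derivative R x +
    (MvPowerSeries.subst ![x, y] ω.B : R⟦X⟧) * PowerSeries.derivative R y

/-- A formal parametrized curve `t ↦ (x(t), y(t))`. -/
abbrev Arc : Type := ℂ⟦X⟧ × ℂ⟦X⟧

/-- The curve parametrized by `γ` is invariant by `ω = 0`, i.e. `γ^* ω ≡ 0`. -/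
def OneForm.Leaves (ω : OneForm) (γ : Arc) : Prop := ω.pullback γ.1 γ.2 = 0

/-! ### Blow-ups along the infinitely near points of a curve

A point of the exceptional divisor of the blow-up of `(0,0)` is a direction `y/x = c` with
`c ∈ ℂ ∪ {∞}`. We centre at it the coordinates `(u, v)` with `(x, y) = (u, u (v + c))` if `c ≠ ∞`,
where the exceptional divisor is `u = 0`, and with `(x, y) = (u v, v)` if `c = ∞`, where the
exceptional divisor is `v = 0`. -/

/-- The blow-down map near the point `c` of the exceptional divisor, applied to an arc. -/
def blowDown (c : OnePoint ℂ) (γ : Arc) : Arc :=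
  match c with
  | OnePoint.infty => (γ.1 * γ.2, γ.2)
  | OnePoint.some c => (γ.1, γ.1 * (γ.2 + PowerSeries.C c))

open Classical in
/-- The point where the strict transform of a (non constant) arc meets the exceptional divisor of
the blow-up of the origin, and that strict transform in the coordinates centred there. -/
def blowUp (γ : Arc) : OnePoint ℂ × Arc :=
  if h : γ.1 ∣ γ.2 then
    (OnePoint.some (PowerSeries.constantCoeff h.choose),
      (γ.1, h.choose - PowerSeries.C (PowerSeries.constantCoeff h.choose)))
  else if h : γ.2 ∣ γ.1 then (OnePoint.infty, (h.choose, γ.2))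
  else (OnePoint.infty, γ)

theorem blowDown_blowUp (γ : Arc) : blowDown (blowUp γ).1 (blowUp γ).2 = γ := by
  obtain ⟨x, y⟩ := γ
  by_cases h : x ∣ y
  · have hs := h.choose_spec
    simp only [blowUp, h, dif_pos, blowDown]
    ext1
    · rfl
    · simp only [sub_add_cancel]
      exact hs.symm
  · have h' : y ∣ x := (ValuationRing.dvd_total x y).resolve_left h
    have hs := h'.choose_spec
    simp only [blowUp, h, h', dif_pos, dif_neg, not_false_eq_true, blowDown]
    ext1
    · simp only
      rw [mul_comm]
      exact hs.symm
    · rfl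

/-- The strict transform of `γ` by the composition of the blow-ups of its first `k` infinitely
near points (starting with the origin), in the coordinates centred at the `k`-th one. -/
def strictTransform (γ : Arc) : ℕ → Arc
  | 0 => γ
  | k + 1 => (blowUp (strictTransform γ k)).2

/-- The `k`-th infinitely near point `P_k` of `γ`, a point of the surface obtained by blowing up
`P_0, …, P_{k-1}`, encoded as the list of its position on the last exceptional divisor `D_k`,
followed by those of `P_{k-1}, …, P_1` on `D_{k-1}, …, D_1`. -/
def nearPoint (γ : Arc) : ℕ → List (OnePoint ℂ)
  | 0 => []
  | k + 1 => (blowUp (strictTransform γ k)).1 :: nearPoint γ k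

/-- Whether the coordinate axes `u = 0` and `v = 0` at an infinitely near point are components of
the total exceptional divisor `E_k`. No other component passes through the point. -/
def axesInDivisor : List (OnePoint ℂ) → Prop × Prop
  | [] => (False, False)
  | OnePoint.infty :: p => ((axesInDivisor p).1, True)
  | OnePoint.some c :: p => (True, (axesInDivisor p).2 ∧ c = 0)

/-- A trace point lies on exactly one irreducible component of the total exceptional divisor. -/
def IsTracePoint (p : List (OnePoint ℂ)) : Prop :=
  Xor (axesInDivisor p).1 (axesInDivisor p).2

/-- The local equation, evaluated on an arc, of the exceptional divisor `D_k` at its point with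
position `c`, in the coordinates centred there. -/
def divisorEquation (c : OnePoint ℂ) (γ : Arc) : ℂ⟦X⟧ :=
  match c with
  | OnePoint.infty => γ.2
  | OnePoint.some _ => γ.1

/-- The strict transform of `γ` by the first `k + 1` blow-ups is a smooth curve transverse to
`D_{k+1}`: it has a parametrization `δ` (from which that induced by `γ` comes by a possibly non
injective change of parameter `φ`) with `δ'(0)` not tangent to `D_{k+1}`. -/
def IsTransverseTo (γ : Arc) (k : ℕ) : Prop :=
  ∃ (δ : Arc) (φ : ℂ⟦X⟧),
    PowerSeries.constantCoeff δ.1 = 0 ∧ PowerSeries.constantCoeff δ.2 = 0 ∧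
    PowerSeries.constantCoeff φ = 0 ∧ φ ≠ 0 ∧
    strictTransform γ (k + 1) = ((PowerSeries.subst φ δ.1 : ℂ⟦X⟧), (PowerSeries.subst φ δ.2 : ℂ⟦X⟧)) ∧
    PowerSeries.coeff 1 (divisorEquation (blowUp (strictTransform γ k)).1 δ) ≠ 0

end PlaneBranch

/-! ### Singular branches and their invariants -/

open PlaneBranch

/-- A singular branch `Γ(t) = (t ^ n, ∑ a_k t ^ k)` of plane curve, with multiplicity `n ≥ 2`,
whose first exponent is not a multiple of `n`. -/
structure PlaneBranch where
  n : ℕ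
  a : ℕ → ℂ
  two_le : 2 ≤ n
  convergent : ∃ r : ℝ, 0 < r ∧ Summable fun k => ‖a k‖ * r ^ k
  irreducible : ∀ d : ℕ, d ∣ n → (∀ k, a k ≠ 0 → d ∣ k) → d = 1
  lt_exponent : ∀ k, a k ≠ 0 → n < k
  first_exponent : ∀ k, a k ≠ 0 → ∃ l ≤ k, a l ≠ 0 ∧ ¬ n ∣ l

namespace PlaneBranch

variable (Γ : PlaneBranch)

/-- The parametrization of `Γ`. -/
def arc : Arc := (PowerSeries.X ^ Γ.n, PowerSeries.mk Γ.a)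

/-- `e_0 = n` and `e_j = gcd (e_{j-1}, β_j)`, with `β_j` the least exponent of `Γ` that is not a
multiple of `e_{j-1}`. -/
def e (Γ : PlaneBranch) : ℕ → ℕ
  | 0 => Γ.n
  | j + 1 => Nat.gcd (e Γ j) (sInf {k | Γ.a k ≠ 0 ∧ ¬ e Γ j ∣ k})

/-- The Puiseux characteristic exponents `β_j`, for `1 ≤ j ≤ g`. -/
def beta (j : ℕ) : ℕ := sInf {k | Γ.a k ≠ 0 ∧ ¬ Γ.e (j - 1) ∣ k}

/-- The number `g` of Puiseux characteristic exponents. -/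
def genus : ℕ := sInf {j | Γ.e j = 1}

/-- The set of exponents `{β_j + k e_j : 1 ≤ j ≤ g, k ≥ 0}`. -/
def exponents : Set ℕ := {b | ∃ j k, 1 ≤ j ∧ j ≤ Γ.genus ∧ b = Γ.beta j + k * Γ.e j}

/-- The next element of the set of exponents. -/
def next (b : ℕ) : ℕ := sInf {b' | b' ∈ Γ.exponents ∧ b < b'}

/-! ### Leading variables -/

/-- The coefficient of `t ^ b`, `b` an exponent, of the generic member of the family of the curves
`(t ^ n, ∑ a_b t ^ b)`, `b` ranging over the exponents, which have the same coefficients as `Γ` for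
`b < β_j`. The free coefficients `a_b`, `b ≥ β_j`, are the variables of a polynomial ring. -/
def genericCoeff (j b : ℕ) : MvPolynomial ℕ ℂ :=
  if b < Γ.beta j then MvPolynomial.C (Γ.a b) else MvPolynomial.X b

open Classical in
/-- The series `g(t)` with `t γ^* ω = g(t) dt`, where `γ` is the generic member of that family. -/
def genericPullback (ω : OneForm) (j : ℕ) : (MvPolynomial ℕ ℂ)⟦X⟧ :=
  PowerSeries.X * ω.pullback (PowerSeries.X ^ Γ.n)
    (PowerSeries.mk fun b => if b ∈ Γ.exponents then Γ.genericCoeff j b else 0)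

/-- The ring of polynomials in the variables `a_b` with `b ≥ β_j` an exponent such that `P b`. -/
def coeffRing (j : ℕ) (P : ℕ → Prop) : Subalgebra ℂ (MvPolynomial ℕ ℂ) :=
  MvPolynomial.supported ℂ {b | b ∈ Γ.exponents ∧ Γ.beta j ≤ b ∧ P b}

open Classical in
/-- The data witnessing that `g(t)` has leading variable `β` of degree `m` for the family attached
to `j`. The sequences indexed by `β`, `next β`, `next (next β)`, … are indexed here by the elements
`b ≥ β` of the set of exponents (their values at other integers are irrelevant). -/
structure LeadingVariable (j β m : ℕ) (g : (MvPolynomial ℕ ℂ)⟦X⟧) where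
  k : ℕ
  C : ℕ → MvPolynomial ℕ ℂ
  R : MvPolynomial ℕ ℂ
  ctilde : ℂ
  c : ℕ → ℂ
  Q : ℕ → MvPolynomial ℕ ℂ
  mem_exponents : β ∈ Γ.exponents
  eq_series : g = PowerSeries.X ^ k *
    PowerSeries.mk fun b => if b ∈ Γ.exponents ∧ β ≤ b then C b else 0
  C_mem : ∀ b ∈ Γ.exponents, β ≤ b → C b ∈ Γ.coeffRing j (· ≤ b)
  C_ne_zero : C β ≠ 0
  R_mem : R ∈ Γ.coeffRing j (· < β)
  ctilde_ne_zero : ctilde ≠ 0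
  c_first : c β = 1
  Q_mem : ∀ b ∈ Γ.exponents, β ≤ b → Q b ∈ Γ.coeffRing j (· < b)
  C_eq : ∀ b ∈ Γ.exponents, β ≤ b →
    C b = MvPolynomial.C (ctilde * c b) * Γ.genericCoeff j β ^ m * R * Γ.genericCoeff j b + Q b
  R_ne_zero : MvPolynomial.eval Γ.a R ≠ 0
  degree_eq_zero : (∀ i, 1 ≤ i → i ≤ j → β ≠ Γ.beta i) → m = 0
  k_modEq : k ≡ m * β
    [MOD Γ.e (((Finset.Icc 1 Γ.genus).filter fun r => Γ.beta r < β).sup id)]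

/-- The `c`-sequence is a strictly increasing sequence of positive rational numbers. -/
def LeadingVariable.StrictlyIncreasing {Γ : PlaneBranch} {j β m : ℕ} {g : (MvPolynomial ℕ ℂ)⟦X⟧}
    (L : Γ.LeadingVariable j β m g) : Prop :=
  ∃ q : ℕ → ℚ, StrictMonoOn q {b | b ∈ Γ.exponents ∧ β ≤ b} ∧
    ∀ b ∈ Γ.exponents, β ≤ b → 0 < q b ∧ L.c b = (q b : ℂ)

/-- The set of the 1-forms with leading variable `next β_j` of degree `0` for the family attached to
`j`, whose `c`-sequence is a strictly increasing sequence of positive rational numbers and whose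
polynomial `R` is of the form `c a_{β_j} ^ s` with `c ≠ 0`. -/
def hatDelta (j : ℕ) : Set OneForm :=
  {ω | ∃ L : Γ.LeadingVariable j (Γ.next (Γ.beta j)) 0 (Γ.genericPullback ω j),
    L.StrictlyIncreasing ∧
    ∃ (c : ℂ) (s : ℕ), c ≠ 0 ∧ L.R = MvPolynomial.C c * MvPolynomial.X (Γ.beta j) ^ s}

/-! ### Fanning families -/

/-- The coefficient of `t ^ m` in
`∑_{b < β_j} a_b t ^ b + s t ^ {β_j} + ∑_{k ≥ 1} b_k(s) t ^ {β_j + k e_j}`. -/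
def familyCoeff (j : ℕ) (b : ℕ → ℂ → ℂ) (s : ℂ) (m : ℕ) : ℂ :=
  if m < Γ.beta j then Γ.a m
  else if m = Γ.beta j then s
  else if Γ.e j ∣ m - Γ.beta j then b ((m - Γ.beta j) / Γ.e j) s
  else 0

/-- A family `{γ_s : s ∈ ℂ^*}` of invariant curves of `ω = 0` fanning `Γ` to genus `j`: a
holomorphic map `(t, s) ↦ (t ^ n, ∑_m familyCoeff m · t ^ m)` on a neighbourhood `U` of `{0} × ℂ^*`
whose restrictions to `s = s_0`, `s_0 ≠ 0`, parametrize invariant curves of `ω = 0`. -/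
structure FanningFamily (ω : OneForm) (j : ℕ) where
  U : Set (ℂ × ℂ)
  P : ℂ × ℂ → ℂ × ℂ
  b : ℕ → ℂ → ℂ
  isOpen : IsOpen U
  mem : ∀ s : ℂ, s ≠ 0 → ((0 : ℂ), s) ∈ U
  holomorphic : DifferentiableOn ℂ P U
  fst_eq : ∀ t s : ℂ, (t, s) ∈ U → (P (t, s)).1 = t ^ Γ.n
  snd_eq : ∀ t s : ℂ, (t, s) ∈ U →
    HasSum (fun m : ℕ => Γ.familyCoeff j b s m * t ^ m) (P (t, s)).2
  invariant : ∀ s : ℂ, s ≠ 0 →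
    ω.Leaves (PowerSeries.X ^ Γ.n, PowerSeries.mk (Γ.familyCoeff j b s))

/-- The parametrization of the member `γ_s` of a fanning family. -/
def FanningFamily.member {Γ : PlaneBranch} {ω : OneForm} {j : ℕ} (F : Γ.FanningFamily ω j) (s : ℂ) :
    Arc :=
  (PowerSeries.X ^ Γ.n, PowerSeries.mk (Γ.familyCoeff j F.b s))

/-- The holomorphic 1-form `ω` fans `Γ` to genus `j`. -/
def Fans (ω : OneForm) (j : ℕ) : Prop :=
  ω.IsHolomorphic ∧ ω ≠ ⟨0, 0⟩ ∧ Nonempty (Γ.FanningFamily ω j)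

/-! ### Characteristic divisors -/

/-- The parametrization of `Γ` plus `ζ t ^ b` in the second coordinate. -/
def perturbation (b : ℕ) (ζ : ℂ) : Arc :=
  (PowerSeries.X ^ Γ.n, PowerSeries.mk Γ.a + PowerSeries.monomial b ζ)

/-- The `j`-th characteristic divisor is `D_ι`, with `ι` the first index `m ≥ 1` such that the
`m`-th infinitely near point of `Γ + ζ t ^ {β_j}` depends on `ζ`, for `ζ` near `0`. -/
def IsCharacteristicIndex (j ι : ℕ) : Prop :=
  IsLeast {m : ℕ | 1 ≤ m ∧
    ¬ ∀ᶠ ζ in 𝓝 (0 : ℂ), nearPoint (Γ.perturbation (Γ.beta j) ζ) m = nearPoint Γ.arc m} ι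

/-- The trace points of the divisor `D_{k+1}`, the exceptional divisor of the blow-up of the `k`-th
infinitely near point of `Γ`. -/
def tracePoints (k : ℕ) : Set (List (OnePoint ℂ)) :=
  {p | IsTracePoint p ∧ ∃ c : OnePoint ℂ, p = c :: nearPoint Γ.arc k}

end PlaneBranch

end

/-! Put β = β_j and e = e_j, let p be the part of Γ below degree β, and write the curves as (t^n, p
+ t^β w). Expanding ω along p turns t γ^*ω into Σ P_l(t) w^l + (Σ D_l(t) w^l) t w'
(`pullback_eq_diffOp`). For w = α + v t^m, with m the gap between β and the next exponent, the
hypothesis says that the first coefficient that may survive is κ α^s v + Q(α), κ ≠ 0. Let K be the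
least t-order among the P_l and D_l. Comparing how v enters in degree K + m gives P_l = t^(K+1) E_l
and D_l = t^K G_l, where G(0, α) = Σ G_l(0) α^l has no zero outside α = 0
(`exists_regular_equation`). Invariance thus reads E(t, w) + G(t, w) w' = 0, a regular differential
equation near every point t = 0, w = s ≠ 0.

The solution with w(0) = s is built degree by degree, dividing only by G(0, s) and by positive
integers, so its coefficients are holomorphic in s. An induction on weighted ℓ¹ norms of truncations
gives convergence locally uniformly in s (`solution_bound`). All P_l and D_l are series in t^e,
hence so is w, and p + t^β w has the shape required of a fanning family (`nonempty_fanningFamily`).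

Transversality uses only the shape (t^n, p + s t^β + …). The infinitely near points follow Euclid's
algorithm on the orders of the two coordinates. After the characteristic exponents below β are
resolved (`exists_stage`), the strict transforms have orders e_(j-1) and b < e_(j-1), with leading
coefficients c and μ s. Subtracting orders multiplies s-powers together without cancellation, so
when the orders meet, at gcd = e, the quotient of the coordinates starts with κ s^k, k > 0
(`exists_characteristic_position`). Up to there nothing depends on s ≠ 0. The last centre is a
corner of the exceptional divisor, so the trace points of the new component are its positions other
than 0 and ∞, all of them of the form κ s^k. The first coordinate is then a series in t^e of order
exactly e, which gives smoothness and transversality after replacing t^e by t. Γ itself has s = a_β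
≠ 0, so the first dependence on ζ also occurs there (`exists_isCharacteristicIndex`). -/

open PowerSeries in
theorem PowerSeries.X_pow_dvd_pow_mul_pow {R : Type*} [CommRing R] {x y : R⟦X⟧}
    (hx : X ∣ x) (hy : X ∣ y) (a b : ℕ) : (X : R⟦X⟧) ^ (a + b) ∣ x ^ a * y ^ b := by
  rw [pow_add]
  exact mul_dvd_mul (pow_dvd_pow_of_dvd hx a) (pow_dvd_pow_of_dvd hy b)

/-! ### Substitution in two variables, series in t^e, and characteristic exponents -/

namespace PlaneBranch

/-- The exponent of the monomial `x ^ a y ^ b`. -/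
noncomputable def bidegree (p : ℕ × ℕ) : Fin 2 →₀ ℕ := Finsupp.single 0 p.1 + Finsupp.single 1 p.2

theorem bidegree_zero (p : ℕ × ℕ) : bidegree p 0 = p.1 := by simp [bidegree]

theorem bidegree_one (p : ℕ × ℕ) : bidegree p 1 = p.2 := by simp [bidegree]

theorem bidegree_injective : Function.Injective bidegree := fun p q h => by
  ext
  · rw [← bidegree_zero, h, bidegree_zero]
  · rw [← bidegree_one, h, bidegree_one]

theorem bidegree_apply (d : Fin 2 →₀ ℕ) : bidegree (d 0, d 1) = d := by
  ext i
  fin_cases i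
  · exact bidegree_zero _
  · exact bidegree_one _

/-- The monomial x^a y^b has order at least a + b, so a finite box of bidegrees suffices. The free
bound N allows all coefficients below N to be compared over one index set. -/
theorem coeff_subst_pair {R : Type} [CommRing R] [Algebra ℂ R] (A : MvPowerSeries (Fin 2) ℂ)
    {x y : R⟦X⟧} (hx : PowerSeries.X ∣ x) (hy : PowerSeries.X ∣ y) {m N : ℕ} (h : m < N) :
    PowerSeries.coeff m (MvPowerSeries.subst ![x, y] A : R⟦X⟧) =
      ∑ p ∈ Finset.range N ×ˢ Finset.range N,
        algebraMap ℂ R (MvPowerSeries.coeff (bidegree p) A) *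
          PowerSeries.coeff m (x ^ p.1 * y ^ p.2) := by
  have hs : MvPowerSeries.HasSubst (![x, y] : Fin 2 → MvPowerSeries Unit R) := by
    apply MvPowerSeries.hasSubst_of_constantCoeff_zero
    intro i
    fin_cases i
    · exact PowerSeries.X_dvd_iff.1 hx
    · exact PowerSeries.X_dvd_iff.1 hy
  have hp : ∀ d : Fin 2 →₀ ℕ, d.prod (fun s e => (![x, y] : Fin 2 → R⟦X⟧) s ^ e) =
      x ^ d 0 * y ^ d 1 := by
    intro d
    rw [Finsupp.prod_fintype _ _ (fun i => pow_zero _), Fin.prod_univ_two]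
    rfl
  rw [PowerSeries.coeff, MvPowerSeries.coeff_subst hs]
  have key : ∀ d : Fin 2 →₀ ℕ, (MvPowerSeries.coeff d A •
      MvPowerSeries.coeff (Finsupp.single () m)
        (d.prod fun s e => (![x, y] : Fin 2 → MvPowerSeries Unit R) s ^ e)) =
      algebraMap ℂ R (MvPowerSeries.coeff d A) * PowerSeries.coeff m (x ^ d 0 * y ^ d 1) := by
    intro d
    rw [Algebra.smul_def]
    congr 1
    rw [PowerSeries.coeff]
    congr 1
    exact hp d
  rw [finsum_congr key]
  rw [finsum_eq_sum_of_support_subset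
    (s := (Finset.range N ×ˢ Finset.range N).map ⟨bidegree, bidegree_injective⟩)]
  · rw [Finset.sum_map]
    simp only [Function.Embedding.coeFn_mk, bidegree_zero, bidegree_one]
    rfl
  · intro d hd
    rw [Function.mem_support] at hd
    simp only [Finset.coe_map, Function.Embedding.coeFn_mk, Set.mem_image, Finset.mem_coe,
      Finset.mem_product, Finset.mem_range]
    refine ⟨(d 0, d 1), ?_, bidegree_apply d⟩
    by_contra hlt
    apply hd
    rw [PowerSeries.X_pow_dvd_iff.1 (PowerSeries.X_pow_dvd_pow_mul_pow hx hy (d 0) (d 1)) m,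
      mul_zero]
    simp only at hlt
    omega

/-- The power series in `t ^ e`. -/
def seriesIn (e : ℕ) : Subalgebra ℂ ℂ⟦X⟧ where
  carrier := {f | ∀ m, ¬ e ∣ m → PowerSeries.coeff m f = 0}
  mul_mem' := by
    intro f g hf hg m hm
    rw [PowerSeries.coeff_mul]
    refine Finset.sum_eq_zero fun p hp => ?_
    rw [Finset.HasAntidiagonal.mem_antidiagonal] at hp
    by_cases h1 : e ∣ p.1
    · rw [hg p.2 fun h2 => hm (hp ▸ dvd_add h1 h2), mul_zero]
    · rw [hf _ h1, zero_mul]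
  add_mem' := by
    intro f g hf hg m hm
    rw [map_add, hf m hm, hg m hm, add_zero]
  algebraMap_mem' := by
    intro c m hm
    rw [PowerSeries.algebraMap_apply, PowerSeries.coeff_C, if_neg]
    rintro rfl
    exact hm (dvd_zero e)

theorem mem_seriesIn {e : ℕ} {f : ℂ⟦X⟧} :
    f ∈ seriesIn e ↔ ∀ m, ¬ e ∣ m → PowerSeries.coeff m f = 0 := Iff.rfl

theorem X_pow_mem_seriesIn {e m : ℕ} (h : e ∣ m) : (PowerSeries.X : ℂ⟦X⟧) ^ m ∈ seriesIn e := by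
  intro k hk
  rw [PowerSeries.coeff_X_pow, if_neg]
  rintro rfl
  exact hk h

theorem C_mem_seriesIn (e : ℕ) (c : ℂ) : PowerSeries.C c ∈ seriesIn e :=
  (seriesIn e).algebraMap_mem c

theorem X_mul_derivative_mem_seriesIn {e : ℕ} {f : ℂ⟦X⟧} (h : f ∈ seriesIn e) :
    PowerSeries.X * PowerSeries.derivative ℂ f ∈ seriesIn e := by
  intro m hm
  cases m with
  | zero => exact absurd (dvd_zero e) hm
  | succ m => rw [PowerSeries.coeff_succ_X_mul, PowerSeries.coeff_derivative, h _ hm, zero_mul]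

/-- If a is the order of u and m the first degree not divisible by e in which w is nonzero, then a +
m is not divisible by e and only the product of these two terms contributes to it. Exact divisions,
and with them blow-ups, therefore stay among series in t^e. -/
theorem mem_seriesIn_of_mul_mem {e : ℕ} {u w : ℂ⟦X⟧} (hu : u ∈ seriesIn e) (hu0 : u ≠ 0)
    (h : u * w ∈ seriesIn e) : w ∈ seriesIn e := by
  by_contra hw
  simp only [mem_seriesIn, not_forall] at hw
  classical
  obtain ⟨hm, hw0⟩ := Nat.find_spec (p := fun m => ∃ _ : ¬ e ∣ m, PowerSeries.coeff m w ≠ 0)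
    (by simpa using hw)
  set m := Nat.find (p := fun m => ∃ _ : ¬ e ∣ m, PowerSeries.coeff m w ≠ 0) (by simpa using hw)
  have hmin : ∀ l < m, ¬ e ∣ l → PowerSeries.coeff l w = 0 := fun l hl hl' => by
    by_contra h0
    exact Nat.find_min _ hl ⟨hl', h0⟩
  have hex : ∃ a, PowerSeries.coeff a u ≠ 0 := by
    by_contra h0
    push Not at h0
    exact hu0 (PowerSeries.ext fun a => by rw [h0, map_zero])
  have ha := Nat.find_spec hex
  set a := Nat.find hex
  have hea : e ∣ a := by
    by_contra h0
    exact ha (hu a h0)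
  have := h (a + m) fun h0 => hm ((Nat.dvd_add_right hea).1 h0)
  rw [PowerSeries.coeff_mul, Finset.sum_eq_single (a, m)] at this
  · exact (mul_ne_zero ha hw0) this
  · rintro ⟨i, l⟩ hil hne
    rw [Finset.HasAntidiagonal.mem_antidiagonal] at hil
    simp only at hil ⊢
    by_cases hia : i < a
    · rw [not_not.1 (Nat.find_min hex hia), zero_mul]
    by_cases hi : e ∣ i
    · have hlm : l < m := by
        rcases lt_or_eq_of_le (not_lt.1 hia) with h1 | h1
        · omega
        · exfalso; apply hne; ext <;> simp <;> omega
      rw [hmin l hlm, mul_zero]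
      intro hl
      apply hm
      rw [← Nat.dvd_add_right hea, ← hil]
      exact dvd_add hi hl
    · rw [hu i hi, zero_mul]
  · intro h0
    exact absurd (by simp) h0

/-! ### Characteristic exponents -/

variable (Γ : PlaneBranch)

theorem e_succ (i : ℕ) : Γ.e (i + 1) = Nat.gcd (Γ.e i) (Γ.beta (i + 1)) := rfl

theorem e_succ_dvd (i : ℕ) : Γ.e (i + 1) ∣ Γ.e i := Nat.gcd_dvd_left _ _

theorem e_succ_dvd_beta (i : ℕ) : Γ.e (i + 1) ∣ Γ.beta (i + 1) := Nat.gcd_dvd_right _ _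

theorem e_dvd_e {i l : ℕ} (h : i ≤ l) : Γ.e l ∣ Γ.e i := by
  induction l, h using Nat.le_induction with
  | base => rfl
  | succ l _ ih => exact (Γ.e_succ_dvd l).trans ih

theorem e_dvd_n (i : ℕ) : Γ.e i ∣ Γ.n := Γ.e_dvd_e (Nat.zero_le i)

theorem e_pos (i : ℕ) : 0 < Γ.e i :=
  Nat.pos_of_dvd_of_pos (Γ.e_dvd_n i) (by have := Γ.two_le; omega)

/-- Otherwise e_i would divide n and every exponent of Γ, and irreducibility would force e_i = 1,
against the minimality of the genus. -/
theorem beta_mem {i : ℕ} (h : i < Γ.genus) :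
    Γ.a (Γ.beta (i + 1)) ≠ 0 ∧ ¬ Γ.e i ∣ Γ.beta (i + 1) := by
  refine Nat.sInf_mem (s := {k | Γ.a k ≠ 0 ∧ ¬ Γ.e i ∣ k}) ?_
  by_contra h0
  rw [Set.not_nonempty_iff_eq_empty, Set.eq_empty_iff_forall_notMem] at h0
  refine Nat.notMem_of_lt_sInf h (Γ.irreducible _ (Γ.e_dvd_n i) fun k hk => ?_)
  by_contra h1
  exact h0 k ⟨hk, h1⟩

theorem e_dvd_of_lt_beta {i k : ℕ} (hk : Γ.a k ≠ 0) (h : k < Γ.beta (i + 1)) : Γ.e i ∣ k := by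
  by_contra h0
  exact Nat.notMem_of_lt_sInf h ⟨hk, h0⟩

theorem n_lt_beta {i : ℕ} (h : i < Γ.genus) : Γ.n < Γ.beta (i + 1) :=
  Γ.lt_exponent _ (Γ.beta_mem h).1

theorem beta_lt_beta_succ {i : ℕ} (h : i + 1 < Γ.genus) :
    Γ.beta (i + 1) < Γ.beta (i + 2) := by
  obtain ⟨h1, h2⟩ := Γ.beta_mem h
  refine lt_of_le_of_ne (Nat.sInf_le ⟨h1, fun h0 => h2 ((Γ.e_succ_dvd i).trans h0)⟩) fun h0 => ?_
  exact h2 (h0 ▸ Γ.e_succ_dvd_beta i)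

theorem beta_lt_beta {i l : ℕ} (hi : 1 ≤ i) (h : i < l) (hl : l ≤ Γ.genus) :
    Γ.beta i < Γ.beta l := by
  obtain ⟨i, rfl⟩ := Nat.exists_eq_add_of_le' hi
  induction l, h using Nat.le_induction with
  | base => exact Γ.beta_lt_beta_succ (by omega)
  | succ l hl' ih =>
    obtain ⟨l, rfl⟩ := Nat.exists_eq_add_of_le' (show 1 ≤ l by omega)
    exact (ih (by omega)).trans (Γ.beta_lt_beta_succ (by omega))

/-- Between two consecutive characteristic exponents β_i and β_(i+1) every exponent of Γ is a
multiple of e_i, as is β_i. Hence restricting the generic curve to `exponents` loses no term of Γ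
below β_j. -/
theorem mem_exponents_of_lt_beta {i b : ℕ} (hi : i ≤ Γ.genus) (hb : Γ.a b ≠ 0)
    (hlt : b < Γ.beta i) : b ∈ Γ.exponents := by
  induction i with
  | zero =>
    have h0 : b < Γ.beta (0 + 1) := hlt
    obtain ⟨l, hl, h1, h2⟩ := Γ.first_exponent b hb
    exact absurd (Γ.e_dvd_of_lt_beta (i := 0) h1 (by omega)) h2
  | succ i ih =>
    by_cases h : b < Γ.beta i
    · exact ih (by omega) h
    · rcases Nat.eq_zero_or_pos i with rfl | hpos
      · exact ih (by omega) hlt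
      · have h1 : Γ.e i ∣ b := Γ.e_dvd_of_lt_beta hb hlt
        have h2 : Γ.e i ∣ Γ.beta i := by
          obtain ⟨i, rfl⟩ := Nat.exists_eq_add_of_le' hpos
          exact Γ.e_succ_dvd_beta i
        obtain ⟨k, hk⟩ := Nat.dvd_sub h1 h2
        refine ⟨i, k, hpos, by omega, ?_⟩
        rw [mul_comm, ← hk]; omega

theorem exponents_pos {b : ℕ} (h : b ∈ Γ.exponents) : 0 < b := by
  obtain ⟨i, k, h1, h2, rfl⟩ := h
  obtain ⟨i, rfl⟩ := Nat.exists_eq_add_of_le' h1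
  have := Γ.n_lt_beta (i := i) (by omega)
  omega

theorem next_mem {b : ℕ} (hg : 1 ≤ Γ.genus) : Γ.next b ∈ Γ.exponents ∧ b < Γ.next b := by
  refine Nat.sInf_mem (s := {b' | b' ∈ Γ.exponents ∧ b < b'})
    ⟨Γ.beta 1 + (b + 1) * Γ.e 1, ⟨1, b + 1, le_rfl, hg, rfl⟩, ?_⟩
  have := Nat.le_mul_of_pos_right (b + 1) (Γ.e_pos 1)
  omega

end PlaneBranch

namespace PlaneBranch

open PowerSeries (X C coeff)

/-! ### Truncated weighted norms -/

/-- The weighted `ℓ¹` norm of the truncation of a power series below degree `N`. -/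
noncomputable def truncNorm (r : ℝ) (N : ℕ) (f : ℂ⟦X⟧) : ℝ := ∑ m ∈ Finset.range N, ‖coeff m f‖ * r ^ m

section truncNorm

variable {r : ℝ}

theorem truncNorm_nonneg (hr : 0 ≤ r) (N : ℕ) (f : ℂ⟦X⟧) : 0 ≤ truncNorm r N f :=
  Finset.sum_nonneg fun m _ => by positivity

theorem truncNorm_mono_right (hr : 0 ≤ r) (N : ℕ) {M : ℕ} (h : N ≤ M) (f : ℂ⟦X⟧) :
    truncNorm r N f ≤ truncNorm r M f :=
  Finset.sum_le_sum_of_subset_of_nonneg (Finset.range_mono h) fun m _ _ => by positivity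

theorem truncNorm_mono_left (hr : 0 ≤ r) (N : ℕ) {r' : ℝ} (h : r ≤ r') (f : ℂ⟦X⟧) :
    truncNorm r N f ≤ truncNorm r' N f :=
  Finset.sum_le_sum fun m _ => by gcongr

theorem truncNorm_add_le (hr : 0 ≤ r) (N : ℕ) (f g : ℂ⟦X⟧) :
    truncNorm r N (f + g) ≤ truncNorm r N f + truncNorm r N g := by
  rw [truncNorm, truncNorm, truncNorm, ← Finset.sum_add_distrib]
  refine Finset.sum_le_sum fun m _ => ?_
  rw [map_add, ← add_mul]
  gcongr
  exact norm_add_le _ _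

theorem truncNorm_zero (N : ℕ) : truncNorm r N 0 = 0 := by simp [truncNorm]

theorem truncNorm_sum_le (hr : 0 ≤ r) (N : ℕ) {ι : Type*} (s : Finset ι) (f : ι → ℂ⟦X⟧) :
    truncNorm r N (∑ i ∈ s, f i) ≤ ∑ i ∈ s, truncNorm r N (f i) :=
  Finset.le_sum_of_subadditive _ (truncNorm_zero N).le (truncNorm_add_le hr N) s f

theorem truncNorm_neg (N : ℕ) (f : ℂ⟦X⟧) : truncNorm r N (-f) = truncNorm r N f := by
  simp [truncNorm]

theorem truncNorm_C_mul (N : ℕ) (c : ℂ) (f : ℂ⟦X⟧) :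
    truncNorm r N (C c * f) = ‖c‖ * truncNorm r N f := by
  simp [truncNorm, Finset.mul_sum, mul_assoc]

theorem truncNorm_congr (N : ℕ) {f g : ℂ⟦X⟧} (h : ∀ m < N, coeff m f = coeff m g) :
    truncNorm r N f = truncNorm r N g :=
  Finset.sum_congr rfl fun m hm => by rw [h m (Finset.mem_range.1 hm)]

theorem truncNorm_C_le (N : ℕ) (c : ℂ) : truncNorm r N (C c) ≤ ‖c‖ := by
  cases N with
  | zero => simp [truncNorm]
  | succ N => simp [truncNorm, Finset.sum_range_succ', PowerSeries.coeff_C]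

theorem truncNorm_X_mul (N : ℕ) (f : ℂ⟦X⟧) : truncNorm r (N + 1) (X * f) = r * truncNorm r N f := by
  rw [truncNorm, Finset.sum_range_succ']
  simp only [PowerSeries.coeff_succ_X_mul, PowerSeries.coeff_zero_X_mul, norm_zero, zero_mul,
    add_zero, truncNorm, Finset.mul_sum, pow_succ]
  exact Finset.sum_congr rfl fun m _ => by ring

theorem truncNorm_mul_le (hr : 0 ≤ r) (N : ℕ) (f g : ℂ⟦X⟧) :
    truncNorm r N (f * g) ≤ truncNorm r N f * truncNorm r N g := by
  have h1 : truncNorm r N (f * g) ≤ ∑ m ∈ Finset.range N,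
      ∑ p ∈ Finset.HasAntidiagonal.antidiagonal m, (‖coeff p.1 f‖ * r ^ p.1) * (‖coeff p.2 g‖ * r ^ p.2) := by
    refine Finset.sum_le_sum fun m _ => ?_
    rw [PowerSeries.coeff_mul]
    refine (mul_le_mul_of_nonneg_right (norm_sum_le _ _) (by positivity)).trans ?_
    rw [Finset.sum_mul]
    refine Finset.sum_le_sum fun p hp => ?_
    rw [norm_mul, ← Finset.HasAntidiagonal.mem_antidiagonal.1 hp, pow_add]
    exact le_of_eq (by ring)
  refine h1.trans ?_
  rw [Finset.sum_sigma', truncNorm, truncNorm, Finset.sum_mul_sum, ← Finset.sum_product']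
  rw [← Finset.sum_image (s := (Finset.range N).sigma fun m => Finset.HasAntidiagonal.antidiagonal m)
    (g := fun q => q.2)
    (f := fun p : ℕ × ℕ => (‖coeff p.1 f‖ * r ^ p.1) * (‖coeff p.2 g‖ * r ^ p.2))]
  · refine Finset.sum_le_sum_of_subset_of_nonneg ?_ fun p _ _ => by positivity
    intro p hp
    simp only [Finset.mem_image, Finset.mem_sigma, Finset.mem_range,
      Finset.HasAntidiagonal.mem_antidiagonal] at hp
    obtain ⟨⟨m, q⟩, ⟨h2, h3⟩, rfl⟩ := hp
    simp only at h2 h3 ⊢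
    rw [Finset.mem_product, Finset.mem_range, Finset.mem_range]
    omega
  · rintro ⟨m, q⟩ h2 ⟨m', q'⟩ h3 h4
    simp only [Finset.coe_sigma, Set.mem_sigma_iff, Finset.mem_coe,
      Finset.HasAntidiagonal.mem_antidiagonal] at h2 h3 h4
    subst h4
    obtain rfl : m = m' := by omega
    rfl

theorem truncNorm_pow_le (hr : 0 ≤ r) (N : ℕ) (f : ℂ⟦X⟧) (l : ℕ) : truncNorm r N (f ^ l) ≤ truncNorm r N f ^ l := by
  induction l with
  | zero =>
    rw [pow_zero, pow_zero]
    simpa using truncNorm_C_le N 1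
  | succ l ih =>
    rw [pow_succ, pow_succ]
    exact (truncNorm_mul_le hr N _ _).trans
      (mul_le_mul_of_nonneg_right ih (truncNorm_nonneg hr N f))

theorem truncNorm_X_le (hr : 0 ≤ r) (N : ℕ) : truncNorm r N X ≤ r := by
  cases N with
  | zero => simpa [truncNorm] using hr
  | succ N =>
    rw [← mul_one (X : ℂ⟦X⟧), truncNorm_X_mul]
    have := truncNorm_C_le (r := r) N 1
    rw [map_one, norm_one] at this
    exact mul_le_of_le_one_right hr this

theorem truncNorm_X_pow_le (hr : 0 ≤ r) (N : ℕ) (l : ℕ) : truncNorm r N (X ^ l) ≤ r ^ l :=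
  (truncNorm_pow_le hr N X l).trans
    (pow_le_pow_left₀ (truncNorm_nonneg hr N X) (truncNorm_X_le hr N) l)

theorem truncNorm_X_pow_mul (N : ℕ) (l : ℕ) (f : ℂ⟦X⟧) :
    truncNorm r (N + l) (X ^ l * f) = r ^ l * truncNorm r N f := by
  induction l with
  | zero => simp
  | succ l ih => rw [pow_succ', mul_assoc, ← add_assoc, truncNorm_X_mul, ih, pow_succ']; ring

/-- When both constant terms vanish, the coefficient of degree N of the product involves only lower
coefficients of each factor. This gain of one degree drives the induction in `solution_bound`. -/
theorem truncNorm_mul_le_of_X_dvd (hr : 0 ≤ r) (N : ℕ) {f g : ℂ⟦X⟧} (hf : X ∣ f) (hg : X ∣ g) :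
    truncNorm r (N + 1) (f * g) ≤ truncNorm r N f * truncNorm r N g := by
  cases N with
  | zero =>
    obtain ⟨f, rfl⟩ := hf
    rw [mul_assoc, truncNorm_X_mul]
    simp [truncNorm]
  | succ N =>
    obtain ⟨f, rfl⟩ := hf
    obtain ⟨g, rfl⟩ := hg
    rw [show X * f * (X * g) = X * (X * (f * g)) by ring]
    simp only [truncNorm_X_mul]
    have := mul_le_mul_of_nonneg_left (truncNorm_mul_le hr N f g) (mul_nonneg hr hr)
    linarith

/-- The truncations of a polynomial have bounded norms, which tend to the norm of its constant
coefficient as the radius tends to `0`. -/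
theorem truncNorm_le_of_coeff_eq_zero (N : ℕ) {f : ℂ⟦X⟧} {B : ℕ} (hf : ∀ m, B ≤ m → coeff m f = 0)
    (h0 : coeff 0 f = 0) (hr0 : 0 ≤ r) (hr1 : r ≤ 1) :
    truncNorm r N f ≤ r * truncNorm 1 B f := by
  have h1 : truncNorm r N f ≤ truncNorm r B f := by
    rcases le_total N B with h | h
    · exact truncNorm_mono_right hr0 N h f
    · rw [truncNorm, truncNorm]
      rw [Finset.sum_subset (Finset.range_mono h)]
      intro m _ hm
      rw [hf m (by simpa using hm), norm_zero, zero_mul]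
  refine h1.trans ?_
  rw [truncNorm, truncNorm, Finset.mul_sum]
  refine Finset.sum_le_sum fun m _ => ?_
  cases m with
  | zero => simp [h0]
  | succ m =>
    rw [one_pow, mul_one, mul_comm]
    refine mul_le_mul_of_nonneg_right ?_ (norm_nonneg _)
    exact pow_le_of_le_one hr0 hr1 (Nat.succ_ne_zero m)

end truncNorm

/-! ### Families of power series with controlled growth -/

/-- The sequence `f` of power series defines, near every compact subset of `{0} × ℂ`, a convergent
series `∑ f l * w ^ l`. -/
def Controlled (f : ℕ → ℂ⟦X⟧) : Prop :=
  ∀ ρ : ℝ, 0 ≤ ρ → ∃ r : ℝ, 0 < r ∧ ∀ r' : ℝ, 0 < r' → r' ≤ r → ∃ M : ℝ, 0 ≤ M ∧ ∀ N L : ℕ,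
    ∑ l ∈ Finset.range L, truncNorm r' N (f l) * ρ ^ l ≤ M

theorem Controlled.add {f g : ℕ → ℂ⟦X⟧} (hf : Controlled f) (hg : Controlled g) :
    Controlled fun l => f l + g l := by
  intro ρ hρ
  obtain ⟨r1, h1, H1⟩ := hf ρ hρ
  obtain ⟨r2, h2, H2⟩ := hg ρ hρ
  refine ⟨min r1 r2, lt_min h1 h2, fun r' h0 hr' => ?_⟩
  obtain ⟨M1, hM1, H1⟩ := H1 r' h0 (hr'.trans (min_le_left _ _))
  obtain ⟨M2, hM2, H2⟩ := H2 r' h0 (hr'.trans (min_le_right _ _))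
  refine ⟨M1 + M2, by positivity, fun N L => le_trans ?_ (add_le_add (H1 N L) (H2 N L))⟩
  rw [← Finset.sum_add_distrib]
  refine Finset.sum_le_sum fun l _ => ?_
  rw [← add_mul]
  exact mul_le_mul_of_nonneg_right (truncNorm_add_le h0.le N _ _) (by positivity)

theorem Controlled.mul_left {f : ℕ → ℂ⟦X⟧} (hf : Controlled f) {q : ℂ⟦X⟧} {B : ℕ}
    (hq : ∀ m, B ≤ m → coeff m q = 0) : Controlled fun l => q * f l := by
  intro ρ hρ
  obtain ⟨r, h, H⟩ := hf ρ hρ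
  refine ⟨r, h, fun r' h0 hr' => ?_⟩
  obtain ⟨M, hM, H⟩ := H r' h0 hr'
  refine ⟨truncNorm r' B q * M, mul_nonneg (truncNorm_nonneg h0.le _ _) hM, fun N L => ?_⟩
  refine le_trans ?_ (mul_le_mul_of_nonneg_left (H N L) (truncNorm_nonneg h0.le B q))
  rw [Finset.mul_sum]
  refine Finset.sum_le_sum fun l _ => ?_
  rw [← mul_assoc]
  refine mul_le_mul_of_nonneg_right ((truncNorm_mul_le h0.le N _ _).trans
    (mul_le_mul_of_nonneg_right ?_ (truncNorm_nonneg h0.le _ _))) (by positivity)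
  rcases le_total N B with h' | h'
  · exact truncNorm_mono_right h0.le N h' q
  · rw [truncNorm, truncNorm, Finset.sum_subset (Finset.range_mono h')]
    intro m _ hm
    rw [hq m (by simpa using hm), norm_zero, zero_mul]

/-- The sequence `0, f 0, f 1, …`. -/
noncomputable def shift (f : ℕ → ℂ⟦X⟧) : ℕ → ℂ⟦X⟧
  | 0 => 0
  | l + 1 => f l

theorem Controlled.shift {f : ℕ → ℂ⟦X⟧} (hf : Controlled f) : Controlled (shift f) := by
  intro ρ hρ
  obtain ⟨r, h, H⟩ := hf ρ hρ
  refine ⟨r, h, fun r' h0 hr' => ?_⟩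
  obtain ⟨M, hM, H⟩ := H r' h0 hr'
  refine ⟨ρ * M, mul_nonneg hρ hM, fun N L => ?_⟩
  cases L with
  | zero => simpa using mul_nonneg hρ hM
  | succ L =>
    refine le_trans ?_ (mul_le_mul_of_nonneg_left (H N L) hρ)
    rw [Finset.sum_range_succ', Finset.mul_sum]
    simp only [PlaneBranch.shift, truncNorm_zero, zero_mul, add_zero]
    exact Finset.sum_le_sum fun l _ => le_of_eq (by ring)

/-- Division by t^k costs a factor r'^(-k), harmless because the bound in `Controlled` is chosen
after the radius. -/
theorem Controlled.of_X_pow_mul {f g : ℕ → ℂ⟦X⟧} (hf : Controlled f) {k : ℕ}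
    (h : ∀ l, f l = X ^ k * g l) : Controlled g := by
  intro ρ hρ
  obtain ⟨r, hr, H⟩ := hf ρ hρ
  refine ⟨r, hr, fun r' h0 hr' => ?_⟩
  obtain ⟨M, hM, H⟩ := H r' h0 hr'
  refine ⟨M / r' ^ k, by positivity, fun N L => ?_⟩
  rw [le_div_iff₀ (by positivity)]
  refine le_trans (le_of_eq ?_) (H (N + k) L)
  rw [Finset.sum_mul]
  refine Finset.sum_congr rfl fun l _ => ?_
  rw [h l, truncNorm_X_pow_mul]
  ring

end PlaneBranch

namespace PlaneBranch

open PowerSeries (X C coeff)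

/-! ### Taylor expansion of a series along a curve -/

/-- The coefficients of the powers of `w` in the expansion of `A (t ^ n, p + t ^ b w)`. -/
noncomputable def taylor (A : MvPowerSeries (Fin 2) ℂ) (n b : ℕ) (p : ℂ⟦X⟧) (l : ℕ) : ℂ⟦X⟧ :=
  PowerSeries.mk fun m => ∑ q ∈ Finset.range (m + 1) ×ˢ Finset.range (m + 1),
    MvPowerSeries.coeff (bidegree q) A *
      coeff m (C (q.2.choose l : ℂ) * (X ^ (n * q.1) * p ^ (q.2 - l) * X ^ (b * l)))

section taylor

variable (A : MvPowerSeries (Fin 2) ℂ) {n b : ℕ} {p : ℂ⟦X⟧}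

theorem X_pow_dvd_taylor_term (hn : 0 < n) (hb : 0 < b) (hp : X ∣ p) (q : ℕ × ℕ) (l : ℕ) :
    (X : ℂ⟦X⟧) ^ (q.1 + q.2) ∣
      C (q.2.choose l : ℂ) * (X ^ (n * q.1) * p ^ (q.2 - l) * X ^ (b * l)) := by
  by_cases h : q.2 < l
  · simp [Nat.choose_eq_zero_of_lt h]
  · refine Dvd.dvd.mul_left ?_ _
    rw [show q.1 + q.2 = q.1 + (q.2 - l) + l by omega, pow_add, pow_add]
    refine mul_dvd_mul (mul_dvd_mul ?_ (pow_dvd_pow_of_dvd hp _)) ?_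
    · exact pow_dvd_pow _ (Nat.le_mul_of_pos_left _ hn)
    · exact pow_dvd_pow _ (Nat.le_mul_of_pos_left _ hb)

theorem coeff_taylor (hn : 0 < n) (hb : 0 < b) (hp : X ∣ p) (l : ℕ) {m N : ℕ} (h : m < N) :
    coeff m (taylor A n b p l) = ∑ q ∈ Finset.range N ×ˢ Finset.range N,
      MvPowerSeries.coeff (bidegree q) A *
        coeff m (C (q.2.choose l : ℂ) * (X ^ (n * q.1) * p ^ (q.2 - l) * X ^ (b * l))) := by
  rw [taylor, PowerSeries.coeff_mk]
  refine Finset.sum_subset (Finset.product_subset_product (Finset.range_mono h)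
    (Finset.range_mono h)) fun q _ hq => ?_
  rw [PowerSeries.X_pow_dvd_iff.1 (X_pow_dvd_taylor_term hn hb hp q l), mul_zero]
  simp only [Finset.mem_product, Finset.mem_range, not_and_or, not_lt] at hq
  omega

/-- Each w comes with a factor t^b, b > 0, so only finitely many powers of w matter in a given
degree. -/
theorem X_pow_dvd_taylor (hb : 0 < b) (l : ℕ) : X ^ l ∣ taylor A n b p l := by
  rw [PowerSeries.X_pow_dvd_iff]
  intro m hm
  rw [taylor, PowerSeries.coeff_mk]
  refine Finset.sum_eq_zero fun q _ => ?_
  have h : (X : ℂ⟦X⟧) ^ l ∣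
      C (q.2.choose l : ℂ) * (X ^ (n * q.1) * p ^ (q.2 - l) * X ^ (b * l)) :=
    Dvd.dvd.mul_left (Dvd.dvd.mul_left (pow_dvd_pow _ (Nat.le_mul_of_pos_left _ hb)) _) _
  rw [PowerSeries.X_pow_dvd_iff.1 h m hm, mul_zero]

theorem taylor_mem_seriesIn {e : ℕ} (hen : e ∣ n) (heb : e ∣ b) (hep : p ∈ seriesIn e) (l : ℕ) :
    taylor A n b p l ∈ seriesIn e := by
  intro m hm
  rw [taylor, PowerSeries.coeff_mk]
  refine Finset.sum_eq_zero fun q _ => ?_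
  have h : C (q.2.choose l : ℂ) * (X ^ (n * q.1) * p ^ (q.2 - l) * X ^ (b * l)) ∈ seriesIn e :=
    mul_mem (C_mem_seriesIn e _) (mul_mem (mul_mem (X_pow_mem_seriesIn (hen.mul_right _))
      (pow_mem hep _)) (X_pow_mem_seriesIn (heb.mul_right _)))
  rw [h m hm, mul_zero]

/-- The binomial theorem for (p + t^b w)^k, applied to the finitely many monomials that are visible
below degree N. -/
theorem subst_eq_taylor (hn : 0 < n) (hb : 0 < b) (hp : X ∣ p) (w : ℂ⟦X⟧) (N : ℕ) :
    X ^ N ∣ (MvPowerSeries.subst ![X ^ n, p + X ^ b * w] A : ℂ⟦X⟧) -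
      ∑ l ∈ Finset.range N, taylor A n b p l * w ^ l := by
  rw [PowerSeries.X_pow_dvd_iff]
  intro m hm
  have hpw : X ∣ p + X ^ b * w := dvd_add hp (Dvd.dvd.mul_right (dvd_pow_self _ hb.ne') _)
  rw [map_sub, coeff_subst_pair A (dvd_pow_self _ hn.ne') hpw hm, sub_eq_zero, map_sum]
  have h1 : ∀ l, coeff m (taylor A n b p l * w ^ l) =
      ∑ q ∈ Finset.range N ×ˢ Finset.range N, MvPowerSeries.coeff (bidegree q) A *
        coeff m (C (q.2.choose l : ℂ) * (X ^ (n * q.1) * p ^ (q.2 - l) * X ^ (b * l)) * w ^ l) := by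
    intro l
    simp only [PowerSeries.coeff_mul _ _ (w ^ l), Finset.mul_sum]
    rw [Finset.sum_comm]
    refine Finset.sum_congr rfl fun i hi => ?_
    rw [coeff_taylor A hn hb hp l (N := N), Finset.sum_mul]
    · exact Finset.sum_congr rfl fun q _ => by ring
    · rw [Finset.HasAntidiagonal.mem_antidiagonal] at hi
      omega
  rw [Finset.sum_congr rfl fun l _ => h1 l, Finset.sum_comm]
  refine Finset.sum_congr rfl fun q hq => ?_
  rw [Finset.mem_product, Finset.mem_range, Finset.mem_range] at hq
  rw [← Finset.mul_sum, ← map_sum, Algebra.algebraMap_self_apply]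
  congr 2
  rw [add_comm p, add_pow, Finset.mul_sum]
  rw [Finset.sum_subset (Finset.range_mono (show q.2 + 1 ≤ N from hq.2))]
  · refine Finset.sum_congr rfl fun l _ => ?_
    rw [← pow_mul, mul_pow, ← pow_mul, map_natCast]
    ring
  · intro l _ hl
    rw [Nat.choose_eq_zero_of_lt (by simpa using hl)]
    simp

/-- Summing over l first reassembles the binomial coefficients into (‖p‖ + r'^b ρ)^k, which is at
most R^k for small r'; what remains is the absolutely convergent series of A at radius R. -/
theorem controlled_taylor (hn : 0 < n) (hb : 0 < b) (hp : X ∣ p) (hA : Converges A)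
    {B : ℕ} (hB : ∀ m, B ≤ m → coeff m p = 0) : Controlled (taylor A n b p) := by
  intro ρ hρ
  obtain ⟨R, hR, hsum⟩ := hA
  set c := truncNorm 1 B p
  have hc : 0 ≤ c := truncNorm_nonneg zero_le_one B p
  -- Since p has no constant term, ‖p‖ ≤ r' c for r' ≤ 1, and r'^b ≤ r'; so the last bound gives ‖p‖
  -- + r'^b ρ ≤ R. The bound r' ≤ R handles the powers of t^n.
  set r := min 1 (min R (R / (c + ρ + 1)))
  have hr : 0 < r := lt_min one_pos (lt_min hR (by positivity))
  refine ⟨r, hr, fun r' h0 hr' => 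
    ⟨∑' d : Fin 2 →₀ ℕ, ‖MvPowerSeries.coeff d A‖ * R ^ (d 0 + d 1),
      tsum_nonneg fun d => by positivity, fun N L => ?_⟩⟩
  have hr1 : r' ≤ 1 := hr'.trans (min_le_left _ _)
  have hrR : r' ≤ R := hr'.trans ((min_le_right _ _).trans (min_le_left _ _))
  have hrc : r' * (c + ρ + 1) ≤ R := by
    rw [← le_div_iff₀ (by positivity)]
    exact hr'.trans ((min_le_right _ _).trans (min_le_right _ _))
  have hp0 : coeff 0 p = 0 := by
    rw [PowerSeries.coeff_zero_eq_constantCoeff]; exact PowerSeries.X_dvd_iff.1 hp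
  have hpN : truncNorm r' N p ≤ r' * c := truncNorm_le_of_coeff_eq_zero N hB hp0 h0.le hr1
  have hbase : truncNorm r' N p + r' ^ b * ρ ≤ R := by
    have : r' ^ b ≤ r' := pow_le_of_le_one h0.le hr1 hb.ne'
    nlinarith
  have hpos := truncNorm_nonneg h0.le N p
  have hterm : ∀ l, truncNorm r' N (taylor A n b p l) ≤
      ∑ q ∈ Finset.range N ×ˢ Finset.range N, ‖MvPowerSeries.coeff (bidegree q) A‖ *
        (q.2.choose l * (R ^ q.1 * truncNorm r' N p ^ (q.2 - l) * (r' ^ b) ^ l)) := by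
    intro l
    have : truncNorm r' N (taylor A n b p l) = truncNorm r' N
        (∑ q ∈ Finset.range N ×ˢ Finset.range N, C (MvPowerSeries.coeff (bidegree q) A) *
          (C (q.2.choose l : ℂ) * (X ^ (n * q.1) * p ^ (q.2 - l) * X ^ (b * l)))) := by
      apply truncNorm_congr
      intro m hm
      rw [coeff_taylor A hn hb hp l hm, map_sum]
      simp only [PowerSeries.coeff_C_mul]
    rw [this]
    refine (truncNorm_sum_le h0.le N _ _).trans (Finset.sum_le_sum fun q _ => ?_)
    rw [truncNorm_C_mul, truncNorm_C_mul, Complex.norm_natCast]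
    gcongr
    refine (truncNorm_mul_le h0.le N _ _).trans ?_
    gcongr
    · exact truncNorm_nonneg h0.le N _
    · refine (truncNorm_mul_le h0.le N _ _).trans ?_
      gcongr
      · exact truncNorm_nonneg h0.le N _
      · refine (truncNorm_X_pow_le h0.le N _).trans ?_
        rw [pow_mul]
        refine pow_le_pow_left₀ (by positivity) ?_ _
        exact (pow_le_of_le_one h0.le hr1 hn.ne').trans hrR
      · exact truncNorm_pow_le h0.le N _ _
    · rw [← pow_mul]
      exact truncNorm_X_pow_le h0.le N _
  calc ∑ l ∈ Finset.range L, truncNorm r' N (taylor A n b p l) * ρ ^ l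
      ≤ ∑ l ∈ Finset.range L, (∑ q ∈ Finset.range N ×ˢ Finset.range N,
          ‖MvPowerSeries.coeff (bidegree q) A‖ *
          (q.2.choose l * (R ^ q.1 * truncNorm r' N p ^ (q.2 - l) * (r' ^ b) ^ l))) * ρ ^ l := by
        gcongr with l _
        exact hterm l
    _ = ∑ q ∈ Finset.range N ×ˢ Finset.range N, ‖MvPowerSeries.coeff (bidegree q) A‖ * (R ^ q.1 *
          ∑ l ∈ Finset.range L,
            (r' ^ b * ρ) ^ l * truncNorm r' N p ^ (q.2 - l) * q.2.choose l) := by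
        simp only [Finset.sum_mul, Finset.mul_sum]
        rw [Finset.sum_comm]
        refine Finset.sum_congr rfl fun q _ => Finset.sum_congr rfl fun l _ => ?_
        rw [mul_pow]
        ring
    _ ≤ ∑ q ∈ Finset.range N ×ˢ Finset.range N, ‖MvPowerSeries.coeff (bidegree q) A‖ *
          (R ^ q.1 * R ^ q.2) := by
        gcongr with q _
        calc _ ≤ ∑ l ∈ Finset.range (max L (q.2 + 1)),
            (r' ^ b * ρ) ^ l * truncNorm r' N p ^ (q.2 - l) * q.2.choose l := by
              refine Finset.sum_le_sum_of_subset_of_nonneg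
                (Finset.range_mono (le_max_left _ _)) fun l _ _ => by positivity
          _ = ∑ l ∈ Finset.range (q.2 + 1),
            (r' ^ b * ρ) ^ l * truncNorm r' N p ^ (q.2 - l) * q.2.choose l := by
              symm
              refine Finset.sum_subset (Finset.range_mono (le_max_right _ _)) fun l _ hl => ?_
              rw [Nat.choose_eq_zero_of_lt (by simpa using hl), Nat.cast_zero, mul_zero]
          _ = (r' ^ b * ρ + truncNorm r' N p) ^ q.2 := (add_pow _ _ _).symm
          _ ≤ R ^ q.2 := by
              refine pow_le_pow_left₀ (by positivity) ?_ _
              rw [add_comm]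
              exact hbase
    _ = ∑ d ∈ (Finset.range N ×ˢ Finset.range N).map ⟨bidegree, bidegree_injective⟩,
          ‖MvPowerSeries.coeff d A‖ * R ^ (d 0 + d 1) := by
        rw [Finset.sum_map]
        refine Finset.sum_congr rfl fun q _ => ?_
        simp only [Function.Embedding.coeFn_mk, bidegree_zero, bidegree_one, pow_add]
    _ ≤ _ := hsum.sum_le_tsum _ fun d _ => by positivity

end taylor

end PlaneBranch

/-! ### The pull-back as a first order differential operator in w -/

namespace PlaneBranch

open PowerSeries (X C coeff)

/-- `X * d/dX`. -/
noncomputable def euler (f : ℂ⟦X⟧) : ℂ⟦X⟧ := X * PowerSeries.derivative ℂ f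

theorem coeff_euler (f : ℂ⟦X⟧) (m : ℕ) : coeff m (euler f) = m * coeff m f := by
  cases m with
  | zero => simp [euler]
  | succ m =>
    rw [euler, PowerSeries.coeff_succ_X_mul, PowerSeries.coeff_derivative]
    push_cast
    ring

theorem X_dvd_euler (f : ℂ⟦X⟧) : X ∣ euler f := Dvd.intro _ rfl

theorem euler_add (f g : ℂ⟦X⟧) : euler (f + g) = euler f + euler g := by
  simp [euler, mul_add]

theorem euler_mul (f g : ℂ⟦X⟧) : euler (f * g) = euler f * g + f * euler g := by
  rw [euler, euler, euler, Derivation.leibniz, smul_eq_mul, smul_eq_mul]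
  ring

theorem euler_X_pow (n : ℕ) : euler (X ^ n) = C (n : ℂ) * X ^ n := by
  ext m
  rw [coeff_euler, PowerSeries.coeff_C_mul, PowerSeries.coeff_X_pow]
  split_ifs with h
  · rw [h]
  · simp

theorem X_mul_pullback (ω : OneForm) (x y : ℂ⟦X⟧) :
    X * ω.pullback x y = (MvPowerSeries.subst ![x, y] ω.A : ℂ⟦X⟧) * euler x +
      (MvPowerSeries.subst ![x, y] ω.B : ℂ⟦X⟧) * euler y := by
  rw [OneForm.pullback, euler, euler]
  ring

/-- The coefficients of the powers of `w` in the part of `t γ^* ω`, `γ = (t ^ n, p + t ^ b w)`,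
without derivatives of `w`. -/
noncomputable def zerothPart (ω : OneForm) (n b : ℕ) (p : ℂ⟦X⟧) (l : ℕ) : ℂ⟦X⟧ :=
  C (n : ℂ) * X ^ n * taylor ω.A n b p l + euler p * taylor ω.B n b p l +
    C (b : ℂ) * X ^ b * shift (taylor ω.B n b p) l

/-- The coefficients of the powers of `w` in the factor of `t w'` in `t γ^* ω`,
`γ = (t ^ n, p + t ^ b w)`. -/
noncomputable def firstPart (ω : OneForm) (n b : ℕ) (p : ℂ⟦X⟧) (l : ℕ) : ℂ⟦X⟧ :=
  X ^ b * taylor ω.B n b p l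

/-- A truncation of `∑ P_l w ^ l + (∑ D_l w ^ l) t w'`. -/
noncomputable def diffOp (P D : ℕ → ℂ⟦X⟧) (N : ℕ) (w : ℂ⟦X⟧) : ℂ⟦X⟧ :=
  ∑ l ∈ Finset.range N, (P l * w ^ l + D l * w ^ l * euler w)

section expansion

variable (ω : OneForm) {n b : ℕ} {p : ℂ⟦X⟧}

theorem pullback_eq_diffOp (hn : 0 < n) (hb : 0 < b) (hp : X ∣ p) (w : ℂ⟦X⟧) (N : ℕ) :
    X ^ N ∣ X * ω.pullback (X ^ n) (p + X ^ b * w) -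
      diffOp (zerothPart ω n b p) (firstPart ω n b p) N w := by
  cases N with
  | zero => simp
  | succ N =>
    obtain ⟨qA, hA⟩ := subst_eq_taylor ω.A hn hb hp w (N + 1)
    obtain ⟨qB, hB⟩ := subst_eq_taylor ω.B hn hb hp w (N + 1)
    -- The term b t^b w B carries an extra w, so the truncation at w^N leaves B expanded only to
    -- order N. The missing power of t is recovered from t^b.
    obtain ⟨qB', hB'⟩ := subst_eq_taylor ω.B hn hb hp w N
    have hshift : ∑ l ∈ Finset.range (N + 1), shift (taylor ω.B n b p) l * w ^ l =
        w * ∑ l ∈ Finset.range N, taylor ω.B n b p l * w ^ l := by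
      rw [Finset.sum_range_succ', Finset.mul_sum]
      simp only [shift, zero_mul, add_zero]
      exact Finset.sum_congr rfl fun l _ => by ring
    have hsum : diffOp (zerothPart ω n b p) (firstPart ω n b p) (N + 1) w =
        C (n : ℂ) * X ^ n * ∑ l ∈ Finset.range (N + 1), taylor ω.A n b p l * w ^ l +
        (euler p + X ^ b * euler w) *
          ∑ l ∈ Finset.range (N + 1), taylor ω.B n b p l * w ^ l +
        C (b : ℂ) * X ^ b * ∑ l ∈ Finset.range (N + 1), shift (taylor ω.B n b p) l * w ^ l := by
      simp only [Finset.mul_sum, ← Finset.sum_add_distrib, diffOp, zerothPart, firstPart]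
      exact Finset.sum_congr rfl fun l _ => by ring
    rw [hsum, hshift, X_mul_pullback, euler_X_pow, euler_add, euler_mul, euler_X_pow]
    rw [show (MvPowerSeries.subst ![X ^ n, p + X ^ b * w] ω.A : ℂ⟦X⟧) * (C (n : ℂ) * X ^ n) +
      (MvPowerSeries.subst ![X ^ n, p + X ^ b * w] ω.B : ℂ⟦X⟧) *
        (euler p + (C (b : ℂ) * X ^ b * w + X ^ b * euler w)) -
      (C (n : ℂ) * X ^ n * ∑ l ∈ Finset.range (N + 1), taylor ω.A n b p l * w ^ l +
        (euler p + X ^ b * euler w) *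
          ∑ l ∈ Finset.range (N + 1), taylor ω.B n b p l * w ^ l +
        C (b : ℂ) * X ^ b * (w * ∑ l ∈ Finset.range N, taylor ω.B n b p l * w ^ l)) =
      C (n : ℂ) * X ^ n * ((MvPowerSeries.subst ![X ^ n, p + X ^ b * w] ω.A : ℂ⟦X⟧) -
        ∑ l ∈ Finset.range (N + 1), taylor ω.A n b p l * w ^ l) +
      (euler p + X ^ b * euler w) *
        ((MvPowerSeries.subst ![X ^ n, p + X ^ b * w] ω.B : ℂ⟦X⟧) -
          ∑ l ∈ Finset.range (N + 1), taylor ω.B n b p l * w ^ l) +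
      C (b : ℂ) * w * (X ^ b * ((MvPowerSeries.subst ![X ^ n, p + X ^ b * w] ω.B : ℂ⟦X⟧) -
          ∑ l ∈ Finset.range N, taylor ω.B n b p l * w ^ l)) by ring, hA, hB, hB']
    refine dvd_add (dvd_add ?_ ?_) ?_
    · exact Dvd.dvd.mul_left (Dvd.intro _ rfl) _
    · exact Dvd.dvd.mul_left (Dvd.intro _ rfl) _
    · refine Dvd.dvd.mul_left ?_ _
      rw [← mul_assoc, ← pow_add]
      exact Dvd.dvd.mul_right (pow_dvd_pow _ (by omega)) _

theorem X_pow_dvd_zerothPart (hb : 0 < b) (l : ℕ) : X ^ l ∣ zerothPart ω n b p l := by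
  refine dvd_add (dvd_add ?_ ?_) ?_
  · exact Dvd.dvd.mul_left (X_pow_dvd_taylor _ hb l) _
  · exact Dvd.dvd.mul_left (X_pow_dvd_taylor _ hb l) _
  · cases l with
    | zero => simp
    | succ l =>
      rw [mul_assoc]
      refine Dvd.dvd.mul_left ?_ _
      rw [pow_succ']
      exact mul_dvd_mul (dvd_pow_self _ hb.ne') (X_pow_dvd_taylor _ hb l)

theorem X_pow_dvd_firstPart (hb : 0 < b) (l : ℕ) : X ^ l ∣ firstPart ω n b p l :=
  Dvd.dvd.mul_left (X_pow_dvd_taylor _ hb l) _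

theorem euler_mem_seriesIn {e : ℕ} {f : ℂ⟦X⟧} (h : f ∈ seriesIn e) : euler f ∈ seriesIn e :=
  X_mul_derivative_mem_seriesIn h

theorem zerothPart_mem_seriesIn {e : ℕ} (hen : e ∣ n) (heb : e ∣ b) (hep : p ∈ seriesIn e)
    (l : ℕ) : zerothPart ω n b p l ∈ seriesIn e := by
  refine add_mem (add_mem ?_ ?_) ?_
  · exact mul_mem (mul_mem (C_mem_seriesIn e _) (X_pow_mem_seriesIn hen))
      (taylor_mem_seriesIn _ hen heb hep l)
  · exact mul_mem (euler_mem_seriesIn hep) (taylor_mem_seriesIn _ hen heb hep l)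
  · refine mul_mem (mul_mem (C_mem_seriesIn e _) (X_pow_mem_seriesIn heb)) ?_
    cases l with
    | zero => exact zero_mem _
    | succ l => exact taylor_mem_seriesIn _ hen heb hep l

theorem firstPart_mem_seriesIn {e : ℕ} (hen : e ∣ n) (heb : e ∣ b) (hep : p ∈ seriesIn e)
    (l : ℕ) : firstPart ω n b p l ∈ seriesIn e :=
  mul_mem (X_pow_mem_seriesIn heb) (taylor_mem_seriesIn _ hen heb hep l)

theorem coeff_C_mul_X_pow_eq_zero (c : ℂ) (k m : ℕ) (h : k + 1 ≤ m) :
    coeff m (C c * X ^ k) = 0 := by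
  rw [PowerSeries.coeff_C_mul, PowerSeries.coeff_X_pow, if_neg (by omega), mul_zero]

theorem controlled_firstPart (hn : 0 < n) (hb : 0 < b) (hp : X ∣ p) (hω : ω.IsHolomorphic)
    {B : ℕ} (hB : ∀ m, B ≤ m → coeff m p = 0) : Controlled (firstPart ω n b p) :=
  (controlled_taylor ω.B hn hb hp hω.2 hB).mul_left (B := b + 1) fun m hm => by
    rw [PowerSeries.coeff_X_pow, if_neg (by omega)]

theorem controlled_zerothPart (hn : 0 < n) (hb : 0 < b) (hp : X ∣ p) (hω : ω.IsHolomorphic)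
    {B : ℕ} (hB : ∀ m, B ≤ m → coeff m p = 0) : Controlled (zerothPart ω n b p) := by
  have hA := controlled_taylor ω.A hn hb hp hω.1 hB
  have hB' := controlled_taylor ω.B hn hb hp hω.2 hB
  refine ((hA.mul_left (coeff_C_mul_X_pow_eq_zero _ n)).add
    (hB'.mul_left (q := euler p) (B := B) fun m hm => ?_)).add
    (hB'.shift.mul_left (coeff_C_mul_X_pow_eq_zero _ b))
  rw [coeff_euler, hB m hm, mul_zero]

end expansion

/-! ### Formal solutions -/

section formal

variable {E G : ℕ → ℂ⟦X⟧} {K : ℕ}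

/-- The value at `t = 0` of the coefficient of `w'` in the differential equation. -/
noncomputable def leadingPolynomial (G : ℕ → ℂ⟦X⟧) (K : ℕ) (s : ℂ) : ℂ :=
  ∑ l ∈ Finset.range (K + 1), coeff 0 (G l) * s ^ l

theorem X_pow_dvd_coeff_eq_zero {f : ℂ⟦X⟧} {k l m : ℕ} (h : X ^ l ∣ X ^ k * f) (hm : m + k < l) :
    coeff m f = 0 := by
  rw [← PowerSeries.coeff_X_pow_mul f k m]
  exact PowerSeries.X_pow_dvd_iff.1 h _ hm

/-- Adding a monomial of degree `m + 1` to `w` changes `∑ t E_l w ^ l + (∑ G_l w ^ l) t w'` in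
degree `m + 1` by a linear term and does not change it in lower degrees. -/
theorem diffOp_add_monomial (hG : ∀ l, X ^ l ∣ X ^ K * G l) (w : ℂ⟦X⟧) (c : ℂ) (m : ℕ) {L : ℕ}
    (hL : K + 1 ≤ L) :
    X ^ (m + 2) ∣ diffOp (fun l => X * E l) G L (w + C c * X ^ (m + 1)) -
      (diffOp (fun l => X * E l) G L w +
        C (leadingPolynomial G K (coeff 0 w) * ((m + 1 : ℕ) * c)) * X ^ (m + 1)) := by
  set δ : ℂ⟦X⟧ := C c * X ^ (m + 1)
  have hδ : X ^ (m + 1) ∣ δ := Dvd.intro_left _ rfl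
  have hpow : ∀ l, X ^ (m + 1) ∣ (w + δ) ^ l - w ^ l := fun l => by
    have := sub_dvd_pow_sub_pow (w + δ) w l
    rw [add_sub_cancel_left] at this
    exact hδ.trans this
  have heuler : euler δ = C ((m + 1 : ℕ) * c : ℂ) * X ^ (m + 1) := by
    ext i
    rw [coeff_euler, PowerSeries.coeff_C_mul, PowerSeries.coeff_C_mul, PowerSeries.coeff_X_pow]
    split_ifs with h
    · rw [h]; ring
    · simp
  have hlead : X ∣ ∑ l ∈ Finset.range L, G l * w ^ l - C (leadingPolynomial G K (coeff 0 w)) := by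
    rw [PowerSeries.X_dvd_iff, map_sub, PowerSeries.constantCoeff_C, map_sum, sub_eq_zero,
      leadingPolynomial]
    symm
    simp only [map_mul, map_pow, PowerSeries.coeff_zero_eq_constantCoeff]
    refine Finset.sum_subset (Finset.range_mono hL) fun l _ hl => ?_
    rw [← PowerSeries.coeff_zero_eq_constantCoeff_apply,
      X_pow_dvd_coeff_eq_zero (hG l) (by simp at hl; omega), zero_mul]
  have heq : diffOp (fun l => X * E l) G L (w + δ) - (diffOp (fun l => X * E l) G L w +
        C (leadingPolynomial G K (coeff 0 w) * ((m + 1 : ℕ) * c)) * X ^ (m + 1)) =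
      ∑ l ∈ Finset.range L, (X * ((w + δ) ^ l - w ^ l) * E l +
        euler (w + δ) * ((w + δ) ^ l - w ^ l) * G l) +
      (∑ l ∈ Finset.range L, G l * w ^ l - C (leadingPolynomial G K (coeff 0 w))) *
        X ^ (m + 1) * C ((m + 1 : ℕ) * c : ℂ) := by
    have h1 : ∑ l ∈ Finset.range L, (X * ((w + δ) ^ l - w ^ l) * E l +
        euler (w + δ) * ((w + δ) ^ l - w ^ l) * G l) = diffOp (fun l => X * E l) G L (w + δ) -
          diffOp (fun l => X * E l) G L w - (∑ l ∈ Finset.range L, G l * w ^ l) * euler δ := by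
      rw [diffOp, diffOp, Finset.sum_mul, ← Finset.sum_sub_distrib, ← Finset.sum_sub_distrib]
      refine Finset.sum_congr rfl fun l _ => ?_
      rw [euler_add]
      ring
    rw [h1, heuler, map_mul]
    ring
  rw [heq]
  refine dvd_add (Finset.dvd_sum fun l _ => dvd_add ?_ ?_) ?_
  · rw [pow_succ' X (m + 1)]
    exact Dvd.dvd.mul_right (mul_dvd_mul_left _ (hpow l)) _
  · rw [pow_succ' X (m + 1)]
    exact Dvd.dvd.mul_right (mul_dvd_mul (X_dvd_euler _) (hpow l)) _
  · rw [pow_succ' X (m + 1)]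
    exact Dvd.dvd.mul_right (mul_dvd_mul hlead (dvd_refl _)) _

/-- The truncations of the formal solution with initial value `s`. -/
noncomputable def truncSolution (E G : ℕ → ℂ⟦X⟧) (K : ℕ) (s : ℂ) : ℕ → ℂ⟦X⟧
  | 0 => C s
  | m + 1 => truncSolution E G K s m +
      -- The correction cancels the defect in degree m + 1; by `coeff_diffOp_eq`, m + K + 2 powers
      -- of w suffice to compute that defect.
      C (-(coeff (m + 1) (diffOp (fun l => X * E l) G (m + K + 2) (truncSolution E G K s m)) /
        (leadingPolynomial G K s * (m + 1 : ℕ)))) * X ^ (m + 1)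

/-- The formal solution with initial value `s`. -/
noncomputable def solution (E G : ℕ → ℂ⟦X⟧) (K : ℕ) (s : ℂ) : ℂ⟦X⟧ :=
  PowerSeries.mk fun m => coeff m (truncSolution E G K s m)

theorem coeff_truncSolution_of_le (s : ℂ) {i m : ℕ} (h : i ≤ m) :
    coeff i (truncSolution E G K s m) = coeff i (solution E G K s) := by
  rw [solution, PowerSeries.coeff_mk]
  induction m, h using Nat.le_induction with
  | base => rfl
  | succ m h ih =>
    rw [truncSolution, map_add, ih, PowerSeries.coeff_C_mul, PowerSeries.coeff_X_pow,
      if_neg (by omega), mul_zero, add_zero]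

theorem coeff_zero_solution (s : ℂ) : coeff 0 (solution E G K s) = s := by
  rw [← coeff_truncSolution_of_le s le_rfl]
  simp [truncSolution]

theorem X_pow_dvd_solution_sub (s : ℂ) (m : ℕ) :
    X ^ (m + 1) ∣ solution E G K s - truncSolution E G K s m := by
  rw [PowerSeries.X_pow_dvd_iff]
  intro i hi
  rw [map_sub, coeff_truncSolution_of_le s (by omega), sub_self]

/-- Both t E_l and G_l have order at least l - K, so the terms with l > i + K do not reach degree i.
-/
theorem coeff_diffOp_eq (hE : ∀ l, X ^ l ∣ X ^ (K + 1) * E l) (hG : ∀ l, X ^ l ∣ X ^ K * G l)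
    (w : ℂ⟦X⟧) {i L L' : ℕ} (hL : i + K + 1 ≤ L) (hL' : L ≤ L') :
    coeff i (diffOp (fun l => X * E l) G L' w) = coeff i (diffOp (fun l => X * E l) G L w) := by
  rw [diffOp, diffOp, ← sub_eq_zero, ← map_sub, ← Finset.sum_Ico_eq_sub _ hL', map_sum]
  refine Finset.sum_eq_zero fun l hl => ?_
  rw [Finset.mem_Ico] at hl
  have h1 : X ^ (i + 1) ∣ X * E l := by
    rw [PowerSeries.X_pow_dvd_iff]
    intro m hm
    refine X_pow_dvd_coeff_eq_zero (k := K) (l := l) ?_ (by omega)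
    rw [← mul_assoc, ← pow_succ]
    exact hE l
  have h2 : X ^ (i + 1) ∣ G l := by
    rw [PowerSeries.X_pow_dvd_iff]
    intro m hm
    exact X_pow_dvd_coeff_eq_zero (hG l) (by omega)
  refine PowerSeries.X_pow_dvd_iff.1 (dvd_add (h1.mul_right _) ?_) i (Nat.lt_succ_self i)
  rw [mul_assoc]
  exact h2.mul_right _

/-- Using t d/dt instead of d/dt, the operator loses no order of agreement. -/
theorem coeff_diffOp_congr {P D : ℕ → ℂ⟦X⟧} {w w' : ℂ⟦X⟧} {m : ℕ} (h : X ^ m ∣ w - w')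
    {L i : ℕ} (hi : i < m) : coeff i (diffOp P D L w) = coeff i (diffOp P D L w') := by
  rw [← sub_eq_zero, ← map_sub]
  refine PowerSeries.X_pow_dvd_iff.1 ?_ i hi
  rw [diffOp, diffOp, ← Finset.sum_sub_distrib]
  refine Finset.dvd_sum fun l _ => ?_
  have h1 : X ^ m ∣ w ^ l - w' ^ l := h.trans (sub_dvd_pow_sub_pow _ _ _)
  have h2 : X ^ m ∣ euler w - euler w' := by
    rw [PowerSeries.X_pow_dvd_iff]
    intro k hk
    have := PowerSeries.X_pow_dvd_iff.1 h k hk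
    rw [map_sub] at this
    rw [map_sub, coeff_euler, coeff_euler, ← mul_sub, this, mul_zero]
  rw [show P l * w ^ l + D l * w ^ l * euler w - (P l * w' ^ l + D l * w' ^ l * euler w') =
    (w ^ l - w' ^ l) * (P l + D l * euler w) + (euler w - euler w') * (D l * w' ^ l) by ring]
  exact dvd_add (h1.mul_right _) (h2.mul_right _)

theorem coeff_diffOp_truncSolution (hE : ∀ l, X ^ l ∣ X ^ (K + 1) * E l)
    (hG : ∀ l, X ^ l ∣ X ^ K * G l) {s : ℂ} (hs : leadingPolynomial G K s ≠ 0) (m : ℕ) {i L : ℕ}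
    (hi : i ≤ m) (hL : i + K + 1 ≤ L) :
    coeff i (diffOp (fun l => X * E l) G L (truncSolution E G K s m)) = 0 := by
  induction m generalizing i L with
  | zero =>
    obtain rfl : i = 0 := by omega
    rw [diffOp, map_sum]
    refine Finset.sum_eq_zero fun l _ => ?_
    rw [PowerSeries.coeff_zero_eq_constantCoeff_apply]
    refine PowerSeries.X_dvd_iff.1 ?_
    exact dvd_add ((Dvd.intro _ rfl : X ∣ X * E l).mul_right _)
      ((X_dvd_euler _).mul_left _)
  | succ m ih =>
    rw [← coeff_diffOp_eq hE hG _ hL (le_max_left L (m + K + 2))]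
    have hm : K + 1 ≤ max L (m + K + 2) := by omega
    set d := leadingPolynomial G K s with hd
    have hw : coeff 0 (truncSolution E G K s m) = s := by
      rw [coeff_truncSolution_of_le s (Nat.zero_le m), coeff_zero_solution]
    have key := PowerSeries.X_pow_dvd_iff.1 (diffOp_add_monomial (E := E) hG
      (truncSolution E G K s m)
      (-(coeff (m + 1) (diffOp (fun l => X * E l) G (m + K + 2) (truncSolution E G K s m)) /
        (d * (m + 1 : ℕ)))) m hm) i (by omega)
    rw [map_sub, sub_eq_zero] at key
    rw [truncSolution, key, map_add, PowerSeries.coeff_C_mul, PowerSeries.coeff_X_pow, hw, ← hd]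
    split_ifs with h
    · subst h
      rw [coeff_diffOp_eq hE hG _ (by omega) (le_max_right L (m + K + 2)), mul_one]
      have : ((m + 1 : ℕ) : ℂ) ≠ 0 := Nat.cast_ne_zero.2 (Nat.succ_ne_zero m)
      field_simp
      ring
    · rw [ih (by omega) (by omega), mul_zero, add_zero]

theorem coeff_diffOp_solution (hE : ∀ l, X ^ l ∣ X ^ (K + 1) * E l)
    (hG : ∀ l, X ^ l ∣ X ^ K * G l) {s : ℂ} (hs : leadingPolynomial G K s ≠ 0) {i L : ℕ}
    (hL : i + K + 1 ≤ L) :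
    coeff i (diffOp (fun l => X * E l) G L (solution E G K s)) = 0 := by
  rw [coeff_diffOp_congr (X_pow_dvd_solution_sub s i) (Nat.lt_succ_self i)]
  exact coeff_diffOp_truncSolution hE hG hs i le_rfl hL

theorem diffOp_mem_seriesIn {e : ℕ} {P D : ℕ → ℂ⟦X⟧} (hP : ∀ l, P l ∈ seriesIn e)
    (hD : ∀ l, D l ∈ seriesIn e) {w : ℂ⟦X⟧} (hw : w ∈ seriesIn e) (L : ℕ) :
    diffOp P D L w ∈ seriesIn e :=
  sum_mem fun l _ => add_mem (mul_mem (hP l) (pow_mem hw l))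
    (mul_mem (mul_mem (hD l) (pow_mem hw l)) (euler_mem_seriesIn hw))

/-- In a degree not divisible by e the defect of the truncated solution is already zero, so the
recursion adds nothing there. -/
theorem solution_mem_seriesIn {e : ℕ} (hE : ∀ l, X * E l ∈ seriesIn e)
    (hG : ∀ l, G l ∈ seriesIn e) (s : ℂ) : solution E G K s ∈ seriesIn e := by
  have : ∀ m, truncSolution E G K s m ∈ seriesIn e := by
    intro m
    induction m with
    | zero => exact C_mem_seriesIn e s
    | succ m ih =>
      rw [truncSolution]
      refine add_mem ih ?_
      by_cases h : e ∣ m + 1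
      · exact mul_mem (C_mem_seriesIn e _) (X_pow_mem_seriesIn h)
      · rw [diffOp_mem_seriesIn hE hG ih _ (m + 1) h, zero_div, neg_zero, map_zero, zero_mul]
        exact zero_mem _
  intro m hm
  rw [solution, PowerSeries.coeff_mk, this m m hm]

/-! ### Holomorphic dependence of the coefficients -/

/-- All the coefficients of a family of power series are holomorphic on `S`. -/
def CoeffHolomorphic (S : Set ℂ) (F : ℂ → ℂ⟦X⟧) : Prop :=
  ∀ m, DifferentiableOn ℂ (fun s => coeff m (F s)) S

theorem CoeffHolomorphic.const (S : Set ℂ) (f : ℂ⟦X⟧) : CoeffHolomorphic S fun _ => f :=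
  fun _ => differentiableOn_const _

theorem CoeffHolomorphic.add {S : Set ℂ} {F F' : ℂ → ℂ⟦X⟧} (h : CoeffHolomorphic S F)
    (h' : CoeffHolomorphic S F') : CoeffHolomorphic S fun s => F s + F' s := fun m => by
  simpa only [map_add] using (h m).fun_add (h' m)

theorem CoeffHolomorphic.mul {S : Set ℂ} {F F' : ℂ → ℂ⟦X⟧} (h : CoeffHolomorphic S F)
    (h' : CoeffHolomorphic S F') : CoeffHolomorphic S fun s => F s * F' s := fun m => by
  simp only [PowerSeries.coeff_mul]
  exact DifferentiableOn.fun_sum fun p _ => (h p.1).mul (h' p.2)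

theorem CoeffHolomorphic.pow {S : Set ℂ} {F : ℂ → ℂ⟦X⟧} (h : CoeffHolomorphic S F) (l : ℕ) :
    CoeffHolomorphic S fun s => F s ^ l := by
  induction l with
  | zero => simpa only [pow_zero] using CoeffHolomorphic.const S 1
  | succ l ih => simpa only [pow_succ] using ih.mul h

theorem CoeffHolomorphic.euler {S : Set ℂ} {F : ℂ → ℂ⟦X⟧} (h : CoeffHolomorphic S F) :
    CoeffHolomorphic S fun s => euler (F s) := fun m => by
  simp only [coeff_euler]
  exact (h m).const_mul _

theorem CoeffHolomorphic.diffOp {S : Set ℂ} {F : ℂ → ℂ⟦X⟧} (h : CoeffHolomorphic S F)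
    (P D : ℕ → ℂ⟦X⟧) (L : ℕ) : CoeffHolomorphic S fun s => diffOp P D L (F s) := fun m => by
  simp only [PlaneBranch.diffOp, map_sum]
  exact DifferentiableOn.fun_sum fun l _ => (((CoeffHolomorphic.const S (P l)).mul (h.pow l)).add
    (((CoeffHolomorphic.const S (D l)).mul (h.pow l)).mul h.euler)) m

theorem differentiable_leadingPolynomial : Differentiable ℂ (leadingPolynomial G K) := by
  unfold leadingPolynomial
  fun_prop

/-- The recursion applies polynomial operations to earlier coefficients and divides only by
`leadingPolynomial G K s` times a positive integer. -/
theorem coeffHolomorphic_solution {S : Set ℂ} (hS : ∀ s ∈ S, leadingPolynomial G K s ≠ 0) :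
    CoeffHolomorphic S (solution E G K) := by
  have : ∀ m, CoeffHolomorphic S fun s => truncSolution E G K s m := by
    intro m
    induction m with
    | zero =>
      intro m
      simp only [truncSolution, PowerSeries.coeff_C]
      split_ifs
      · exact differentiableOn_id
      · exact differentiableOn_const _
    | succ m ih =>
      refine ih.add fun i => ?_
      simp only [PowerSeries.coeff_C_mul]
      refine DifferentiableOn.mul_const (DifferentiableOn.neg (DifferentiableOn.div
        (ih.diffOp _ _ _ _) (DifferentiableOn.mul_const
          differentiable_leadingPolynomial.differentiableOn _) fun s hs => ?_)) _
      exact mul_ne_zero (hS s hs) (Nat.cast_ne_zero.2 (Nat.succ_ne_zero m))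
  intro m
  simp only [solution, PowerSeries.coeff_mk]
  exact this m m

end formal

end PlaneBranch

namespace PlaneBranch

open PowerSeries (X C coeff)

/-! ### Convergence of the formal solutions -/

/-- The Euler operator multiplies the coefficient of degree m by m ≥ 1 away from the constant term,
so estimates need only be made for t w'. -/
theorem truncNorm_sub_C_le {r : ℝ} (hr : 0 ≤ r) (N : ℕ) (w : ℂ⟦X⟧) :
    truncNorm r N (w - C (coeff 0 w)) ≤ truncNorm r N (euler w) := by
  refine Finset.sum_le_sum fun m _ => mul_le_mul_of_nonneg_right ?_ (by positivity)
  rw [coeff_euler, map_sub, PowerSeries.coeff_C]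
  split_ifs with h
  · simp [h]
  · rw [sub_zero, norm_mul, Complex.norm_natCast]
    exact le_mul_of_one_le_left (norm_nonneg _) (by exact_mod_cast Nat.one_le_iff_ne_zero.2 h)

theorem truncNorm_pow_sub_C_le {r ρ T : ℝ} (hr : 0 ≤ r) (hρ : 1 ≤ ρ) (N : ℕ) {w : ℂ⟦X⟧} {s : ℂ}
    (hw : truncNorm r N w ≤ ρ) (hs : ‖s‖ ≤ ρ) (hT : truncNorm r N (w - C s) ≤ T) (l : ℕ) :
    truncNorm r N (w ^ l - C (s ^ l)) ≤ T * (l * ρ ^ l) := by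
  have hT0 : 0 ≤ T := (truncNorm_nonneg hr N _).trans hT
  induction l with
  | zero => simp [truncNorm_zero]
  | succ l ih =>
    have h1 : w ^ (l + 1) - C (s ^ (l + 1)) =
        w * (w ^ l - C (s ^ l)) + C (s ^ l) * (w - C s) := by
      rw [pow_succ', pow_succ' s, map_mul]; ring
    rw [h1]
    refine (truncNorm_add_le hr N _ _).trans ?_
    have h2 : truncNorm r N (w * (w ^ l - C (s ^ l))) ≤ ρ * (T * (l * ρ ^ l)) :=
      (truncNorm_mul_le hr N _ _).trans
        (mul_le_mul hw ih (truncNorm_nonneg hr N _) (by linarith))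
    have h3 : truncNorm r N (C (s ^ l) * (w - C s)) ≤ ρ ^ l * T := by
      rw [truncNorm_C_mul, norm_pow]
      exact mul_le_mul (pow_le_pow_left₀ (norm_nonneg _) hs l) hT (truncNorm_nonneg hr N _)
        (by positivity)
    have h4 : ρ ^ l * T ≤ T * ρ ^ (l + 1) := by
      rw [mul_comm]
      exact mul_le_mul_of_nonneg_left (pow_le_pow_right₀ hρ (Nat.le_succ l)) hT0
    push_cast
    rw [pow_succ] at h4 ⊢
    linarith

theorem truncNorm_sub_C_le_mul {r r' : ℝ} (hr : 0 < r) (hr' : r ≤ r') (N : ℕ) (f : ℂ⟦X⟧) :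
    truncNorm r N (f - C (coeff 0 f)) ≤ r / r' * truncNorm r' N f := by
  rw [truncNorm, truncNorm, Finset.mul_sum]
  have h0 : 0 < r' := hr.trans_le hr'
  refine Finset.sum_le_sum fun m _ => ?_
  cases m with
  | zero => simp only [map_sub, PowerSeries.coeff_zero_C, sub_self, norm_zero, zero_mul]; positivity
  | succ m =>
    rw [map_sub, PowerSeries.coeff_C, if_neg (Nat.succ_ne_zero m), sub_zero]
    have : r ^ (m + 1) ≤ r / r' * r' ^ (m + 1) := by
      rw [pow_succ, pow_succ, ← mul_assoc, mul_comm (r / r'), mul_assoc, div_mul_cancel₀ _ h0.ne']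
      exact mul_le_mul_of_nonneg_right (pow_le_pow_left₀ hr.le hr' m) hr.le
    calc _ ≤ ‖coeff (m + 1) f‖ * (r / r' * r' ^ (m + 1)) := by gcongr
      _ = _ := by ring

section bound

variable {E G : ℕ → ℂ⟦X⟧} {K : ℕ}

theorem truncNorm_sum_mul_pow_le {r r' ρ M : ℝ} (hr : 0 ≤ r) (hr' : r ≤ r') (N L : ℕ)
    {f : ℕ → ℂ⟦X⟧} {w : ℂ⟦X⟧} (hw : truncNorm r N w ≤ ρ)
    (hM : ∑ l ∈ Finset.range L, truncNorm r' N (f l) * ρ ^ l ≤ M) :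
    truncNorm r N (∑ l ∈ Finset.range L, f l * w ^ l) ≤ M := by
  refine (truncNorm_sum_le hr N _ _).trans (le_trans (Finset.sum_le_sum fun l _ => ?_) hM)
  refine (truncNorm_mul_le hr N _ _).trans (mul_le_mul (truncNorm_mono_left hr N hr' _) ?_
    (truncNorm_nonneg hr N _) (truncNorm_nonneg (hr.trans hr') N _))
  exact (truncNorm_pow_le hr N w l).trans (pow_le_pow_left₀ (truncNorm_nonneg hr N w) hw l)

/-- The splitting of G(t, w) - G(0, s) into G(t, w) - G(0, w), small with the radius, and G(0, w) -
G(0, s), small with t w'. -/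
theorem sum_sub_leadingPolynomial (hG : ∀ l, X ^ l ∣ X ^ K * G l) (w : ℂ⟦X⟧) (s : ℂ) {L : ℕ}
    (hL : K + 1 ≤ L) :
    ∑ l ∈ Finset.range L, G l * w ^ l - C (leadingPolynomial G K s) =
      ∑ l ∈ Finset.range L, (G l - C (coeff 0 (G l))) * w ^ l +
        ∑ l ∈ Finset.range (K + 1), C (coeff 0 (G l)) * (w ^ l - C (s ^ l)) := by
  have h1 : ∑ l ∈ Finset.range L, C (coeff 0 (G l)) * w ^ l =
      ∑ l ∈ Finset.range (K + 1), C (coeff 0 (G l)) * w ^ l := by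
    symm
    refine Finset.sum_subset (Finset.range_mono hL) fun l _ hl => ?_
    rw [X_pow_dvd_coeff_eq_zero (hG l) (by simp at hl; omega), map_zero, zero_mul]
  simp only [sub_mul, mul_sub, Finset.sum_sub_distrib, h1, leadingPolynomial, map_sum, map_mul]
  ring

/-- Write the equation as G(0, s) t w' = -t E(t, w) - (G(t, w) - G(0, s)) t w'. Below degree N + 1
the right side only sees w below degree N, so the bound ‖t w'‖ ≤ τ propagates by induction on N,
with constants independent of N and of s near s₀. -/
theorem solution_bound (hEc : Controlled E) (hGc : Controlled G)
    (hE : ∀ l, X ^ l ∣ X ^ (K + 1) * E l) (hG : ∀ l, X ^ l ∣ X ^ K * G l) {s₀ : ℂ}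
    (hs₀ : leadingPolynomial G K s₀ ≠ 0) :
    ∃ δ r B : ℝ, 0 < δ ∧ 0 < r ∧ 0 ≤ B ∧ ∀ s ∈ Metric.ball s₀ δ, leadingPolynomial G K s ≠ 0 ∧
      ∀ N, truncNorm r N (solution E G K s) ≤ B := by
  set d := ‖leadingPolynomial G K s₀‖ / 2 with hd
  have hd0 : 0 < d := half_pos (norm_pos_iff.2 hs₀)
  obtain ⟨δ, hδ0, hδ⟩ : ∃ δ > 0, ∀ s ∈ Metric.ball s₀ δ, d < ‖leadingPolynomial G K s‖ := by
    have : ∀ᶠ s in 𝓝 s₀, d < ‖leadingPolynomial G K s‖ :=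
      (differentiable_leadingPolynomial.continuous.norm.tendsto s₀).eventually
        (lt_mem_nhds (half_lt_self (norm_pos_iff.2 hs₀)))
    exact Metric.eventually_nhds_iff_ball.1 this
  -- One unit allows s to move in a ball of radius 1 around s₀, the other covers ‖w - s‖ ≤ τ ≤ 1.
  set ρ := ‖s₀‖ + 2
  have hρ : 1 ≤ ρ := by have := norm_nonneg s₀; linarith
  have hρ0 : 0 ≤ ρ := by linarith
  obtain ⟨r1, hr1, H1⟩ := hEc ρ hρ0
  obtain ⟨r2, hr2, H2⟩ := hGc ρ hρ0
  set r' := min r1 r2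
  have hr' : 0 < r' := lt_min hr1 hr2
  obtain ⟨M1, hM1, H1⟩ := H1 r' hr' (min_le_left _ _)
  obtain ⟨M2, hM2, H2⟩ := H2 r' hr' (min_le_right _ _)
  set c := ∑ l ∈ Finset.range (K + 1), ‖coeff 0 (G l)‖ * (l * ρ ^ l)
  have hc : 0 ≤ c := Finset.sum_nonneg fun l _ => by positivity
  -- This makes the contribution of G(0, w) - G(0, s) at most d / 4.
  set τ := min 1 (d / (4 * (c + 1)))
  have hτ0 : 0 < τ := lt_min one_pos (by positivity)
  have hτ1 : τ ≤ 1 := min_le_left _ _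
  have hτc : c * τ ≤ d / 4 := by
    have h1 : τ * (4 * (c + 1)) ≤ d := by
      rw [← le_div_iff₀ (by positivity)]; exact min_le_right _ _
    nlinarith
  -- The two bounds give ‖t E‖ ≤ d τ / 2 and ‖G(t, w) - G(0, w)‖ ≤ d / 4. The right side is then at
  -- most d τ / 2 + (d / 2) τ = d τ, while |G(0, s)| > d.
  set r := min r' (min (d * τ / (2 * (M1 + 1))) (d * r' / (4 * (M2 + 1))))
  have hr0 : 0 < r := lt_min hr' (lt_min (by positivity) (by positivity))
  have hrr' : r ≤ r' := min_le_left _ _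
  have hrM1 : r * M1 ≤ d * τ / 2 := by
    have h1 : r * (2 * (M1 + 1)) ≤ d * τ := by
      rw [← le_div_iff₀ (by positivity)]; exact (min_le_right _ _).trans (min_le_left _ _)
    nlinarith
  have hrM2 : r / r' * M2 ≤ d / 4 := by
    have h1 : r * (4 * (M2 + 1)) ≤ d * r' := by
      rw [← le_div_iff₀ (by positivity)]; exact (min_le_right _ _).trans (min_le_right _ _)
    rw [div_mul_eq_mul_div, div_le_iff₀ hr']
    nlinarith
  refine ⟨min δ 1, r, ρ, lt_min hδ0 one_pos, hr0, hρ0, fun s hs => ?_⟩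
  have hsd := hδ s (Metric.ball_subset_ball (min_le_left _ _) hs)
  have hs0 : leadingPolynomial G K s ≠ 0 := norm_pos_iff.1 (hd0.trans hsd)
  have hsn : ‖s‖ ≤ ‖s₀‖ + 1 := by
    have h1 := Metric.ball_subset_ball (min_le_right δ 1) hs
    rw [mem_ball_iff_norm] at h1
    have h2 := norm_sub_norm_le s s₀
    linarith
  set w := solution E G K s with hw
  have hw0 : coeff 0 w = s := coeff_zero_solution s
  have hwle : ∀ N, truncNorm r N (euler w) ≤ τ → truncNorm r N w ≤ ρ := by
    intro N hN
    have h1 := truncNorm_sub_C_le hr0.le N w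
    have h2 := truncNorm_add_le hr0.le N (w - C s) (C s)
    have h3 := truncNorm_C_le (r := r) N s
    rw [sub_add_cancel] at h2
    rw [hw0] at h1
    linarith
  have key : ∀ N, truncNorm r N (euler w) ≤ τ := by
    intro N
    induction N with
    | zero => simpa [truncNorm] using hτ0.le
    | succ N ih =>
      have hwN := hwle N ih
      set L := N + K + 2 with hL
      have heq : ∀ i < N + 1, coeff i (C (leadingPolynomial G K s) * euler w) =
          coeff i (-(X * ∑ l ∈ Finset.range L, E l * w ^ l) +
            -((∑ l ∈ Finset.range L, G l * w ^ l - C (leadingPolynomial G K s)) * euler w)) := by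
        intro i hi
        have h1 := coeff_diffOp_solution hE hG hs0 (i := i) (L := L) (by omega)
        rw [← hw] at h1
        rw [← sub_eq_zero, ← map_sub, ← h1]
        congr 1
        rw [diffOp, Finset.sum_add_distrib, ← Finset.sum_mul]
        simp only [mul_assoc X]
        rw [← Finset.mul_sum]
        ring
      have hfac : X ∣ ∑ l ∈ Finset.range L, G l * w ^ l - C (leadingPolynomial G K s) := by
        rw [sum_sub_leadingPolynomial hG w s (by omega)]
        refine dvd_add (Finset.dvd_sum fun l _ => Dvd.dvd.mul_right ?_ _)
          (Finset.dvd_sum fun l _ => Dvd.dvd.mul_left ?_ _)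
        · rw [PowerSeries.X_dvd_iff]; simp
        · rw [PowerSeries.X_dvd_iff, map_sub, map_pow,
            ← PowerSeries.coeff_zero_eq_constantCoeff_apply, hw0, PowerSeries.constantCoeff_C,
            sub_self]
      have h1 : truncNorm r (N + 1) (X * ∑ l ∈ Finset.range L, E l * w ^ l) ≤ r * M1 := by
        rw [truncNorm_X_mul]
        exact mul_le_mul_of_nonneg_left
          (truncNorm_sum_mul_pow_le hr0.le hrr' N L hwN (H1 N L)) hr0.le
      have h2 : truncNorm r N (∑ l ∈ Finset.range L, G l * w ^ l - C (leadingPolynomial G K s)) ≤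
          d / 2 := by
        rw [sum_sub_leadingPolynomial hG w s (by omega)]
        refine (truncNorm_add_le hr0.le N _ _).trans ?_
        have h3 : truncNorm r N (∑ l ∈ Finset.range L, (G l - C (coeff 0 (G l))) * w ^ l) ≤
            r / r' * M2 := by
          refine truncNorm_sum_mul_pow_le hr0.le le_rfl N L hwN ?_
          refine le_trans ?_ (mul_le_mul_of_nonneg_left (H2 N L) (by positivity))
          rw [Finset.mul_sum]
          refine Finset.sum_le_sum fun l _ => ?_
          rw [← mul_assoc]
          exact mul_le_mul_of_nonneg_right (truncNorm_sub_C_le_mul hr0 hrr' N _) (by positivity)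
        have h4 : truncNorm r N
            (∑ l ∈ Finset.range (K + 1), C (coeff 0 (G l)) * (w ^ l - C (s ^ l))) ≤ c * τ := by
          refine (truncNorm_sum_le hr0.le N _ _).trans ?_
          rw [Finset.sum_mul]
          refine Finset.sum_le_sum fun l _ => ?_
          rw [truncNorm_C_mul, mul_assoc, mul_comm _ τ]
          refine mul_le_mul_of_nonneg_left ?_ (norm_nonneg _)
          refine truncNorm_pow_sub_C_le hr0.le hρ N hwN (by linarith) ?_ l
          have := truncNorm_sub_C_le hr0.le N w
          rw [hw0] at this
          exact this.trans ih
        linarith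
      have h5 := truncNorm_mul_le_of_X_dvd hr0.le N hfac (X_dvd_euler w)
      have h6 : truncNorm r N (∑ l ∈ Finset.range L, G l * w ^ l - C (leadingPolynomial G K s)) *
          truncNorm r N (euler w) ≤ d / 2 * τ :=
        mul_le_mul h2 ih (truncNorm_nonneg hr0.le N _) (by positivity)
      have h7 : ‖leadingPolynomial G K s‖ * truncNorm r (N + 1) (euler w) ≤ d * τ := by
        rw [← truncNorm_C_mul, truncNorm_congr (N + 1) heq]
        refine (truncNorm_add_le hr0.le _ _ _).trans ?_
        rw [truncNorm_neg, truncNorm_neg]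
        linarith
      have h8 := truncNorm_nonneg hr0.le (N + 1) (euler w)
      by_contra! h9
      nlinarith
  exact ⟨hs0, fun N => hwle N (key N)⟩

end bound

/-! ### Holomorphic sums -/

/-- A power series in `t` whose coefficients are holomorphic functions of `s`, with locally uniform
geometric bounds, is a holomorphic function of `(t, s)`. -/
theorem differentiableAt_tsum_mul_pow {f : ℕ → ℂ → ℂ} {s₀ t₀ : ℂ} {δ r B : ℝ} (hδ : 0 < δ)
    (hr : 0 < r) (hf : ∀ m, DifferentiableOn ℂ (f m) (Metric.ball s₀ δ))
    (hB : ∀ m, ∀ s ∈ Metric.ball s₀ δ, ‖f m s‖ * r ^ m ≤ B) (ht : ‖t₀‖ < r / 2) :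
    DifferentiableAt ℂ (fun z : ℂ × ℂ => ∑' m, f m z.2 * z.1 ^ m) (t₀, s₀) := by
  have hB0 : 0 ≤ B := (by positivity : (0 : ℝ) ≤ ‖f 0 s₀‖ * r ^ 0).trans
    (hB 0 s₀ (Metric.mem_ball_self hδ))
  have hfB : ∀ m, ∀ s ∈ Metric.ball s₀ δ, ‖f m s‖ ≤ B / r ^ m := fun m s hs => by
    rw [le_div_iff₀ (by positivity)]; exact hB m s hs
  set S : Set (ℂ × ℂ) := Metric.ball 0 (r / 2) ×ˢ Metric.ball s₀ (δ / 2)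
  have hSo : IsOpen S := Metric.isOpen_ball.prod Metric.isOpen_ball
  have hSp : IsPreconnected S :=
    ((convex_ball _ _).prod (convex_ball _ _)).isPreconnected
  have hsub : Metric.ball s₀ (δ / 2) ⊆ Metric.ball s₀ δ := Metric.ball_subset_ball (by linarith)
  -- Cauchy's estimate on circles of radius δ / 4, which stay inside the ball of radius δ.
  have hderiv : ∀ m, ∀ s ∈ Metric.ball s₀ (δ / 2), ‖deriv (f m) s‖ ≤ B / r ^ m / (δ / 4) := by
    intro m s hs
    have hcl : Metric.closedBall s (δ / 4) ⊆ Metric.ball s₀ δ := by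
      intro z hz
      rw [Metric.mem_ball] at hs ⊢
      rw [Metric.mem_closedBall] at hz
      have := dist_triangle z s s₀
      linarith
    refine Complex.norm_deriv_le_of_forall_mem_sphere_norm_le (by positivity) ?_ fun z hz =>
      hfB m z (hcl (Metric.sphere_subset_closedBall hz))
    refine DifferentiableOn.diffContOnCl ?_
    refine (hf m).mono ?_
    rw [closure_ball _ (by positivity)]
    exact hcl
  have hfd : ∀ m, ∀ s ∈ Metric.ball s₀ (δ / 2), HasDerivAt (f m) (deriv (f m) s) s :=
    fun m s hs => ((hf m).differentiableAt
      (Metric.isOpen_ball.mem_nhds (hsub hs))).hasDerivAt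
  have hFD : ∀ m : ℕ, ∀ z ∈ S, HasFDerivAt (fun z : ℂ × ℂ => f m z.2 * z.1 ^ m)
      (f m z.2 • ((m : ℂ) * z.1 ^ (m - 1)) • ContinuousLinearMap.fst ℂ ℂ ℂ +
        z.1 ^ m • (deriv (f m) z.2) • ContinuousLinearMap.snd ℂ ℂ ℂ) z := by
    intro m z hz
    have h1 := (hfd m z.2 hz.2).comp_hasFDerivAt z (hasFDerivAt_snd (𝕜 := ℂ))
    have h2 := (hasDerivAt_pow m z.1).comp_hasFDerivAt z (hasFDerivAt_fst (𝕜 := ℂ))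
    exact h1.mul h2
  have hu : Summable fun m : ℕ => B * (2 / r) * ((m : ℝ) ^ 1 * (1 / 2) ^ m) +
      B / (δ / 4) * (1 / 2) ^ m := by
    refine Summable.add (Summable.mul_left _ ?_) (Summable.mul_left _ ?_)
    · exact summable_pow_mul_geometric_of_norm_lt_one 1 (by norm_num)
    · exact summable_geometric_of_lt_one (by norm_num) (by norm_num)
  have hz0 : (t₀, s₀) ∈ S := ⟨by simpa using ht, Metric.mem_ball_self (by positivity)⟩
  have hzero : ((0 : ℂ), s₀) ∈ S :=
    ⟨Metric.mem_ball_self (by positivity), Metric.mem_ball_self (by positivity)⟩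
  refine (hasFDerivAt_tsum_of_isPreconnected hu hSo hSp hFD ?_ hzero ?_ hz0).differentiableAt
  · intro m z hz
    have hz1 : ‖z.1‖ ≤ r / 2 := by simpa using (Metric.mem_ball.1 hz.1).le
    have h1 : ‖f m z.2‖ ≤ B / r ^ m := hfB m _ (hsub hz.2)
    have h2 := hderiv m z.2 hz.2
    refine (norm_add_le _ _).trans (add_le_add ?_ ?_)
    · rw [norm_smul, norm_smul, norm_mul, Complex.norm_natCast, norm_pow]
      have h3 : ‖ContinuousLinearMap.fst ℂ ℂ ℂ‖ ≤ 1 := ContinuousLinearMap.norm_fst_le ℂ ℂ ℂ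
      calc ‖f m z.2‖ * (m * ‖z.1‖ ^ (m - 1) * ‖ContinuousLinearMap.fst ℂ ℂ ℂ‖)
          ≤ B / r ^ m * (m * (r / 2) ^ (m - 1) * 1) := by gcongr
        _ = B * (2 / r) * ((m : ℝ) ^ 1 * (1 / 2) ^ m) := by
          cases m with
          | zero => simp
          | succ m =>
            rw [Nat.add_sub_cancel, div_pow, one_div, inv_pow]
            field_simp
            ring
    · rw [norm_smul, norm_smul, norm_pow]
      have h3 : ‖ContinuousLinearMap.snd ℂ ℂ ℂ‖ ≤ 1 := ContinuousLinearMap.norm_snd_le ℂ ℂ ℂ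
      calc ‖z.1‖ ^ m * (‖deriv (f m) z.2‖ * ‖ContinuousLinearMap.snd ℂ ℂ ℂ‖)
          ≤ (r / 2) ^ m * (B / r ^ m / (δ / 4) * 1) := by gcongr
        _ = B / (δ / 4) * (1 / 2) ^ m := by
          rw [div_pow, one_div, inv_pow]
          field_simp
  -- Summability at one base point is enough; at t = 0 only the term m = 0 remains.
  · refine summable_of_ne_finset_zero (s := {0}) fun m hm => ?_
    simp at hm
    simp [hm]

theorem norm_coeff_mul_pow_le_truncNorm {r : ℝ} (hr : 0 ≤ r) (f : ℂ⟦X⟧) (m : ℕ) :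
    ‖coeff m f‖ * r ^ m ≤ truncNorm r (m + 1) f :=
  Finset.single_le_sum (f := fun m => ‖coeff m f‖ * r ^ m) (fun i _ => by positivity)
    (Finset.self_mem_range_succ m)

theorem summable_mul_pow_of_bound {a : ℕ → ℂ} {r B : ℝ}
    (hB : ∀ m, ‖a m‖ * r ^ m ≤ B) {t : ℂ} (ht : ‖t‖ < r / 2) : Summable fun m => a m * t ^ m := by
  refine Summable.of_norm_bounded (g := fun m => B * (1 / 2) ^ m)
    (Summable.mul_left _ (summable_geometric_of_lt_one (by norm_num) (by norm_num))) fun m => ?_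
  rw [norm_mul, norm_pow]
  calc ‖a m‖ * ‖t‖ ^ m ≤ ‖a m‖ * (r / 2) ^ m := by gcongr
    _ = ‖a m‖ * r ^ m * (1 / 2) ^ m := by rw [div_pow, one_div, inv_pow]; ring
    _ ≤ _ := by gcongr; exact hB m

end PlaneBranch

namespace PlaneBranch

open PowerSeries (X C coeff)

/-! ### The differential equation of the invariant curves of the family -/

theorem map_pullback {R S : Type} [CommRing R] [Algebra ℂ R] [CommRing S] [Algebra ℂ S]
    (φ : R →ₐ[ℂ] S) (ω : OneForm) {x y : R⟦X⟧} (hx : X ∣ x) (hy : X ∣ y) :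
    PowerSeries.map (φ : R →+* S) (ω.pullback x y) =
      ω.pullback (PowerSeries.map (φ : R →+* S) x) (PowerSeries.map (φ : R →+* S) y) := by
  have hx' : X ∣ PowerSeries.map (φ : R →+* S) x := by
    simpa using map_dvd (PowerSeries.map (φ : R →+* S)) hx
  have hy' : X ∣ PowerSeries.map (φ : R →+* S) y := by
    simpa using map_dvd (PowerSeries.map (φ : R →+* S)) hy
  have hsub : ∀ A : MvPowerSeries (Fin 2) ℂ, PowerSeries.map (φ : R →+* S)
      (MvPowerSeries.subst ![x, y] A : R⟦X⟧) = (MvPowerSeries.subst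
        ![PowerSeries.map (φ : R →+* S) x, PowerSeries.map (φ : R →+* S) y] A : S⟦X⟧) := by
    intro A
    ext m
    rw [PowerSeries.coeff_map, coeff_subst_pair A hx hy (Nat.lt_succ_self m),
      coeff_subst_pair A hx' hy' (Nat.lt_succ_self m), map_sum]
    refine Finset.sum_congr rfl fun q _ => ?_
    rw [← map_pow, ← map_pow, ← map_mul (PowerSeries.map _), PowerSeries.coeff_map,
      RingHom.coe_coe, map_mul, AlgHom.commutes]
  have hder : ∀ z : R⟦X⟧, PowerSeries.map (φ : R →+* S) (PowerSeries.derivative R z) =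
      PowerSeries.derivative S (PowerSeries.map (φ : R →+* S) z) := by
    intro z
    ext m
    simp [PowerSeries.coeff_derivative]
  rw [OneForm.pullback, OneForm.pullback, map_add, map_mul, map_mul, hsub, hsub, hder, hder]

theorem diffOp_X_pow_mul (P D : ℕ → ℂ⟦X⟧) (K N : ℕ) (w : ℂ⟦X⟧) :
    diffOp (fun l => X ^ K * P l) (fun l => X ^ K * D l) N w = X ^ K * diffOp P D N w := by
  rw [diffOp, diffOp, Finset.mul_sum]
  exact Finset.sum_congr rfl fun l _ => by ring

theorem sum_range_mul_pow_eq_zero {c : ℕ → ℂ} {N : ℕ}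
    (h : ∀ z : ℂ, ∑ l ∈ Finset.range N, c l * z ^ l = 0) {l : ℕ} (hl : l < N) : c l = 0 := by
  have hp : (∑ l ∈ Finset.range N, Polynomial.monomial l (c l) : Polynomial ℂ) = 0 := by
    refine Polynomial.funext fun z => ?_
    rw [Polynomial.eval_finsetSum]
    simpa using h z
  have := congrArg (fun q => Polynomial.coeff q l) hp
  simpa [Polynomial.finsetSum_coeff, Polynomial.coeff_monomial, hl] using this

/-- If `g = ∑ P_l w ^ l + (∑ D_l w ^ l) t w'` has, for `w = α + v t ^ m`, a first coefficient of the
form `κ α ^ s v + Q(α)`, then the equation `g = 0` is, up to a power of `t`, regular along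
`t = 0`, `w ≠ 0`. -/
theorem exists_regular_equation {P D : ℕ → ℂ⟦X⟧} (hP : ∀ l, X ^ l ∣ P l) (hD : ∀ l, X ^ l ∣ D l)
    {m M s : ℕ} (hm : 0 < m) {κ : ℂ} (hκ : κ ≠ 0) {Q : ℂ → ℂ} (g : ℂ → ℂ → ℂ⟦X⟧)
    (hg : ∀ α v N, X ^ N ∣ g α v - diffOp P D N (C α + C v * X ^ m))
    (hlow : ∀ α v, ∀ i < M, coeff i (g α v) = 0)
    (hlead : ∀ α v, coeff M (g α v) = κ * α ^ s * v + Q α) :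
    ∃ (K : ℕ) (E G : ℕ → ℂ⟦X⟧), (∀ l, P l = X ^ (K + 1) * E l) ∧ (∀ l, D l = X ^ K * G l) ∧
      (∀ α : ℂ, α ≠ 0 → leadingPolynomial G K α ≠ 0) ∧ ∃ l, coeff 0 (G l) ≠ 0 := by
  classical
  have hcoef : ∀ α v i N, i < N →
      coeff i (g α v) = coeff i (diffOp P D N (C α + C v * X ^ m)) := by
    intro α v i N hi
    have := PowerSeries.X_pow_dvd_iff.1 (hg α v N) i hi
    rwa [map_sub, sub_eq_zero] at this
  -- If all P_l and D_l vanished, κ α^s v + Q(α) would vanish identically, which v = 0 and v = 1 at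
  -- α = 1 exclude.
  have hex : ∃ i l, coeff i (P l) ≠ 0 ∨ coeff i (D l) ≠ 0 := by
    by_contra! h0
    have hP0 : P = fun _ => 0 := funext fun l => PowerSeries.ext fun i => (h0 i l).1
    have hD0 : D = fun _ => 0 := funext fun l => PowerSeries.ext fun i => (h0 i l).2
    have h1 : ∀ v, κ * 1 ^ s * v + Q 1 = 0 := fun v => by
      rw [← hlead, hcoef 1 v M (M + 1) (Nat.lt_succ_self M), hP0, hD0]
      simp [diffOp]
    have h2 := h1 0
    have h3 := h1 1
    rw [mul_zero, zero_add] at h2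
    rw [h2] at h3
    exact hκ (by simpa using h3)
  obtain ⟨K, hspec, hlt⟩ : ∃ K, (∃ l, coeff K (P l) ≠ 0 ∨ coeff K (D l) ≠ 0) ∧
      ∀ i < K, ¬ ∃ l, coeff i (P l) ≠ 0 ∨ coeff i (D l) ≠ 0 :=
    ⟨Nat.find hex, Nat.find_spec hex, fun i hi => Nat.find_min hex hi⟩
  have hmin : ∀ l, X ^ K ∣ P l ∧ X ^ K ∣ D l := by
    intro l
    simp only [PowerSeries.X_pow_dvd_iff]
    refine ⟨fun i hi => ?_, fun i hi => ?_⟩ <;>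
    · have := hlt i hi
      push Not at this
      first | exact (this l).1 | exact (this l).2
  choose P' hP' using fun l => (hmin l).1
  choose G hG using fun l => (hmin l).2
  have hXP : ∀ l, X ^ l ∣ X ^ K * P' l := fun l => hP' l ▸ hP l
  have hXG : ∀ l, X ^ l ∣ X ^ K * G l := fun l => hG l ▸ hD l
  obtain rfl : P = fun l => X ^ K * P' l := funext hP'
  obtain rfl : D = fun l => X ^ K * G l := funext hG
  have hcoef' : ∀ α v i N, K + i < N →
      coeff (K + i) (g α v) = coeff i (diffOp P' G N (C α + C v * X ^ m)) := by
    intro α v i N hi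
    rw [hcoef α v _ N hi, diffOp_X_pow_mul, add_comm K, PowerSeries.coeff_X_pow_mul]
  -- After division by t^K, the term v t^m of w is invisible below degree m, whereas v does occur in
  -- degree M.
  have hKM : K + m ≤ M := by
    by_contra! hlt
    have h1 : ∀ v, coeff M (g 1 v) = coeff M (g 1 0) := by
      intro v
      rw [hcoef 1 v M (M + 1) (Nat.lt_succ_self M), hcoef 1 0 M (M + 1) (Nat.lt_succ_self M),
        diffOp_X_pow_mul, diffOp_X_pow_mul, PowerSeries.coeff_X_pow_mul',
        PowerSeries.coeff_X_pow_mul']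
      split_ifs with h
      · refine coeff_diffOp_congr (m := m) ?_ (by omega)
        rw [map_zero, zero_mul, add_zero, add_sub_cancel_left]
        exact Dvd.intro_left _ rfl
      · rfl
    have h2 := h1 1
    rw [hlead, hlead] at h2
    exact hκ (by simpa using h2)
  -- For constant w = z only the P_l contribute, and degree K < M of the pull-back vanishes. So Σ
  -- P'_l(0) z^l is the zero polynomial.
  have hP0 : ∀ l, coeff 0 (P' l) = 0 := by
    intro l
    rcases le_or_gt (K + 1) l with h | h
    · exact X_pow_dvd_coeff_eq_zero (hXP l) (by omega)
    · refine sum_range_mul_pow_eq_zero (c := fun l => coeff 0 (P' l)) (fun z => ?_) h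
      have h1 := hlow z 0 K (by omega)
      have h2 := hcoef' z 0 0 (K + 1) (by omega)
      rw [add_zero, h1] at h2
      rw [h2, diffOp, map_sum]
      refine Finset.sum_congr rfl fun i _ => ?_
      simp [euler]
  have hXP' : ∀ l, X ∣ P' l := fun l => by
    rw [PowerSeries.X_dvd_iff, ← PowerSeries.coeff_zero_eq_constantCoeff_apply]
    exact hP0 l
  choose E hE using hXP'
  obtain rfl : P' = fun l => X * E l := funext hE
  have hm' : m - 1 + 1 = m := Nat.sub_add_cancel hm
  -- In degree K + m the dependence on v comes only from G(0, α) t w', where t w' = m v t^m.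
  have hdiff : ∀ α v, coeff (K + m) (g α v) =
      coeff (K + m) (g α 0) + leadingPolynomial G K α * (m * v) := by
    intro α v
    rw [hcoef' α v m (K + m + 1) (by omega), hcoef' α 0 m (K + m + 1) (by omega)]
    have := PowerSeries.X_pow_dvd_iff.1 (diffOp_add_monomial (E := E) hXG (C α) v (m - 1)
      (L := K + m + 1) (by omega)) m (by omega)
    rw [map_sub, sub_eq_zero, hm', map_add, PowerSeries.coeff_C_mul, PowerSeries.coeff_X_pow_self,
      mul_one, PowerSeries.coeff_zero_C] at this
    rw [this, map_zero, zero_mul, add_zero]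
  have hmC : (m : ℂ) ≠ 0 := Nat.cast_ne_zero.2 hm.ne'
  have hG0 : ∃ l, coeff 0 (G l) ≠ 0 := by
    obtain ⟨l, hl⟩ := hspec
    refine ⟨l, ?_⟩
    have h1 := PowerSeries.coeff_X_pow_mul (X * E l) K 0
    have h2 := PowerSeries.coeff_X_pow_mul (G l) K 0
    rw [zero_add] at h1 h2
    rw [h1, h2, hP0 l] at hl
    simpa using hl
  -- Were M larger, degree K + m would vanish for all α and v, hence G(0, α) would be zero for all
  -- α, contradicting `hG0`.
  have hMK : M = K + m := by
    by_contra hne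
    obtain ⟨l, hl⟩ := hG0
    refine hl ?_
    rcases le_or_gt (K + 1) l with h | h
    · exact X_pow_dvd_coeff_eq_zero (hXG l) (by omega)
    · refine sum_range_mul_pow_eq_zero (c := fun l => coeff 0 (G l)) (fun z => ?_) h
      have h1 := hdiff z 1
      rw [hlow z 1 _ (by omega), hlow z 0 _ (by omega), zero_add, mul_one] at h1
      exact (mul_eq_zero.1 h1.symm).resolve_right hmC
  refine ⟨K, E, G, fun l => ?_, fun l => rfl, fun α hα h0 => ?_, hG0⟩
  · rw [pow_succ, mul_assoc]
  · have h1 := hdiff α 1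
    rw [← hMK, hlead, hlead, h0] at h1
    exact mul_ne_zero hκ (pow_ne_zero s hα) (by simpa using h1)

variable (Γ : PlaneBranch)

/-- The part of the parametrization of `Γ` of degree less than `β_j`. -/
noncomputable def lowerPart (j : ℕ) : ℂ⟦X⟧ := PowerSeries.mk fun m => if m < Γ.beta j then Γ.a m else 0

theorem coeff_lowerPart (j m : ℕ) :
    coeff m (Γ.lowerPart j) = if m < Γ.beta j then Γ.a m else 0 := PowerSeries.coeff_mk _ _

theorem a_zero : Γ.a 0 = 0 := by
  by_contra h
  exact absurd (Γ.lt_exponent 0 h) (Nat.not_lt_zero _)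

theorem X_dvd_lowerPart (j : ℕ) : X ∣ Γ.lowerPart j := by
  rw [PowerSeries.X_dvd_iff, ← PowerSeries.coeff_zero_eq_constantCoeff_apply, coeff_lowerPart,
    a_zero, ite_self]

theorem lowerPart_mem_seriesIn (j : ℕ) : Γ.lowerPart (j + 1) ∈ seriesIn (Γ.e j) := by
  intro m hm
  rw [coeff_lowerPart]
  split_ifs with h
  · by_contra h0
    exact hm (Γ.e_dvd_of_lt_beta h0 h)
  · rfl

theorem seriesIn_mono {e e' : ℕ} (h : e ∣ e') : seriesIn e' ≤ seriesIn e :=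
  fun _ hf m hm => hf m fun h' => hm (h.trans h')

theorem coeff_lowerPart_add (j : ℕ) (w : ℂ⟦X⟧) (m : ℕ) :
    coeff m (Γ.lowerPart j + X ^ Γ.beta j * w) =
      if m < Γ.beta j then Γ.a m else coeff (m - Γ.beta j) w := by
  rw [map_add, coeff_lowerPart, PowerSeries.coeff_X_pow_mul']
  split_ifs with h1 h2
  · omega
  · rw [add_zero]
  · rw [zero_add]
  · omega

theorem eval_eq_of_mem_coeffRing {j : ℕ} {P : ℕ → Prop} {q : MvPolynomial ℕ ℂ}
    (hq : q ∈ Γ.coeffRing j P) {a a' : ℕ → ℂ}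
    (h : ∀ b ∈ Γ.exponents, Γ.beta j ≤ b → P b → a b = a' b) :
    MvPolynomial.eval a q = MvPolynomial.eval a' q := by
  rw [coeffRing, MvPolynomial.mem_supported] at hq
  refine MvPolynomial.eval₂Hom_congr' rfl (fun i hi _ => ?_) rfl
  obtain ⟨h1, h2, h3⟩ := hq hi
  exact h i h1 h2 h3

/-- The values of the variables `a_b` corresponding to the curve with `w = α + v t ^ m`. -/
noncomputable def specialValues (β ν : ℕ) (α v : ℂ) : ℕ → ℂ := fun b =>
  if b = β then α else if b = ν then v else 0

/-- Setting a_β = α, a_ν = v and the other free variables to 0, where ν follows β, specialises the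
generic curve to w = α + v t^(ν-β). No exponent lies strictly between β and ν, so `Q ν` depends on α
alone and the coefficient of degree k + ν is κ α^s v + Q(α). -/
theorem exists_regular_equation_of_mem_hatDelta {ω : OneForm} {j : ℕ} (hj : 1 ≤ j)
    (hjg : j ≤ Γ.genus) (hω : ω ∈ Γ.hatDelta j) :
    ∃ (K : ℕ) (E G : ℕ → ℂ⟦X⟧),
      (∀ l, zerothPart ω Γ.n (Γ.beta j) (Γ.lowerPart j) l = X ^ (K + 1) * E l) ∧
      (∀ l, firstPart ω Γ.n (Γ.beta j) (Γ.lowerPart j) l = X ^ K * G l) ∧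
      (∀ α : ℂ, α ≠ 0 → leadingPolynomial G K α ≠ 0) ∧ ∃ l, coeff 0 (G l) ≠ 0 := by
  classical
  obtain ⟨i, rfl⟩ := Nat.exists_eq_add_of_le' hj
  set β := Γ.beta (i + 1) with hβ
  set ν := Γ.next β with hν
  obtain ⟨L, -, c, s, hc, hR⟩ : ∃ L : Γ.LeadingVariable (i + 1) ν 0
      (Γ.genericPullback ω (i + 1)), L.StrictlyIncreasing ∧ ∃ (c : ℂ) (s : ℕ), c ≠ 0 ∧
        L.R = MvPolynomial.C c * MvPolynomial.X β ^ s := hω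
  obtain ⟨hνE, hβν⟩ := Γ.next_mem (b := β) (by omega)
  rw [← hν] at hνE hβν
  have hβE : β ∈ Γ.exponents := ⟨i + 1, 0, by omega, hjg, by simp [hβ]⟩
  have hβ0 : 0 < β := Γ.exponents_pos hβE
  have hn : 0 < Γ.n := by have := Γ.two_le; omega
  set gen : (MvPolynomial ℕ ℂ)⟦X⟧ :=
    PowerSeries.mk fun b => if b ∈ Γ.exponents then Γ.genericCoeff (i + 1) b else 0 with hgen
  have hgenX : X ∣ gen := by
    rw [PowerSeries.X_dvd_iff, ← PowerSeries.coeff_zero_eq_constantCoeff_apply, hgen,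
      PowerSeries.coeff_mk, if_neg fun h => (Γ.exponents_pos h).ne' rfl]
  have hxX : (X : (MvPolynomial ℕ ℂ)⟦X⟧) ∣ X ^ Γ.n := dvd_pow_self _ hn.ne'
  let φ : ℂ → ℂ → (MvPolynomial ℕ ℂ →ₐ[ℂ] ℂ) := fun α v =>
    MvPolynomial.aeval (specialValues β ν α v)
  have hφ : ∀ α v q, φ α v q = MvPolynomial.eval (specialValues β ν α v) q := fun α v q => by
    simp only [φ, MvPolynomial.aeval_eq_eval]
  have hmapgen : ∀ α v, PowerSeries.map (φ α v : MvPolynomial ℕ ℂ →+* ℂ) gen =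
      Γ.lowerPart (i + 1) + X ^ β * (C α + C v * X ^ (ν - β)) := by
    intro α v
    ext b
    rw [hβ, coeff_lowerPart_add, ← hβ, PowerSeries.coeff_map, hgen, PowerSeries.coeff_mk,
      RingHom.coe_coe, genericCoeff, ← hβ]
    by_cases h1 : b < β
    · rw [if_pos h1, if_pos h1]
      split_ifs with h2
      · simp [hφ]
      · rw [map_zero]
        by_contra h3
        exact h2 (Γ.mem_exponents_of_lt_beta hjg (Ne.symm h3) h1)
    · rw [if_neg h1, if_neg h1, map_add, PowerSeries.coeff_C, PowerSeries.coeff_C_mul,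
        PowerSeries.coeff_X_pow]
      by_cases h2 : b = β
      · subst h2
        rw [if_pos hβE, hφ, MvPolynomial.eval_X, if_pos (Nat.sub_self _), if_neg (by omega)]
        simp [specialValues]
      · by_cases h3 : b = ν
        · rw [h3, if_pos hνE, hφ, MvPolynomial.eval_X, if_neg (by omega), if_pos rfl]
          simp [specialValues, hβν.ne']
        · rw [if_neg (by omega : ¬ b - β = 0), if_neg (by omega : ¬ b - β = ν - β)]
          split_ifs with h4
          · rw [hφ, MvPolynomial.eval_X]
            simp [specialValues, h2, h3]
          · simp
  set g : ℂ → ℂ → ℂ⟦X⟧ := fun α v =>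
    PowerSeries.map (φ α v : MvPolynomial ℕ ℂ →+* ℂ) (Γ.genericPullback ω (i + 1)) with hg
  have hgeq : ∀ α v, g α v = X * ω.pullback (X ^ Γ.n)
      (Γ.lowerPart (i + 1) + X ^ β * (C α + C v * X ^ (ν - β))) := by
    intro α v
    rw [← hmapgen]
    simp only [hg, genericPullback]
    rw [map_mul, map_pullback _ ω hxX hgenX, map_pow, PowerSeries.map_X]
  have hcoeffg : ∀ α v b, coeff b (g α v) = if L.k ≤ b then
      φ α v (if b - L.k ∈ Γ.exponents ∧ ν ≤ b - L.k then L.C (b - L.k) else 0) else 0 := by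
    intro α v b
    simp only [hg]
    rw [PowerSeries.coeff_map, congrArg (coeff b) L.eq_series, PowerSeries.coeff_X_pow_mul']
    split_ifs with h1
    · rw [PowerSeries.coeff_mk, if_pos (by assumption)]; rfl
    · rw [PowerSeries.coeff_mk, if_neg (by assumption)]; simp
    · simp
  refine exists_regular_equation (m := ν - β) (M := L.k + ν) (s := s) (κ := L.ctilde * c)
    (Q := fun α => MvPolynomial.eval (specialValues β ν α 0) (L.Q ν))
    (X_pow_dvd_zerothPart ω hβ0) (X_pow_dvd_firstPart ω hβ0) (by omega)
    (mul_ne_zero L.ctilde_ne_zero hc) g (fun α v N => ?_) (fun α v b hb => ?_) (fun α v => ?_)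
  · rw [hgeq]
    exact pullback_eq_diffOp ω hn hβ0 (Γ.X_dvd_lowerPart _) _ N
  · rw [hcoeffg]
    split_ifs with h1 h2
    · omega
    · rw [map_zero]
    · rfl
  · rw [hcoeffg, if_pos (Nat.le_add_right _ _), Nat.add_sub_cancel_left, if_pos ⟨hνE, le_rfl⟩,
      L.C_eq ν hνE le_rfl, hR, hφ, genericCoeff,
      if_neg (by omega : ¬ ν < Γ.beta (i + 1))]
    simp only [map_add, map_mul, map_pow, MvPolynomial.eval_C, MvPolynomial.eval_X]
    rw [L.c_first, Γ.eval_eq_of_mem_coeffRing (L.Q_mem ν hνE le_rfl)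
      (a' := specialValues β ν α 0)]
    · simp only [specialValues, if_true, hβν.ne', if_false]
      ring
    · intro b hb1 hb2 hb3
      have : b = β := by
        by_contra hne
        exact Nat.notMem_of_lt_sInf hb3 ⟨hb1, lt_of_le_of_ne hb2 (Ne.symm hne)⟩
      simp [specialValues, this]

end PlaneBranch

namespace PlaneBranch

open PowerSeries (X C coeff)

/-! ### Construction of a fanning family -/

variable (Γ : PlaneBranch)

theorem familyCoeff_eq {j : ℕ} {w : ℂ → ℂ⟦X⟧} (hw : ∀ s, w s ∈ seriesIn (Γ.e j))
    (hw0 : ∀ s, coeff 0 (w s) = s) (s : ℂ) (m : ℕ) :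
    Γ.familyCoeff j (fun k s => coeff (k * Γ.e j) (w s)) s m =
      coeff m (Γ.lowerPart j + X ^ Γ.beta j * w s) := by
  rw [coeff_lowerPart_add, familyCoeff]
  split_ifs with h1 h2 h3
  · rfl
  · rw [h2, Nat.sub_self, hw0]
  · rw [Nat.div_mul_cancel h3]
  · exact (hw s _ h3).symm

theorem ne_zero_of_mem_hatDelta {ω : OneForm} {j : ℕ} (hj : 1 ≤ j) (hjg : j ≤ Γ.genus)
    (hω : ω ∈ Γ.hatDelta j) : ω ≠ ⟨0, 0⟩ := by
  rintro rfl
  obtain ⟨K, E, G, -, hG, -, l, hl⟩ := Γ.exists_regular_equation_of_mem_hatDelta hj hjg hω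
  have h := congrArg (coeff K) (hG l)
  have h0 := PowerSeries.coeff_X_pow_mul (G l) K 0
  rw [zero_add] at h0
  rw [h0, firstPart, taylor] at h
  refine hl (h.symm.trans ?_)
  simp [PowerSeries.coeff_X_pow_mul']

/-- The family is p + t^β w with w the formal solution of initial value s. The divisibility of
degrees by e gives its shape, and `solution_bound` its holomorphy. -/
theorem nonempty_fanningFamily {ω : OneForm} {j : ℕ} (hj : 1 ≤ j) (hjg : j ≤ Γ.genus)
    (hol : ω.IsHolomorphic) (hω : ω ∈ Γ.hatDelta j) : Nonempty (Γ.FanningFamily ω j) := by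
  obtain ⟨K, E, G, hE, hG, hlead, l₀, hl₀⟩ := Γ.exists_regular_equation_of_mem_hatDelta hj hjg hω
  obtain ⟨i, rfl⟩ := Nat.exists_eq_add_of_le' hj
  set β := Γ.beta (i + 1) with hβ
  set e := Γ.e (i + 1) with he
  set p := Γ.lowerPart (i + 1) with hp
  have hn : 0 < Γ.n := by have := Γ.two_le; omega
  have hβ0 : 0 < β := by have := Γ.n_lt_beta (i := i) (by omega); omega
  have hpX : X ∣ p := Γ.X_dvd_lowerPart _
  have hpB : ∀ m, β ≤ m → coeff m p = 0 := fun m hm => by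
    rw [hp, coeff_lowerPart, if_neg (by omega)]
  have hen : e ∣ Γ.n := Γ.e_dvd_n _
  have heβ : e ∣ β := Γ.e_succ_dvd_beta i
  have hep : p ∈ seriesIn e := seriesIn_mono (Γ.e_succ_dvd i) (Γ.lowerPart_mem_seriesIn i)
  have hXK : (X : ℂ⟦X⟧) ^ K ≠ 0 := pow_ne_zero _ PowerSeries.X_ne_zero
  -- The series t^K G_(l₀) lies in `seriesIn e` and has a nonzero coefficient in degree K; so t^K
  -- may be divided out inside `seriesIn e`.
  have heK : e ∣ K := by
    by_contra h
    refine hl₀ ?_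
    rw [← PowerSeries.coeff_X_pow_mul (G l₀) K 0, zero_add, ← hG]
    exact firstPart_mem_seriesIn ω hen heβ hep l₀ K h
  have hEs : ∀ l, X * E l ∈ seriesIn e := fun l => by
    refine mem_seriesIn_of_mul_mem (X_pow_mem_seriesIn heK) hXK ?_
    rw [← mul_assoc, ← pow_succ, ← hE]
    exact zerothPart_mem_seriesIn ω hen heβ hep l
  have hGs : ∀ l, G l ∈ seriesIn e := fun l => by
    refine mem_seriesIn_of_mul_mem (X_pow_mem_seriesIn heK) hXK ?_
    rw [← hG]
    exact firstPart_mem_seriesIn ω hen heβ hep l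
  have hE' : ∀ l, X ^ l ∣ X ^ (K + 1) * E l := fun l => hE l ▸ X_pow_dvd_zerothPart ω hβ0 l
  have hG' : ∀ l, X ^ l ∣ X ^ K * G l := fun l => hG l ▸ X_pow_dvd_firstPart ω hβ0 l
  have hEc : Controlled E := (controlled_zerothPart ω hn hβ0 hpX hol hpB).of_X_pow_mul hE
  have hGc : Controlled G := (controlled_firstPart ω hn hβ0 hpX hol hpB).of_X_pow_mul hG
  set w : ℂ → ℂ⟦X⟧ := solution E G K with hw
  have hws : ∀ s, w s ∈ seriesIn e := solution_mem_seriesIn hEs hGs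
  have hfam := Γ.familyCoeff_eq hws coeff_zero_solution
  rw [← hp, ← hβ, ← he] at hfam
  choose! δ r B hδ hr hB hball using fun s₀ (hs₀ : s₀ ≠ 0) =>
    solution_bound hEc hGc hE' hG' (hlead s₀ hs₀)
  have hbound : ∀ s₀ ≠ 0, ∀ s ∈ Metric.ball s₀ (δ s₀), ∀ m,
      ‖coeff m (p + X ^ β * w s)‖ * r s₀ ^ m ≤
        truncNorm (r s₀) β p + r s₀ ^ β * B s₀ := by
    intro s₀ hs₀ s hs m
    have hr0 := (hr s₀ hs₀).le
    have h1 := truncNorm_nonneg hr0 β p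
    have h2 := mul_nonneg (pow_nonneg hr0 β) (hB s₀ hs₀)
    rw [map_add, PowerSeries.coeff_X_pow_mul']
    rcases lt_or_ge m β with h | h
    · rw [if_neg (not_le.2 h), add_zero]
      have h3 := norm_coeff_mul_pow_le_truncNorm hr0 p m
      have h4 := truncNorm_mono_right hr0 (m + 1) (show m + 1 ≤ β from h) p
      linarith
    · rw [if_pos h, hpB m h, zero_add]
      have h3 := (norm_coeff_mul_pow_le_truncNorm hr0 (w s) (m - β)).trans
        ((hball s₀ hs₀ s hs).2 (m - β + 1))
      have h4 : r s₀ ^ m = r s₀ ^ β * r s₀ ^ (m - β) := by rw [← pow_add, Nat.add_sub_cancel' h]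
      have h5 := mul_le_mul_of_nonneg_left h3 (pow_nonneg hr0 β)
      rw [h4]
      linarith
  have hdiff : ∀ s₀ ≠ 0, ∀ m, DifferentiableOn ℂ (fun s => coeff m (p + X ^ β * w s))
      (Metric.ball s₀ (δ s₀)) := fun s₀ hs₀ => (CoeffHolomorphic.const _ p).add
    ((CoeffHolomorphic.const _ (X ^ β)).mul
      (coeffHolomorphic_solution fun s hs => (hball s₀ hs₀ s hs).1))
  -- The radius of convergence is only locally uniform in s, so the neighbourhood of {0} × ℂ^* is a
  -- union of bidiscs.
  set U : Set (ℂ × ℂ) :=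
    ⋃ s₀ ∈ ({0}ᶜ : Set ℂ), Metric.ball 0 (r s₀ / 2) ×ˢ Metric.ball s₀ (δ s₀) with hU
  have hUo : IsOpen U := isOpen_biUnion fun s₀ _ => Metric.isOpen_ball.prod Metric.isOpen_ball
  have hUmem : ∀ z ∈ U, ∃ s₀ ≠ 0, ‖z.1‖ < r s₀ / 2 ∧ z.2 ∈ Metric.ball s₀ (δ s₀) := by
    intro z hz
    simp only [hU, Set.mem_iUnion, Set.mem_prod, exists_prop] at hz
    obtain ⟨s₀, h1, h2, h3⟩ := hz
    exact ⟨s₀, h1, by simpa using h2, h3⟩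
  refine ⟨⟨U, fun z => (z.1 ^ Γ.n, ∑' m, coeff m (p + X ^ β * w z.2) * z.1 ^ m),
    fun k s => coeff (k * e) (w s), hUo, fun s hs => ?_, fun z hz => ?_, fun t s _ => rfl,
    fun t s hts => ?_, fun s hs => ?_⟩⟩
  · simp only [hU, Set.mem_iUnion, Set.mem_prod, exists_prop]
    exact ⟨s, hs, Metric.mem_ball_self (half_pos (hr s hs)), Metric.mem_ball_self (hδ s hs)⟩
  · obtain ⟨s₀, hs₀, ht, hs⟩ := hUmem z hz
    refine DifferentiableAt.differentiableWithinAt (DifferentiableAt.prodMk ?_ ?_)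
    · exact differentiableAt_fst.pow _
    · have hz2 : z.2 ∈ Metric.ball z.2 (δ s₀ - dist z.2 s₀) :=
        Metric.mem_ball_self (sub_pos.2 hs)
      have hsub : Metric.ball z.2 (δ s₀ - dist z.2 s₀) ⊆ Metric.ball s₀ (δ s₀) :=
        Metric.ball_subset_ball' (by linarith)
      exact differentiableAt_tsum_mul_pow (f := fun m s => coeff m (p + X ^ β * w s))
        (t₀ := z.1) (s₀ := z.2) (sub_pos.2 hs) (hr s₀ hs₀) (fun m => (hdiff s₀ hs₀ m).mono hsub)
        (fun m s hs' => hbound s₀ hs₀ s (hsub hs') m) ht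
  · obtain ⟨s₀, hs₀, ht, hs⟩ := hUmem _ hts
    simp only [hfam]
    exact (summable_mul_pow_of_bound (hbound s₀ hs₀ s hs) ht).hasSum
  · have hmk : PowerSeries.mk (Γ.familyCoeff (i + 1) (fun k s => coeff (k * e) (w s)) s) =
        p + X ^ β * w s := by
      ext m
      rw [PowerSeries.coeff_mk, hfam]
    rw [OneForm.Leaves, hmk]
    refine (mul_eq_zero.1 (?_ : X * ω.pullback (X ^ Γ.n) (p + X ^ β * w s) = 0)).resolve_left
      PowerSeries.X_ne_zero
    ext m
    have h1 := PowerSeries.X_pow_dvd_iff.1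
      (pullback_eq_diffOp ω hn hβ0 hpX (w s) (m + 1)) m (Nat.lt_succ_self m)
    rw [map_sub, sub_eq_zero] at h1
    have h2 : zerothPart ω Γ.n β p = fun l => X ^ K * (X * E l) := funext fun l => by
      rw [hE, pow_succ, mul_assoc]
    rw [h1, h2, funext hG, diffOp_X_pow_mul, PowerSeries.coeff_X_pow_mul', map_zero]
    split_ifs with h
    · exact coeff_diffOp_solution hE' hG' (hlead s hs) (by omega)
    · rfl

theorem fans_of_mem_hatDelta {ω : OneForm} {j : ℕ} (hj : 1 ≤ j) (hjg : j ≤ Γ.genus)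
    (hol : ω.IsHolomorphic) (hω : ω ∈ Γ.hatDelta j) : Γ.Fans ω j :=
  ⟨hol, Γ.ne_zero_of_mem_hatDelta hj hjg hω, Γ.nonempty_fanningFamily hj hjg hol hω⟩

end PlaneBranch

namespace PlaneBranch

open PowerSeries (X C constantCoeff)

/-! ### Blow-ups of arcs -/

theorem blowUp_of_eq_mul {u v w : ℂ⟦X⟧} (hu : u ≠ 0) (hv : v = u * w) :
    blowUp (u, v) = (OnePoint.some (constantCoeff w), (u, w - C (constantCoeff w))) := by
  have h : (u, v).1 ∣ (u, v).2 := Dvd.intro _ hv.symm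
  have hw : h.choose = w := mul_left_cancel₀ hu (h.choose_spec.symm.trans hv)
  rw [blowUp, dif_pos h, hw]

theorem blowUp_of_eq_mul_of_constantCoeff {u v w : ℂ⟦X⟧} (hv : v ≠ 0) (hu : u = v * w)
    (hw : constantCoeff w = 0) : blowUp (u, v) = (OnePoint.infty, (w, v)) := by
  have h : ¬ (u, v).1 ∣ (u, v).2 := by
    rintro ⟨q, hq⟩
    simp only [hu] at hq
    have h1 : 1 = w * q := mul_left_cancel₀ hv (by rw [mul_one, ← mul_assoc]; exact hq)
    have := congrArg constantCoeff h1
    rw [map_mul, hw, zero_mul, map_one] at this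
    exact one_ne_zero this
  have h' : (u, v).2 ∣ (u, v).1 := Dvd.intro _ hu.symm
  have hw : h'.choose = w := mul_left_cancel₀ hv (h'.choose_spec.symm.trans hu)
  rw [blowUp, dif_neg h, dif_pos h', hw]

theorem blowUp_mem_seriesIn {e : ℕ} {γ : Arc} (h0 : γ.1 ≠ 0) (h1 : γ.1 ∈ seriesIn e)
    (h2 : γ.2 ∈ seriesIn e) : (blowUp γ).2.1 ≠ 0 ∧ (blowUp γ).2.1 ∈ seriesIn e ∧
      (blowUp γ).2.2 ∈ seriesIn e := by
  obtain ⟨u, v⟩ := γ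
  simp only at h0 h1 h2
  by_cases h : u ∣ v
  · obtain ⟨w, rfl⟩ := h
    rw [blowUp_of_eq_mul h0 rfl]
    exact ⟨h0, h1, sub_mem (mem_seriesIn_of_mul_mem h1 h0 h2) (C_mem_seriesIn e _)⟩
  · obtain ⟨w, rfl⟩ := (ValuationRing.dvd_total u v).resolve_left h
    have hv : v ≠ 0 := left_ne_zero_of_mul h0
    have hw : constantCoeff w = 0 := by
      by_contra hw
      refine h ⟨w⁻¹, ?_⟩
      rw [mul_assoc, PowerSeries.mul_inv_cancel w hw, mul_one]
    rw [blowUp_of_eq_mul_of_constantCoeff hv rfl hw]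
    exact ⟨right_ne_zero_of_mul h0, mem_seriesIn_of_mul_mem h2 hv h1, h2⟩

theorem strictTransform_mem_seriesIn {e : ℕ} {γ : Arc} (h0 : γ.1 ≠ 0) (h1 : γ.1 ∈ seriesIn e)
    (h2 : γ.2 ∈ seriesIn e) (T : ℕ) : (strictTransform γ T).1 ≠ 0 ∧
      (strictTransform γ T).1 ∈ seriesIn e ∧ (strictTransform γ T).2 ∈ seriesIn e := by
  induction T with
  | zero => exact ⟨h0, h1, h2⟩
  | succ T ih => exact blowUp_mem_seriesIn ih.1 ih.2.1 ih.2.2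

theorem X_pow_dvd_of_mem_seriesIn {e : ℕ} {f : ℂ⟦X⟧} (hf : f ∈ seriesIn e)
    (h0 : constantCoeff f = 0) : X ^ e ∣ f := by
  rw [PowerSeries.X_pow_dvd_iff]
  intro m hm
  rcases Nat.eq_zero_or_pos m with rfl | hm0
  · rw [PowerSeries.coeff_zero_eq_constantCoeff_apply, h0]
  · exact hf m (Nat.not_dvd_of_pos_of_lt hm0 hm)

/-- `f = c t ^ a + …` -/
def HasLead (a : ℕ) (c : ℂ) (f : ℂ⟦X⟧) : Prop := ∃ g, f = X ^ a * g ∧ constantCoeff g = c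

theorem HasLead.ne_zero {a : ℕ} {c : ℂ} {f : ℂ⟦X⟧} (h : HasLead a c f) (hc : c ≠ 0) : f ≠ 0 := by
  obtain ⟨g, rfl, rfl⟩ := h
  refine mul_ne_zero (pow_ne_zero _ PowerSeries.X_ne_zero) ?_
  rintro rfl
  exact hc (map_zero _)

theorem HasLead.mul {a b : ℕ} {c d : ℂ} {f g : ℂ⟦X⟧} (hf : HasLead a c f) (hg : HasLead b d g) :
    HasLead (a + b) (c * d) (f * g) := by
  obtain ⟨f, rfl, rfl⟩ := hf
  obtain ⟨g, rfl, rfl⟩ := hg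
  exact ⟨f * g, by rw [pow_add]; ring, map_mul _ _ _⟩

theorem HasLead.exists_eq_mul {a b : ℕ} {c d : ℂ} {f g : ℂ⟦X⟧} (hf : HasLead a c f)
    (hg : HasLead b d g) (hc : c ≠ 0) (hab : a ≤ b) :
    ∃ w, g = f * w ∧ HasLead (b - a) (d / c) w := by
  obtain ⟨f, rfl, rfl⟩ := hf
  obtain ⟨g, rfl, rfl⟩ := hg
  refine ⟨X ^ (b - a) * (g * f⁻¹), ?_, g * f⁻¹, rfl, ?_⟩
  · rw [show X ^ a * f * (X ^ (b - a) * (g * f⁻¹)) = X ^ a * X ^ (b - a) * g * (f * f⁻¹) by ring,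
      PowerSeries.mul_inv_cancel f hc, ← pow_add, Nat.add_sub_cancel' hab, mul_one]
  · rw [map_mul, PowerSeries.constantCoeff_inv, div_eq_mul_inv]

theorem HasLead.constantCoeff {a : ℕ} {c : ℂ} {f : ℂ⟦X⟧} (h : HasLead a c f) :
    constantCoeff f = if a = 0 then c else 0 := by
  obtain ⟨g, rfl, rfl⟩ := h
  rw [map_mul, map_pow, PowerSeries.constantCoeff_X]
  split_ifs with h
  · rw [h, pow_zero, one_mul]
  · rw [zero_pow h, zero_mul]

/-- `f = 1 + φ t ^ r + …` -/
def NearOne (r : ℕ) (φ : ℂ) (f : ℂ⟦X⟧) : Prop := X ^ (r + 1) ∣ f - (1 + C φ * X ^ r)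

theorem NearOne.mul {r : ℕ} (hr : 0 < r) {φ ψ : ℂ} {f g : ℂ⟦X⟧} (hf : NearOne r φ f)
    (hg : NearOne r ψ g) : NearOne r (φ + ψ) (f * g) := by
  have h : f * g - (1 + C (φ + ψ) * X ^ r) = (f - (1 + C φ * X ^ r)) * g +
      (1 + C φ * X ^ r) * (g - (1 + C ψ * X ^ r)) + C (φ * ψ) * X ^ (r + r) := by
    rw [map_add, map_mul, pow_add]; ring
  rw [NearOne, h]
  exact dvd_add (dvd_add (Dvd.dvd.mul_right hf _) (Dvd.dvd.mul_left hg _))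
    (Dvd.dvd.mul_left (pow_dvd_pow _ (by omega)) _)

theorem NearOne.constantCoeff {r : ℕ} (hr : 0 < r) {φ : ℂ} {f : ℂ⟦X⟧} (hf : NearOne r φ f) :
    constantCoeff f = 1 := by
  have h := PowerSeries.X_dvd_iff.1 ((dvd_pow_self X (Nat.succ_ne_zero r)).trans hf)
  rw [map_sub, map_add, map_mul, map_pow, PowerSeries.constantCoeff_X, zero_pow hr.ne', mul_zero,
    add_zero, map_one] at h
  exact sub_eq_zero.1 h

theorem NearOne.inv {r : ℕ} (hr : 0 < r) {φ : ℂ} {f : ℂ⟦X⟧} (hf : NearOne r φ f) :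
    NearOne r (-φ) f⁻¹ := by
  have h0 : PowerSeries.constantCoeff f ≠ 0 := by rw [hf.constantCoeff hr]; exact one_ne_zero
  have h : f⁻¹ - (1 + C (-φ) * X ^ r) =
      f⁻¹ * (C (φ * φ) * X ^ (r + r) - (f - (1 + C φ * X ^ r)) * (1 - C φ * X ^ r)) := by
    have h1 : f⁻¹ * f = 1 := PowerSeries.inv_mul_cancel f h0
    have h2 : f⁻¹ * (C (φ * φ) * X ^ (r + r) - (f - (1 + C φ * X ^ r)) * (1 - C φ * X ^ r)) =
        f⁻¹ - f⁻¹ * f * (1 - C φ * X ^ r) := by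
      rw [map_mul, pow_add]; ring
    rw [h2, h1, map_neg]; ring
  rw [NearOne, h]
  exact Dvd.dvd.mul_left (dvd_sub (Dvd.dvd.mul_left (pow_dvd_pow _ (by omega)) _)
    (Dvd.dvd.mul_right hf _)) _

theorem NearOne.ne_zero {r : ℕ} (hr : 0 < r) {φ : ℂ} {f : ℂ⟦X⟧} (hf : NearOne r φ f) : f ≠ 0 := by
  rintro rfl
  have := hf.constantCoeff hr
  rw [map_zero] at this
  exact zero_ne_one this

theorem nearOne_of_X_pow_dvd {r q : ℕ} (h : r < q) {f : ℂ⟦X⟧} (hf : X ^ q ∣ f - 1) :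
    NearOne r 0 f := by
  rw [NearOne, map_zero, zero_mul, add_zero]
  exact (pow_dvd_pow _ h).trans hf

theorem NearOne.X_pow_dvd {r : ℕ} {φ : ℂ} {f : ℂ⟦X⟧} (hf : NearOne r φ f) : X ^ r ∣ f - 1 := by
  have h : f - 1 = f - (1 + C φ * X ^ r) + C φ * X ^ r := by ring
  rw [h]
  exact dvd_add ((pow_dvd_pow _ (Nat.le_succ r)).trans hf) (Dvd.intro_left _ rfl)

/-- Blow-up of two nearby arcs at a point of the second one with a finite position, when they
differ in degree `q` more than the multiplicity of the exceptional divisor. -/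
theorem blowUp_free {U V u v f : ℂ⟦X⟧} {a q : ℕ} {c μ : ℂ} (hU : HasLead a c U) (hc : c ≠ 0)
    (haq : a < q) (ha : 0 < a) (hV : X ^ a ∣ V) (hu : u = U * f) (hf : X ^ q ∣ f - 1)
    (hv : X ^ (q + 1) ∣ v - V - C μ * X ^ q) :
    ∃ (z : ℂ) (W w : ℂ⟦X⟧), blowUp (U, V) = (OnePoint.some z, (U, W)) ∧
      blowUp (u, v) = (OnePoint.some z, (u, w)) ∧ PowerSeries.constantCoeff W = 0 ∧
      X ^ (q - a + 1) ∣ w - W - C (μ / c) * X ^ (q - a) := by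
  obtain ⟨g, rfl, rfl⟩ := hU
  obtain ⟨V, rfl⟩ := hV
  obtain ⟨k, hk⟩ := hv
  obtain ⟨f', hf'⟩ := hf
  have hX : (X : ℂ⟦X⟧) ^ a ≠ 0 := pow_ne_zero _ PowerSeries.X_ne_zero
  have hg : g ≠ 0 := by rintro rfl; exact hc (map_zero _)
  have hf1 : PowerSeries.constantCoeff f = 1 := by
    rw [sub_eq_iff_eq_add.1 hf']
    simp [zero_pow (by omega : q ≠ 0)]
  have hf0 : f ≠ 0 := by
    rintro rfl
    rw [map_zero] at hf1
    exact zero_ne_one hf1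
  have hgi : g * g⁻¹ = 1 := PowerSeries.mul_inv_cancel g hc
  have hfi : f * f⁻¹ = 1 := PowerSeries.mul_inv_cancel f (by rw [hf1]; exact one_ne_zero)
  set v' : ℂ⟦X⟧ := V + C μ * X ^ (q - a) + X ^ (q - a + 1) * k with hv'
  have hvv : v = X ^ a * v' := by
    have h1 : (X : ℂ⟦X⟧) ^ q = X ^ a * X ^ (q - a) := by rw [← pow_add]; congr 1; omega
    have h2 : v = X ^ a * V + C μ * X ^ q + X ^ (q + 1) * k := by rw [← hk]; ring
    rw [h2, hv', pow_succ, pow_succ, h1]; ring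
  have hB1 := blowUp_of_eq_mul (u := X ^ a * g) (v := X ^ a * V) (w := V * g⁻¹) (mul_ne_zero hX hg)
    (by rw [show X ^ a * g * (V * g⁻¹) = X ^ a * V * (g * g⁻¹) by ring, hgi, mul_one])
  have hB2 := blowUp_of_eq_mul (u := u) (v := v) (w := v' * g⁻¹ * f⁻¹)
    (hu ▸ mul_ne_zero (mul_ne_zero hX hg) hf0) (by
      rw [hu, hvv, show X ^ a * g * f * (v' * g⁻¹ * f⁻¹) = X ^ a * v' * (g * g⁻¹) * (f * f⁻¹) by
        ring, hgi, hfi, mul_one, mul_one])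
  have hunit : X ∣ g⁻¹ * f⁻¹ - C (PowerSeries.constantCoeff g)⁻¹ := by
    rw [PowerSeries.X_dvd_iff, map_sub, map_mul, PowerSeries.constantCoeff_inv,
      PowerSeries.constantCoeff_inv, hf1, inv_one, mul_one, PowerSeries.constantCoeff_C, sub_self]
  have hkey : X ^ (q - a + 1) ∣ v' * g⁻¹ * f⁻¹ - V * g⁻¹ -
      C (μ / PowerSeries.constantCoeff g) * X ^ (q - a) := by
    have h1 : v' * g⁻¹ * f⁻¹ - V * g⁻¹ - C (μ / PowerSeries.constantCoeff g) * X ^ (q - a) =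
        X ^ (q - a + 1) * (k * g⁻¹ * f⁻¹) - V * g⁻¹ * f⁻¹ * (X ^ q * f') +
          X ^ (q - a) * (g⁻¹ * f⁻¹ - C (PowerSeries.constantCoeff g)⁻¹) * C μ := by
      rw [← hf', hv', div_eq_mul_inv, map_mul]
      linear_combination (V * g⁻¹) * hfi
    rw [h1]
    refine dvd_add (dvd_sub (Dvd.intro _ rfl) ?_) ?_
    · exact Dvd.dvd.mul_left (Dvd.dvd.mul_right (pow_dvd_pow _ (by omega)) _) _
    · rw [pow_succ]
      exact Dvd.dvd.mul_right (mul_dvd_mul_left _ hunit) _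
  -- As a < q, the quotients differ only in degree at least q - a > 0, so both arcs pass through the
  -- same point.
  have hconst : PowerSeries.constantCoeff (v' * g⁻¹ * f⁻¹) =
      PowerSeries.constantCoeff (V * g⁻¹) := by
    have h1 := PowerSeries.X_dvd_iff.1 ((dvd_pow_self X (Nat.succ_ne_zero (q - a))).trans hkey)
    rw [map_sub, map_sub, map_mul _ (C _), map_pow, PowerSeries.constantCoeff_X,
      zero_pow (by omega), mul_zero, sub_zero] at h1
    exact sub_eq_zero.1 h1
  rw [hconst] at hB2
  refine ⟨_, _, _, hB1, hB2, ?_, ?_⟩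
  · rw [map_sub, PowerSeries.constantCoeff_C, sub_self]
  · rwa [sub_sub_sub_cancel_right]

theorem nearOne_of_sub {V v : ℂ⟦X⟧} {b q : ℕ} {d μ : ℂ} (hV : HasLead b d V) (hd : d ≠ 0)
    (hbq : b < q) (hv : X ^ (q + 1) ∣ v - V - C μ * X ^ q) :
    ∃ k, v = V * k ∧ NearOne (q - b) (μ / d) k := by
  obtain ⟨h, rfl, rfl⟩ := hV
  obtain ⟨k, hk⟩ := hv
  have hhi : h * h⁻¹ = 1 := PowerSeries.mul_inv_cancel h hd
  have hX : (X : ℂ⟦X⟧) ^ q = X ^ b * X ^ (q - b) := by rw [← pow_add]; congr 1; omega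
  have hunit : X ∣ h⁻¹ - C (PowerSeries.constantCoeff h)⁻¹ := by
    rw [PowerSeries.X_dvd_iff, map_sub, PowerSeries.constantCoeff_inv, PowerSeries.constantCoeff_C,
      sub_self]
  refine ⟨1 + C μ * X ^ (q - b) * h⁻¹ + X ^ (q - b + 1) * (k * h⁻¹), ?_, ?_⟩
  · have h2 : v = X ^ b * h + C μ * X ^ q + X ^ (q + 1) * k := by rw [← hk]; ring
    have h3 : X ^ b * h * (1 + C μ * X ^ (q - b) * h⁻¹ + X ^ (q - b + 1) * (k * h⁻¹)) =
        X ^ b * h + C μ * (X ^ b * X ^ (q - b)) * (h * h⁻¹) +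
          X ^ b * X ^ (q - b) * X * k * (h * h⁻¹) := by rw [pow_succ]; ring
    rw [h3, hhi, h2, pow_succ, hX]; ring
  · have h1 : 1 + C μ * X ^ (q - b) * h⁻¹ + X ^ (q - b + 1) * (k * h⁻¹) -
        (1 + C (μ / PowerSeries.constantCoeff h) * X ^ (q - b)) =
        X ^ (q - b) * (h⁻¹ - C (PowerSeries.constantCoeff h)⁻¹) * C μ +
          X ^ (q - b + 1) * (k * h⁻¹) := by
      rw [div_eq_mul_inv, map_mul]; ring
    rw [NearOne, h1]
    refine dvd_add ?_ (Dvd.intro _ rfl)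
    rw [pow_succ]
    exact Dvd.dvd.mul_right (mul_dvd_mul_left _ hunit) _

theorem X_pow_dvd_mul_sub {W k : ℂ⟦X⟧} {r : ℕ} {ψ : ℂ} (hk : NearOne r ψ k) :
    X ^ (r + 1) ∣ W * k - W - C (ψ * PowerSeries.constantCoeff W) * X ^ r := by
  have hunit : X ∣ W - C (PowerSeries.constantCoeff W) := by
    rw [PowerSeries.X_dvd_iff, map_sub, PowerSeries.constantCoeff_C, sub_self]
  have h : W * k - W - C (ψ * PowerSeries.constantCoeff W) * X ^ r =
      W * (k - (1 + C ψ * X ^ r)) + X ^ r * (W - C (PowerSeries.constantCoeff W)) * C ψ := by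
    rw [map_mul]; ring
  rw [h]
  refine dvd_add (Dvd.dvd.mul_left hk _) ?_
  rw [pow_succ]
  exact Dvd.dvd.mul_right (mul_dvd_mul_left _ hunit) _

end PlaneBranch

namespace PlaneBranch

open PowerSeries (X C coeff constantCoeff)

/-! ### Infinitely near points of the curves with the same lower part -/

variable (Γ : PlaneBranch)

/-- The arcs `(t ^ n, ∑_{m < β_l} a_m t ^ m + s t ^ {β_l} + …)`. -/
def IsMember (l : ℕ) (s : ℂ) (γ : Arc) : Prop :=
  γ.1 = X ^ Γ.n ∧ X ^ (Γ.beta l + 1) ∣ γ.2 - Γ.lowerPart l - C s * X ^ Γ.beta l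

/-- The arc `(t ^ n, ∑_{m < β_l} a_m t ^ m)`. -/
noncomputable def lowerArc (l : ℕ) : Arc := (X ^ Γ.n, Γ.lowerPart l)

theorem isMember_of_coeff {l : ℕ} {s : ℂ} {γ : Arc} (h1 : γ.1 = X ^ Γ.n)
    (h2 : ∀ m < Γ.beta l, coeff m γ.2 = Γ.a m) (h3 : coeff (Γ.beta l) γ.2 = s) :
    Γ.IsMember l s γ := by
  refine ⟨h1, ?_⟩
  rw [PowerSeries.X_pow_dvd_iff]
  intro m hm
  rw [map_sub, map_sub, coeff_lowerPart, PowerSeries.coeff_C_mul, PowerSeries.coeff_X_pow]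
  rcases Nat.lt_succ_iff_lt_or_eq.1 hm with h | rfl
  · rw [if_pos h, if_neg h.ne, h2 m h]; ring
  · rw [if_neg (lt_irrefl _), if_pos rfl, h3]; ring

theorem isMember_lowerArc {i l : ℕ} (hi : 1 ≤ i) (h : i < l) (hl : l ≤ Γ.genus) :
    Γ.IsMember i (Γ.a (Γ.beta i)) (Γ.lowerArc l) := by
  have hlt := Γ.beta_lt_beta hi h hl
  refine Γ.isMember_of_coeff rfl (fun m hm => ?_) ?_
  · rw [lowerArc, coeff_lowerPart, if_pos (by omega)]
  · rw [lowerArc, coeff_lowerPart, if_pos hlt]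

/-- The strict transforms of the arcs of level `l` agree up to terms of relative degree `q` in the
first coordinate and of degree `q` in the second one, where they depend linearly on `s`. -/
def FreeState (l T a q : ℕ) : Prop :=
  ∃ c μ : ℂ, c ≠ 0 ∧ μ ≠ 0 ∧ HasLead a c (strictTransform (Γ.lowerArc l) T).1 ∧
    constantCoeff (strictTransform (Γ.lowerArc l) T).2 = 0 ∧
    ∀ s γ, Γ.IsMember l s γ → nearPoint γ T = nearPoint (Γ.lowerArc l) T ∧
      (∃ f, (strictTransform γ T).1 = (strictTransform (Γ.lowerArc l) T).1 * f ∧ X ^ q ∣ f - 1) ∧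
      X ^ (q + 1) ∣ (strictTransform γ T).2 - (strictTransform (Γ.lowerArc l) T).2 -
        C (μ * s) * X ^ q

/-- The strict transforms of the arcs of level `l` have orders `a` and `b` and agree up to terms of
relative degree `r`, where they depend linearly on `s`. -/
def SatelliteState (l T a b r : ℕ) : Prop :=
  ∃ (c d μ : ℂ) (κ₁ κ₂ : ℕ), c ≠ 0 ∧ d ≠ 0 ∧ μ ≠ 0 ∧ 0 < κ₁ + κ₂ ∧
    HasLead a c (strictTransform (Γ.lowerArc l) T).1 ∧
    HasLead b d (strictTransform (Γ.lowerArc l) T).2 ∧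
    ∀ s γ, Γ.IsMember l s γ → nearPoint γ T = nearPoint (Γ.lowerArc l) T ∧
      (∃ f, (strictTransform γ T).1 = (strictTransform (Γ.lowerArc l) T).1 * f ∧
        NearOne r (-(κ₁ * μ * s)) f) ∧
      ∃ k, (strictTransform γ T).2 = (strictTransform (Γ.lowerArc l) T).2 * k ∧
        NearOne r (κ₂ * μ * s) k

variable {Γ} {l T a b q r : ℕ}

theorem nearPoint_succ_of_eq {γ δ : Arc} {x y : OnePoint ℂ × Arc}
    (h : nearPoint γ T = nearPoint δ T) (hγ : blowUp (strictTransform γ T) = x)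
    (hδ : blowUp (strictTransform δ T) = y) (hxy : x.1 = y.1) :
    nearPoint γ (T + 1) = nearPoint δ (T + 1) := by
  rw [nearPoint, nearPoint, h, hγ, hδ, hxy]

/-- Division by the first coordinate c t^a + … lowers the degree of first dependence on s by a and
divides its coefficient by c. -/
theorem FreeState.step (h : Γ.FreeState l T a q) (ha : 0 < a) (haq : a < q)
    (hV : X ^ a ∣ (strictTransform (Γ.lowerArc l) T).2) :
    Γ.FreeState l (T + 1) a (q - a) ∧
      ∃ z : ℂ, nearPoint (Γ.lowerArc l) (T + 1) =
        OnePoint.some z :: nearPoint (Γ.lowerArc l) T := by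
  obtain ⟨c, μ, hc, hμ, hU, -, hmem⟩ := h
  obtain ⟨V', hV'⟩ := hV
  have hu := hU.ne_zero hc
  obtain ⟨g, hg, hgc⟩ := hU
  have hB := blowUp_of_eq_mul (v := (strictTransform (Γ.lowerArc l) T).2) (w := V' * g⁻¹) hu (by
    rw [hV', hg, show X ^ a * g * (V' * g⁻¹) = X ^ a * V' * (g * g⁻¹) by ring,
      PowerSeries.mul_inv_cancel g (by rwa [hgc]), mul_one])
  rw [Prod.mk.eta] at hB
  refine ⟨⟨c, μ / c, hc, div_ne_zero hμ hc, ?_, ?_, ?_⟩, _, by rw [nearPoint, hB]⟩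
  · rw [strictTransform, hB]
    exact ⟨g, hg, hgc⟩
  · rw [strictTransform, hB, map_sub, PowerSeries.constantCoeff_C, sub_self]
  · intro s γ hγ
    obtain ⟨h1, ⟨f, hf, hf1⟩, h3⟩ := hmem s γ hγ
    obtain ⟨z, W, w, hB1, hB2, -, hw⟩ := blowUp_free ⟨g, hg, hgc⟩ hc haq ha ⟨V', hV'⟩ hf hf1 h3
    rw [Prod.mk.eta] at hB1 hB2
    refine ⟨nearPoint_succ_of_eq h1 hB2 hB1 rfl,
      ⟨f, ?_, (pow_dvd_pow _ (by omega)).trans hf1⟩, ?_⟩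
    · rw [strictTransform, strictTransform, hB1, hB2, hf]
    · rw [strictTransform, strictTransform, hB1, hB2, div_mul_eq_mul_div]
      exact hw

/-- A difference in degree q is of relative degree q - b for a series of order b. The first
coordinate agrees to relative degree q > q - b, so at the start only the second depends on s. -/
theorem FreeState.satelliteState (h : Γ.FreeState l T a q) {d : ℂ} (hd : d ≠ 0) (hb : 0 < b)
    (hbq : b < q) (hV : HasLead b d (strictTransform (Γ.lowerArc l) T).2) :
    Γ.SatelliteState l T a b (q - b) := by
  obtain ⟨c, μ, hc, hμ, hU, -, hmem⟩ := h
  refine ⟨c, d, μ / d, 0, 1, hc, hd, div_ne_zero hμ hd, one_pos, hU, hV, fun s γ hγ => ?_⟩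
  obtain ⟨h1, ⟨f, hf, hf1⟩, h3⟩ := hmem s γ hγ
  obtain ⟨k, hk, hk1⟩ := nearOne_of_sub hV hd hbq h3
  refine ⟨h1, ⟨f, hf, ?_⟩, k, hk, ?_⟩
  · simpa using nearOne_of_X_pow_dvd (show q - b < q by omega) hf1
  · convert hk1 using 1
    push_cast
    ring

/-- Dividing factors 1 + φ t^r + … subtracts the φ's. Those of the two coordinates have opposite
signs, so κ₁ and κ₂ add up and the dependence on s never cancels. -/
theorem SatelliteState.step_lt (h : Γ.SatelliteState l T a b r) (hr : 0 < r) (hab : a < b) :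
    Γ.SatelliteState l (T + 1) a (b - a) r := by
  obtain ⟨c, d, μ, κ₁, κ₂, hc, hd, hμ, hκ, hU, hV, hmem⟩ := h
  obtain ⟨W, hW, hWl⟩ := hU.exists_eq_mul hV hc hab.le
  have hW0 : constantCoeff W = 0 := by rw [hWl.constantCoeff, if_neg (by omega)]
  have hB := blowUp_of_eq_mul (hU.ne_zero hc) hW
  rw [Prod.mk.eta, hW0, map_zero, sub_zero] at hB
  refine ⟨c, d / c, μ, κ₁, κ₁ + κ₂, hc, div_ne_zero hd hc, hμ, by omega, ?_, ?_,
    fun s γ hγ => ?_⟩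
  · rwa [strictTransform, hB]
  · rwa [strictTransform, hB]
  · obtain ⟨h1, ⟨f, hf, hf1⟩, k, hk, hk1⟩ := hmem s γ hγ
    have hff : f * f⁻¹ = 1 :=
      PowerSeries.mul_inv_cancel f (by rw [hf1.constantCoeff hr]; exact one_ne_zero)
    have hBγ := blowUp_of_eq_mul (u := (strictTransform γ T).1) (v := (strictTransform γ T).2)
      (w := W * (k * f⁻¹)) (hf ▸ mul_ne_zero (hU.ne_zero hc) (hf1.ne_zero hr)) (by
        rw [hk, hW, hf]
        linear_combination (-(strictTransform (Γ.lowerArc l) T).1 * W * k) * hff)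
    rw [Prod.mk.eta, map_mul, hW0, zero_mul, map_zero, sub_zero] at hBγ
    refine ⟨nearPoint_succ_of_eq h1 hBγ hB rfl,
      ⟨f, ?_, hf1⟩, k * f⁻¹, ?_, ?_⟩
    · rw [strictTransform, strictTransform, hB, hBγ, hf]
    · rw [strictTransform, strictTransform, hB, hBγ]
    · convert hk1.mul hr (hf1.inv hr) using 1
      push_cast
      ring

theorem SatelliteState.step_gt (h : Γ.SatelliteState l T a b r) (hr : 0 < r) (hab : b < a) :
    Γ.SatelliteState l (T + 1) (a - b) b r := by
  obtain ⟨c, d, μ, κ₁, κ₂, hc, hd, hμ, hκ, hU, hV, hmem⟩ := h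
  obtain ⟨W, hW, hWl⟩ := hV.exists_eq_mul hU hd hab.le
  have hW0 : constantCoeff W = 0 := by rw [hWl.constantCoeff, if_neg (by omega)]
  have hB := blowUp_of_eq_mul_of_constantCoeff (hV.ne_zero hd) hW hW0
  rw [Prod.mk.eta] at hB
  refine ⟨c / d, d, μ, κ₁ + κ₂, κ₂, div_ne_zero hc hd, hd, hμ, by omega, ?_, ?_,
    fun s γ hγ => ?_⟩
  · rwa [strictTransform, hB]
  · rwa [strictTransform, hB]
  · obtain ⟨h1, ⟨f, hf, hf1⟩, k, hk, hk1⟩ := hmem s γ hγ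
    have hkk : k * k⁻¹ = 1 :=
      PowerSeries.mul_inv_cancel k (by rw [hk1.constantCoeff hr]; exact one_ne_zero)
    have hBγ := blowUp_of_eq_mul_of_constantCoeff (u := (strictTransform γ T).1)
      (v := (strictTransform γ T).2) (w := W * (f * k⁻¹))
      (hk ▸ mul_ne_zero (hV.ne_zero hd) (hk1.ne_zero hr)) (by
        rw [hk, hf, hW]
        linear_combination (-(strictTransform (Γ.lowerArc l) T).2 * W * f) * hkk)
      (by rw [map_mul, hW0, zero_mul])
    rw [Prod.mk.eta] at hBγ
    refine ⟨nearPoint_succ_of_eq h1 hBγ hB rfl,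
      ⟨f * k⁻¹, ?_, ?_⟩, k, ?_, hk1⟩
    · rw [strictTransform, strictTransform, hB, hBγ]
    · convert hf1.mul hr (hk1.inv hr) using 1
      push_cast
      ring
    · rw [strictTransform, strictTransform, hB, hBγ, hk]

/-- With equal orders the quotient is a unit with constant term d / c, independent of s. After
translation to that point, s enters in degree r with coefficient (κ₁ + κ₂) μ d / c ≠ 0. -/
theorem SatelliteState.step_eq (h : Γ.SatelliteState l T a a r) (hr : 0 < r) :
    Γ.FreeState l (T + 1) a r ∧ ∃ z : ℂ, z ≠ 0 ∧ nearPoint (Γ.lowerArc l) (T + 1) =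
      OnePoint.some z :: nearPoint (Γ.lowerArc l) T := by
  obtain ⟨c, d, μ, κ₁, κ₂, hc, hd, hμ, hκ, hU, hV, hmem⟩ := h
  obtain ⟨W, hW, hWl⟩ := hU.exists_eq_mul hV hc le_rfl
  have hW0 : constantCoeff W = d / c := by rw [hWl.constantCoeff, if_pos (Nat.sub_self a)]
  have hdc : d / c ≠ 0 := div_ne_zero hd hc
  have hB := blowUp_of_eq_mul (hU.ne_zero hc) hW
  rw [Prod.mk.eta, hW0] at hB
  have hκ' : ((κ₁ + κ₂ : ℕ) : ℂ) ≠ 0 := Nat.cast_ne_zero.2 hκ.ne'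
  refine ⟨⟨c, (κ₁ + κ₂ : ℕ) * μ * (d / c), hc, mul_ne_zero (mul_ne_zero hκ' hμ) hdc, ?_, ?_,
    fun s γ hγ => ?_⟩, d / c, hdc, by rw [nearPoint, hB]⟩
  · rwa [strictTransform, hB]
  · rw [strictTransform, hB, map_sub, hW0, PowerSeries.constantCoeff_C, sub_self]
  · obtain ⟨h1, ⟨f, hf, hf1⟩, k, hk, hk1⟩ := hmem s γ hγ
    have hff : f * f⁻¹ = 1 :=
      PowerSeries.mul_inv_cancel f (by rw [hf1.constantCoeff hr]; exact one_ne_zero)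
    have hkf := hk1.mul hr (hf1.inv hr)
    have hBγ := blowUp_of_eq_mul (u := (strictTransform γ T).1) (v := (strictTransform γ T).2)
      (w := W * (k * f⁻¹)) (hf ▸ mul_ne_zero (hU.ne_zero hc) (hf1.ne_zero hr)) (by
        rw [hk, hW, hf]
        linear_combination (-(strictTransform (Γ.lowerArc l) T).1 * W * k) * hff)
    rw [Prod.mk.eta, map_mul, hW0, hkf.constantCoeff hr, mul_one] at hBγ
    refine ⟨nearPoint_succ_of_eq h1 hBγ hB rfl,
      ⟨f, ?_, hf1.X_pow_dvd⟩, ?_⟩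
    · rw [strictTransform, strictTransform, hB, hBγ, hf]
    · rw [strictTransform, strictTransform, hB, hBγ]
      simp only
      rw [sub_sub_sub_cancel_right]
      convert X_pow_dvd_mul_sub (W := W) hkf using 3
      rw [hW0]
      push_cast
      congr 1
      ring

/-- Euclid's subtractive algorithm on (a, b). It is run for all levels l at once so that the number
of blow-ups is common to them. -/
theorem exists_freeState_of_satelliteState {I : ℕ → Prop} {r : ℕ → ℕ} (hr : ∀ l, I l → 0 < r l)
    (N : ℕ) : ∀ T a b, a + b ≤ N → 0 < a → 0 < b → (∀ l, I l → Γ.SatelliteState l T a b (r l)) →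
      ∃ T', ∀ l, I l → Γ.FreeState l T' (Nat.gcd a b) (r l) ∧
        (axesInDivisor (nearPoint (Γ.lowerArc l) T')).1 ∧
        ¬ (axesInDivisor (nearPoint (Γ.lowerArc l) T')).2 := by
  induction N with
  | zero => intro T a b h ha; omega
  | succ N ih =>
    intro T a b h ha hb hS
    rcases lt_trichotomy a b with hab | rfl | hab
    · obtain ⟨T', hT'⟩ := ih (T + 1) a (b - a) (by omega) ha (by omega)
        fun l hl => (hS l hl).step_lt (hr l hl) hab
      rw [Nat.gcd_sub_self_right hab.le] at hT'
      exact ⟨T', hT'⟩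
    · refine ⟨T + 1, fun l hl => ?_⟩
      obtain ⟨h1, z, hz, h2⟩ := (hS l hl).step_eq (hr l hl)
      rw [Nat.gcd_self, h2]
      exact ⟨h1, trivial, fun h3 => hz h3.2⟩
    · obtain ⟨T', hT'⟩ := ih (T + 1) (a - b) b (by omega) (by omega) hb
        fun l hl => (hS l hl).step_gt (hr l hl) hab
      rw [Nat.gcd_sub_self_left hab.le] at hT'
      exact ⟨T', hT'⟩

variable (Γ)

/-- The situation after the resolution of the first `i` characteristic exponents. -/
structure Stage (i j C T : ℕ) : Prop where
  dvd : Γ.e i ∣ C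
  lt : C < Γ.beta (i + 1)
  free : ∀ l, i < l → l ≤ j → Γ.FreeState l T (Γ.e i) (Γ.beta l - C)
  not_snd : ¬ (axesInDivisor (nearPoint (Γ.lowerArc j) T)).2
  fst : (axesInDivisor (nearPoint (Γ.lowerArc j) T)).1 ∨ Γ.e i < Γ.beta (i + 1) - C

variable {Γ} {i j K : ℕ}

theorem lowerArc_mem_seriesIn (i T : ℕ) :
    (strictTransform (Γ.lowerArc (i + 1)) T).2 ∈ seriesIn (Γ.e i) :=
  (strictTransform_mem_seriesIn (γ := Γ.lowerArc (i + 1))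
    (pow_ne_zero _ PowerSeries.X_ne_zero) (X_pow_mem_seriesIn (Γ.e_dvd_n i))
    (Γ.lowerPart_mem_seriesIn i) T).2.2

theorem Stage.beta_le (hj : j ≤ Γ.genus) {l : ℕ} (hl : i < l) (hlj : l ≤ j) :
    Γ.beta (i + 1) ≤ Γ.beta l := by
  rcases Nat.eq_or_lt_of_le (show i + 1 ≤ l from hl) with rfl | h
  · rfl
  · exact (Γ.beta_lt_beta (by omega) h (by omega)).le

/-- At level i + 1 the strict transform is a series in t^(e_i), and it vanishes at t = 0. -/
theorem Stage.X_pow_dvd_snd (h : Γ.Stage i j K T) (hij : i < j) :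
    X ^ Γ.e i ∣ (strictTransform (Γ.lowerArc (i + 1)) T).2 := by
  obtain ⟨c, μ, -, -, -, h0, -⟩ := h.free (i + 1) (Nat.lt_succ_self i) hij
  exact X_pow_dvd_of_mem_seriesIn (lowerArc_mem_seriesIn i T) h0

theorem Stage.step (h : Γ.Stage i j K T) (hij : i < j) (hj : j ≤ Γ.genus)
    (hlt : Γ.e i < Γ.beta (i + 1) - K) : Γ.Stage i j (K + Γ.e i) (T + 1) := by
  have hdvd : ∀ l, i < l → l ≤ j →
      X ^ Γ.e i ∣ (strictTransform (Γ.lowerArc l) T).2 := by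
    intro l hl hlj
    have h0 := h.X_pow_dvd_snd hij
    rcases Nat.eq_or_lt_of_le (show i + 1 ≤ l from hl) with rfl | hil
    · exact h0
    -- For a higher level l, `lowerArc l` is itself a member of level i + 1, so it differs from
    -- `lowerArc (i + 1)` only in degree β_(i+1) - K > e_i.
    · obtain ⟨c, μ, -, -, -, -, hmem⟩ := h.free (i + 1) (Nat.lt_succ_self i) hij
      obtain ⟨-, -, h1⟩ := hmem _ _ (Γ.isMember_lowerArc (by omega) hil (by omega))
      have h2 := (pow_dvd_pow (X : ℂ⟦X⟧)
        (show Γ.e i ≤ Γ.beta (i + 1) - K + 1 by omega)).trans h1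
      have h3 : X ^ Γ.e i ∣ C (μ * Γ.a (Γ.beta (i + 1))) * X ^ (Γ.beta (i + 1) - K) :=
        Dvd.dvd.mul_left (pow_dvd_pow _ hlt.le) _
      have h4 := dvd_add (dvd_add h2 h3) h0
      rwa [sub_add_cancel, sub_add_cancel] at h4
  have hstep := fun l hl hlj => (h.free l hl hlj).step (Γ.e_pos i)
    (hlt.trans_le (Nat.sub_le_sub_right (Stage.beta_le hj hl hlj) K)) (hdvd l hl hlj)
  obtain ⟨-, z, hz⟩ := hstep j hij le_rfl
  refine ⟨dvd_add h.dvd dvd_rfl, by omega, fun l hl hlj => ?_, ?_, ?_⟩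
  · have := (hstep l hl hlj).1
    rwa [Nat.sub_sub] at this
  · rw [hz]
    exact fun h1 => h.not_snd h1.1
  · rw [hz]
    exact Or.inl trivial

/-- Free blow-ups lower β_(i+1) - K by e_i until it is less than e_i. Equality cannot occur, because
e_i divides K but not β_(i+1). -/
theorem Stage.exists_end (hij : i < j) (hj : j ≤ Γ.genus) (N : ℕ) :
    ∀ K T, Γ.beta (i + 1) - K ≤ N → Γ.Stage i j K T →
      ∃ K' T', Γ.Stage i j K' T' ∧ Γ.beta (i + 1) - K' < Γ.e i := by
  induction N with
  | zero =>
    intro K T hN h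
    have := h.lt
    omega
  | succ N ih =>
    intro K T hN h
    have hpos := Γ.e_pos i
    rcases lt_trichotomy (Γ.beta (i + 1) - K) (Γ.e i) with h1 | h1 | h1
    · exact ⟨K, T, h, h1⟩
    · exfalso
      have h2 := h.lt
      refine (Γ.beta_mem (i := i) (by omega)).2 ?_
      rw [show Γ.beta (i + 1) = K + Γ.e i by omega]
      exact dvd_add h.dvd dvd_rfl
    · exact ih _ _ (by omega) (h.step hij hj h1)

theorem gcd_beta_sub (hK : Γ.e i ∣ K) (hlt : K < Γ.beta (i + 1)) :
    Nat.gcd (Γ.e i) (Γ.beta (i + 1) - K) = Γ.e (i + 1) := by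
  rw [e_succ]
  obtain ⟨m, rfl⟩ := hK
  rw [Nat.gcd_sub_mul_left_right hlt.le]

/-- Once b = β_(i+1) - K is less than e_i, the term of Γ in β_(i+1) dominates the second coordinate
at all higher levels. The orders (e_i, b) then run through Euclid's algorithm down to their gcd
e_(i+1). -/
theorem Stage.exists_succ (hij : i + 1 < j) (hj : j ≤ Γ.genus) (h : Γ.Stage i j K T) :
    ∃ K' T', Γ.Stage (i + 1) j K' T' := by
  obtain ⟨K, T, h, hlt⟩ := Stage.exists_end (by omega) hj _ K T le_rfl h
  have hKlt := h.lt
  have hS : ∀ l, (i + 1 < l ∧ l ≤ j) → Γ.SatelliteState l T (Γ.e i) (Γ.beta (i + 1) - K)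
      (Γ.beta l - Γ.beta (i + 1)) := by
    rintro l ⟨hl, hlj⟩
    have hβ := Γ.beta_lt_beta (by omega) hl (by omega)
    obtain ⟨c, μ, -, hμ, -, -, hmem⟩ := h.free (i + 1) (by omega) (by omega)
    obtain ⟨-, -, k, hk⟩ := hmem _ _ (Γ.isMember_lowerArc (by omega) hl (by omega))
    have hd : μ * Γ.a (Γ.beta (i + 1)) ≠ 0 := mul_ne_zero hμ (Γ.beta_mem (by omega)).1
    obtain ⟨V, hV⟩ := (pow_dvd_pow X (show Γ.beta (i + 1) - K + 1 ≤ Γ.e i from hlt)).trans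
      (h.X_pow_dvd_snd (by omega))
    have hlead : HasLead (Γ.beta (i + 1) - K) (μ * Γ.a (Γ.beta (i + 1)))
        (strictTransform (Γ.lowerArc l) T).2 := by
      -- `lowerArc (i + 1)` contributes only from degree e_i > b on (the series V), so the leading
      -- term is the one proportional to a_(β_(i+1)).
      refine ⟨C (μ * Γ.a (Γ.beta (i + 1))) + X * (V + k), ?_, by simp⟩
      rw [sub_eq_iff_eq_add, sub_eq_iff_eq_add, hV, pow_succ] at hk
      rw [hk]; ring
    have := (h.free l (by omega) hlj).satelliteState hd (by omega) (by omega) hlead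
    rwa [show Γ.beta l - K - (Γ.beta (i + 1) - K) = Γ.beta l - Γ.beta (i + 1) by omega] at this
  obtain ⟨T', hT'⟩ := exists_freeState_of_satelliteState
    (fun l hl => Nat.sub_pos_of_lt (Γ.beta_lt_beta (by omega) hl.1 (by omega))) _ T _ _ le_rfl
    (Γ.e_pos i) (by omega) hS
  rw [gcd_beta_sub h.dvd h.lt] at hT'
  obtain ⟨-, h1, h2⟩ := hT' j ⟨hij, le_rfl⟩
  exact ⟨Γ.beta (i + 1), T', Γ.e_succ_dvd_beta i, Γ.beta_lt_beta_succ (by omega),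
    fun l hl hlj => (hT' l ⟨hl, hlj⟩).1, h2, Or.inl h1⟩

/-- No exceptional divisor exists yet. The second alternative of `fst` holds because n < β_1, so a
free blow-up is still to come. -/
theorem stage_zero (hj1 : 1 ≤ j) (hj : j ≤ Γ.genus) : Γ.Stage 0 j 0 0 := by
  refine ⟨dvd_zero _, ?_, fun l hl hlj => ?_, fun h => h, Or.inr ?_⟩
  · exact (Nat.zero_le _).trans_lt (Γ.n_lt_beta (by omega))
  · refine ⟨1, 1, one_ne_zero, one_ne_zero, ⟨1, (mul_one _).symm, map_one _⟩,
      PowerSeries.X_dvd_iff.1 (Γ.X_dvd_lowerPart l), fun s γ hγ => ⟨rfl, ⟨1, ?_, by simp⟩, ?_⟩⟩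
    · rw [mul_one]
      exact hγ.1
    · rw [one_mul]
      exact hγ.2
  · exact Γ.n_lt_beta (by omega)

theorem exists_stage (hj : j + 1 ≤ Γ.genus) : ∀ i, i ≤ j → ∃ K T, Γ.Stage i (j + 1) K T := by
  intro i
  induction i with
  | zero => exact fun _ => ⟨0, 0, stage_zero (by omega) hj⟩
  | succ i ih =>
    intro hi
    obtain ⟨K, T, h⟩ := ih (by omega)
    exact h.exists_succ (by omega) hj

/-! ### The last satellite points before a characteristic divisor -/

variable (Γ)

/-- The strict transforms of the arcs of level `l` have orders `a` and `b` and leading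
coefficients proportional to powers of `s` with exponents of opposite signs. -/
structure TerminalState (l T a b : ℕ) (p : List (OnePoint ℂ)) : Prop where
  axes : (axesInDivisor p).1
  axes' : (axesInDivisor p).2 ∨ ¬ a ∣ b
  exists_lead : ∃ (c d : ℂ) (κ₁ κ₂ : ℕ), c ≠ 0 ∧ d ≠ 0 ∧ 0 < κ₁ + κ₂ ∧
    ∀ s γ, s ≠ 0 → Γ.IsMember l s γ → nearPoint γ T = p ∧
      HasLead a (c / s ^ κ₁) (strictTransform γ T).1 ∧
      HasLead b (d * s ^ κ₂) (strictTransform γ T).2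

variable {Γ} {p : List (OnePoint ℂ)}

theorem TerminalState.step_lt (h : Γ.TerminalState l T a b p) (hab : a < b) :
    Γ.TerminalState l (T + 1) a (b - a) (OnePoint.some 0 :: p) := by
  obtain ⟨h1, h2, c, d, κ₁, κ₂, hc, hd, hκ, hmem⟩ := h
  refine ⟨trivial, h2.imp (fun h => ⟨h, rfl⟩) fun h h' => h ((Nat.dvd_sub_iff_left hab.le
    dvd_rfl).1 h'), c, d / c, κ₁, κ₁ + κ₂, hc, div_ne_zero hd hc, by omega,
    fun s γ hs hγ => ?_⟩
  obtain ⟨h3, hU, hV⟩ := hmem s γ hs hγ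
  have hcs : c / s ^ κ₁ ≠ 0 := div_ne_zero hc (pow_ne_zero _ hs)
  obtain ⟨W, hW, hWl⟩ := hU.exists_eq_mul hV hcs hab.le
  have hB := blowUp_of_eq_mul (hU.ne_zero hcs) hW
  rw [Prod.mk.eta, hWl.constantCoeff, if_neg (by omega), map_zero, sub_zero] at hB
  refine ⟨by rw [nearPoint, hB, h3], by rwa [strictTransform, hB], ?_⟩
  rw [strictTransform, hB]
  convert hWl using 1
  rw [pow_add]
  field_simp

theorem TerminalState.step_gt (h : Γ.TerminalState l T a b p) (hab : b < a) :
    Γ.TerminalState l (T + 1) (a - b) b (OnePoint.infty :: p) := by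
  obtain ⟨h1, h2, c, d, κ₁, κ₂, hc, hd, hκ, hmem⟩ := h
  refine ⟨h1, Or.inl trivial, c / d, d, κ₁ + κ₂, κ₂, div_ne_zero hc hd, hd, by omega,
    fun s γ hs hγ => ?_⟩
  obtain ⟨h3, hU, hV⟩ := hmem s γ hs hγ
  have hds : d * s ^ κ₂ ≠ 0 := mul_ne_zero hd (pow_ne_zero _ hs)
  obtain ⟨W, hW, hWl⟩ := hV.exists_eq_mul hU hds hab.le
  have hB := blowUp_of_eq_mul_of_constantCoeff (hV.ne_zero hds) hW
    (by rw [hWl.constantCoeff, if_neg (by omega)])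
  rw [Prod.mk.eta] at hB
  refine ⟨by rw [nearPoint, hB, h3], ?_, by rwa [strictTransform, hB]⟩
  rw [strictTransform, hB]
  convert hWl using 1
  rw [pow_add]
  field_simp

/-- The same Euclidean descent, now with s in the leading coefficients. At equal orders the quotient
starts with (d / c) s^(κ₁+κ₂). There a divides b, so `axes'` forces the centre to be a corner. -/
theorem TerminalState.exists_position (N : ℕ) : ∀ T a b p, a + b ≤ N → 0 < a → 0 < b →
    Γ.TerminalState l T a b p → ∃ (T' : ℕ) (p' : List (OnePoint ℂ)) (κ : ℂ) (k : ℕ),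
      (axesInDivisor p').1 ∧ (axesInDivisor p').2 ∧ κ ≠ 0 ∧ 0 < k ∧
      ∀ s γ, s ≠ 0 → Γ.IsMember l s γ → nearPoint γ T' = p' ∧
        (blowUp (strictTransform γ T')).1 = OnePoint.some (κ * s ^ k) ∧
        (∃ c : ℂ, c ≠ 0 ∧ HasLead (Nat.gcd a b) c (strictTransform γ (T' + 1)).1) ∧
        constantCoeff (strictTransform γ (T' + 1)).2 = 0 := by
  induction N with
  | zero => intro T a b p h ha; omega
  | succ N ih =>
    intro T a b p h ha hb hS
    rcases lt_trichotomy a b with hab | rfl | hab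
    · have := ih (T + 1) a (b - a) _ (by omega) ha (by omega) (hS.step_lt hab)
      rwa [Nat.gcd_sub_self_right hab.le] at this
    · obtain ⟨h1, h2, c, d, κ₁, κ₂, hc, hd, hκ, hmem⟩ := hS
      refine ⟨T, p, d / c, κ₁ + κ₂, h1, h2.resolve_right fun h => h dvd_rfl, div_ne_zero hd hc,
        hκ, fun s γ hs hγ => ?_⟩
      obtain ⟨h3, hU, hV⟩ := hmem s γ hs hγ
      have hcs : c / s ^ κ₁ ≠ 0 := div_ne_zero hc (pow_ne_zero _ hs)
      obtain ⟨W, hW, hWl⟩ := hU.exists_eq_mul hV hcs le_rfl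
      have hB := blowUp_of_eq_mul (hU.ne_zero hcs) hW
      rw [Prod.mk.eta] at hB
      refine ⟨h3, ?_, ⟨_, hcs, ?_⟩, ?_⟩
      · rw [hB, hWl.constantCoeff, if_pos (Nat.sub_self a), pow_add]
        simp only
        congr 1
        field_simp
      · rwa [strictTransform, hB, Nat.gcd_self]
      · rw [strictTransform, hB, map_sub, PowerSeries.constantCoeff_C, sub_self]
    · have := ih (T + 1) (a - b) b _ (by omega) (by omega) hb (hS.step_gt hab)
      rwa [Nat.gcd_sub_self_left hab.le] at this

/-- The infinitely near points of the arcs of level `j + 1`, with parameter `s ≠ 0`, up to the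
first one which depends on `s`. -/
theorem exists_characteristic_position (hj : j + 1 ≤ Γ.genus) :
    ∃ (T : ℕ) (p : List (OnePoint ℂ)) (κ : ℂ) (k : ℕ),
      (axesInDivisor p).1 ∧ (axesInDivisor p).2 ∧ κ ≠ 0 ∧ 0 < k ∧
      ∀ s γ, s ≠ 0 → Γ.IsMember (j + 1) s γ → nearPoint γ T = p ∧
        (blowUp (strictTransform γ T)).1 = OnePoint.some (κ * s ^ k) ∧
        (∃ c : ℂ, c ≠ 0 ∧ HasLead (Γ.e (j + 1)) c (strictTransform γ (T + 1)).1) ∧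
        constantCoeff (strictTransform γ (T + 1)).2 = 0 := by
  obtain ⟨K, T, h⟩ := exists_stage hj j le_rfl
  obtain ⟨K, T, h, hlt⟩ := Stage.exists_end (Nat.lt_succ_self j) hj _ K T le_rfl h
  have hKlt := h.lt
  have key : Γ.TerminalState (j + 1) T (Γ.e j) (Γ.beta (j + 1) - K)
      (nearPoint (Γ.lowerArc (j + 1)) T) := by
    obtain ⟨c, μ, hc, hμ, hU, -, hmem⟩ := h.free (j + 1) (Nat.lt_succ_self j) le_rfl
    -- Initially only the second coordinate involves s, linearly: κ₁ = 0 and κ₂ = 1.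
    refine ⟨h.fst.resolve_right (by omega), Or.inr (Nat.not_dvd_of_pos_of_lt (by omega) hlt), c,
      μ, 0, 1, hc, hμ, one_pos, fun s γ hs hγ => ?_⟩
    obtain ⟨h1, ⟨f, hf, f', hf'⟩, k, hk⟩ := hmem s γ hγ
    refine ⟨h1, ?_, ?_⟩
    · rw [hf, pow_zero, div_one]
      have hf0 : HasLead 0 1 f := by
        refine ⟨f, by rw [pow_zero, one_mul], ?_⟩
        rw [sub_eq_iff_eq_add.1 hf', map_add, map_mul, map_pow, PowerSeries.constantCoeff_X,
          zero_pow (by omega), zero_mul, zero_add, map_one]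
      simpa using hU.mul hf0
    · obtain ⟨V, hV⟩ := (pow_dvd_pow X (show Γ.beta (j + 1) - K + 1 ≤ Γ.e j from hlt)).trans
        (h.X_pow_dvd_snd (Nat.lt_succ_self j))
      refine ⟨C (μ * s) + X * (V + k), ?_, by simp⟩
      rw [sub_eq_iff_eq_add, sub_eq_iff_eq_add, hV, pow_succ] at hk
      rw [hk]; ring
  have := TerminalState.exists_position _ T _ _ _ le_rfl (Γ.e_pos j) (by omega) key
  rwa [gcd_beta_sub h.dvd h.lt] at this

end PlaneBranch

namespace PlaneBranch

open PowerSeries (X C coeff constantCoeff)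

/-! ### Fanning families and characteristic divisors -/

/-- The series `f` with `f (t ^ e)` equal to a given element of `seriesIn e`. -/
noncomputable def contract (e : ℕ) (f : ℂ⟦X⟧) : ℂ⟦X⟧ := PowerSeries.mk fun m => coeff (e * m) f

theorem constantCoeff_contract (e : ℕ) (f : ℂ⟦X⟧) :
    constantCoeff (contract e f) = constantCoeff f := by
  rw [← PowerSeries.coeff_zero_eq_constantCoeff_apply, contract, PowerSeries.coeff_mk, mul_zero,
    PowerSeries.coeff_zero_eq_constantCoeff_apply]

theorem subst_contract {e : ℕ} (he : 0 < e) {f : ℂ⟦X⟧} (hf : f ∈ seriesIn e) :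
    (PowerSeries.subst (X ^ e : ℂ⟦X⟧) (contract e f) : ℂ⟦X⟧) = f := by
  ext m
  rw [PowerSeries.coeff_subst_X_pow he.ne', contract]
  split_ifs with h
  · rw [PowerSeries.coeff_mk, Nat.mul_div_cancel' h, Algebra.algebraMap_self_apply]
  · exact (hf m h).symm

theorem nearPoint_eq_of_le {γ δ : Arc} {m T : ℕ} (hm : m ≤ T)
    (h : nearPoint γ T = nearPoint δ T) : nearPoint γ m = nearPoint δ m := by
  induction T, hm using Nat.le_induction with
  | base => exact h
  | succ T _ ih => exact ih (List.cons.inj h).2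

/-- The derivative k a^(k-1) at ζ = 0 is nonzero. -/
theorem not_eventually_pow_eq {a : ℂ} (ha : a ≠ 0) {k : ℕ} (hk : 0 < k) :
    ¬ ∀ᶠ ζ in 𝓝 (0 : ℂ), (a + ζ) ^ k = a ^ k := by
  intro h
  have h1 : HasDerivAt (fun ζ : ℂ => (a + ζ) ^ k) (k * (a + 0) ^ (k - 1) * 1) 0 :=
    ((hasDerivAt_id (0 : ℂ)).const_add a).pow k
  have h2 : HasDerivAt (fun ζ : ℂ => (a + ζ) ^ k) 0 0 :=
    (hasDerivAt_const (0 : ℂ) (a ^ k)).congr_of_eventuallyEq h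
  have h3 := h1.unique h2
  rw [add_zero, mul_one] at h3
  exact mul_ne_zero (Nat.cast_ne_zero.2 hk.ne') (pow_ne_zero _ ha) h3

variable {Γ : PlaneBranch} {j : ℕ}

theorem isMember_perturbation (ζ : ℂ) :
    Γ.IsMember j (Γ.a (Γ.beta j) + ζ) (Γ.perturbation (Γ.beta j) ζ) := by
  refine Γ.isMember_of_coeff rfl (fun m hm => ?_) ?_
  · rw [perturbation, map_add, PowerSeries.coeff_mk, PowerSeries.coeff_monomial, if_neg hm.ne,
      add_zero]
  · rw [perturbation, map_add, PowerSeries.coeff_mk, PowerSeries.coeff_monomial, if_pos rfl]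

theorem isMember_arc : Γ.IsMember j (Γ.a (Γ.beta j)) Γ.arc := by
  refine Γ.isMember_of_coeff rfl (fun m _ => ?_) ?_ <;> rw [arc, PowerSeries.coeff_mk]

theorem FanningFamily.isMember {ω : OneForm} (F : Γ.FanningFamily ω j) (s : ℂ) :
    Γ.IsMember j s (F.member s) := by
  refine Γ.isMember_of_coeff rfl (fun m hm => ?_) ?_
  · rw [member, PowerSeries.coeff_mk, familyCoeff, if_pos hm]
  · rw [member, PowerSeries.coeff_mk, familyCoeff, if_neg (lt_irrefl _), if_pos rfl]

theorem FanningFamily.member_mem_seriesIn {ω : OneForm} (F : Γ.FanningFamily ω (j + 1)) (s : ℂ) :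
    (F.member s).2 ∈ seriesIn (Γ.e (j + 1)) := by
  intro m hm
  rw [member, PowerSeries.coeff_mk, familyCoeff]
  split_ifs with h1 h2 h3
  · by_contra h0
    exact hm ((Γ.e_succ_dvd j).trans (Γ.e_dvd_of_lt_beta h0 h1))
  · exact absurd (h2 ▸ Γ.e_succ_dvd_beta j) hm
  · refine absurd ?_ hm
    rw [← Nat.sub_add_cancel (not_lt.1 h1)]
    exact dvd_add h3 (Γ.e_succ_dvd_beta j)
  · rfl

/-- The strict transform is a series in t^e whose first coordinate has order exactly e. Replacing
t^e by t gives that coordinate order 1, and it is the equation of the divisor at a finite position.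
-/
theorem FanningFamily.isTransverseTo {ω : OneForm} (F : Γ.FanningFamily ω (j + 1)) {s z c : ℂ}
    {T : ℕ} (hz : (blowUp (strictTransform (F.member s) T)).1 = OnePoint.some z) (hc : c ≠ 0)
    (hlead : HasLead (Γ.e (j + 1)) c (strictTransform (F.member s) (T + 1)).1)
    (h0 : constantCoeff (strictTransform (F.member s) (T + 1)).2 = 0) :
    IsTransverseTo (F.member s) T := by
  have he := Γ.e_pos (j + 1)
  obtain ⟨-, h1, h2⟩ := strictTransform_mem_seriesIn (γ := F.member s)
    (pow_ne_zero _ PowerSeries.X_ne_zero) (X_pow_mem_seriesIn (Γ.e_dvd_n (j + 1)))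
    (F.member_mem_seriesIn s) (T + 1)
  refine ⟨(contract (Γ.e (j + 1)) (strictTransform (F.member s) (T + 1)).1,
    contract (Γ.e (j + 1)) (strictTransform (F.member s) (T + 1)).2), X ^ Γ.e (j + 1), ?_, ?_, ?_,
    pow_ne_zero _ PowerSeries.X_ne_zero, ?_, ?_⟩
  · rw [constantCoeff_contract, hlead.constantCoeff, if_neg he.ne']
  · rw [constantCoeff_contract, h0]
  · rw [map_pow, PowerSeries.constantCoeff_X, zero_pow he.ne']
  · rw [subst_contract he h1, subst_contract he h2]
  · rw [hz]
    simp only [divisorEquation, contract]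
    obtain ⟨g, hg, rfl⟩ := hlead
    have h3 := PowerSeries.coeff_X_pow_mul g (Γ.e (j + 1)) 0
    rw [zero_add] at h3
    rw [PowerSeries.coeff_mk, mul_one, hg, h3, PowerSeries.coeff_zero_eq_constantCoeff_apply]
    exact hc

/-- Over a corner the new component meets the two old ones exactly at the positions 0 and ∞. -/
theorem isTracePoint_iff {p : List (OnePoint ℂ)} (h1 : (axesInDivisor p).1)
    (h2 : (axesInDivisor p).2) (z : OnePoint ℂ) :
    IsTracePoint (z :: p) ↔ ∃ c : ℂ, c ≠ 0 ∧ z = OnePoint.some c := by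
  induction z using OnePoint.rec with
  | infty =>
    refine ⟨fun h => ?_, ?_⟩
    · rcases h with h | h
      · exact absurd trivial h.2
      · exact absurd h1 h.2
    · rintro ⟨c, -, h⟩
      exact absurd h (OnePoint.infty_ne_coe c)
  | coe c =>
    refine ⟨fun h => ⟨c, fun h0 => ?_, rfl⟩, ?_⟩
    · rcases h with h | h
      · exact h.2 ⟨h2, h0⟩
      · exact h.2 trivial
    · rintro ⟨c', hc', h⟩
      obtain rfl := OnePoint.coe_injective h
      exact Or.inl ⟨trivial, fun h3 => hc' h3.2⟩

/-- Γ and its perturbations are members with parameters a_β and a_β + ζ, nonzero for small ζ. Their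
points agree up to index T, and the next position κ (a_β + ζ)^k varies with ζ. -/
theorem exists_isCharacteristicIndex (hj : j + 1 ≤ Γ.genus) (ω : OneForm) :
    ∃ T : ℕ, Γ.IsCharacteristicIndex (j + 1) (T + 1) ∧ ∀ F : Γ.FanningFamily ω (j + 1),
      (∀ s : ℂ, s ≠ 0 → nearPoint (F.member s) (T + 1) ∈ Γ.tracePoints T ∧
        IsTransverseTo (F.member s) T) ∧
      (∀ p ∈ Γ.tracePoints T, ∃ s : ℂ, s ≠ 0 ∧ nearPoint (F.member s) (T + 1) = p) := by
  obtain ⟨T, p, κ, k, h1, h2, hκ, hk, hmem⟩ := exists_characteristic_position hj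
  have ha : Γ.a (Γ.beta (j + 1)) ≠ 0 := (Γ.beta_mem hj).1
  obtain ⟨hp, hpos, -, -⟩ := hmem _ _ ha isMember_arc
  refine ⟨T, ⟨⟨by omega, fun hev => ?_⟩, fun m hm => ?_⟩, fun F => ⟨fun s hs => ?_, ?_⟩⟩
  · refine not_eventually_pow_eq ha hk ?_
    have hne : ∀ᶠ ζ in 𝓝 (0 : ℂ), Γ.a (Γ.beta (j + 1)) + ζ ≠ 0 :=
      ((continuous_const.add continuous_id).tendsto' 0 _ (add_zero _)).eventually_ne ha
    filter_upwards [hev, hne] with ζ hζ hζ0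
    obtain ⟨-, hpos', -, -⟩ := hmem _ _ hζ0 (isMember_perturbation ζ)
    rw [nearPoint, nearPoint, hpos, hpos'] at hζ
    exact mul_left_cancel₀ hκ (OnePoint.coe_injective (List.cons.inj hζ).1)
  · by_contra! hlt
    refine hm.2 ?_
    have hne : ∀ᶠ ζ in 𝓝 (0 : ℂ), Γ.a (Γ.beta (j + 1)) + ζ ≠ 0 :=
      ((continuous_const.add continuous_id).tendsto' 0 _ (add_zero _)).eventually_ne ha
    filter_upwards [hne] with ζ hζ0
    obtain ⟨hp', -⟩ := hmem _ _ hζ0 (isMember_perturbation ζ)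
    exact nearPoint_eq_of_le (Nat.lt_succ_iff.1 hlt) (hp'.trans hp.symm)
  · obtain ⟨h3, h4, ⟨c, hc, h5⟩, h6⟩ := hmem s _ hs (F.isMember s)
    refine ⟨⟨?_, OnePoint.some (κ * s ^ k), ?_⟩, F.isTransverseTo h4 hc h5 h6⟩
    · rw [nearPoint, h3, h4, isTracePoint_iff h1 h2]
      exact ⟨_, mul_ne_zero hκ (pow_ne_zero _ hs), rfl⟩
    · rw [nearPoint, h3, h4, hp]
  · rintro _ ⟨htr, z, rfl⟩
    rw [hp, isTracePoint_iff h1 h2] at htr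
    obtain ⟨c, hc, rfl⟩ := htr
    -- A trace point at position c is reached by any k-th root s of c / κ.
    obtain ⟨s, hs⟩ := IsAlgClosed.exists_pow_nat_eq (c / κ) hk
    have hs0 : s ≠ 0 := by
      rintro rfl
      rw [zero_pow hk.ne'] at hs
      exact div_ne_zero hc hκ hs.symm
    obtain ⟨h3, h4, -, -⟩ := hmem s _ hs0 (F.isMember s)
    refine ⟨s, hs0, ?_⟩
    rw [nearPoint, h3, h4, hs, hp, mul_div_cancel₀ c hκ]

end PlaneBranch

/-! ### Existence of the fanning family and transversality, combined -/

theorem mainTheorem7 (Γ : PlaneBranch) (j : ℕ) (hj : 1 ≤ j) (hjg : j ≤ Γ.genus)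
    (ω : PlaneBranch.OneForm) (hol : ω.IsHolomorphic) (hω : ω ∈ Γ.hatDelta j) :
    Γ.Fans ω j ∧
    ∃ k : ℕ, Γ.IsCharacteristicIndex j (k + 1) ∧
      ∀ F : Γ.FanningFamily ω j,
        (∀ s : ℂ, s ≠ 0 →
          PlaneBranch.nearPoint (F.member s) (k + 1) ∈ Γ.tracePoints k ∧
          PlaneBranch.IsTransverseTo (F.member s) k) ∧
        (∀ p ∈ Γ.tracePoints k, ∃ s : ℂ, s ≠ 0 ∧
          PlaneBranch.nearPoint (F.member s) (k + 1) = p) := by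
  refine ⟨Γ.fans_of_mem_hatDelta hj hjg hol hω, ?_⟩
  obtain ⟨j, rfl⟩ := Nat.exists_eq_add_of_le' hj
  exact PlaneBranch.exists_isCharacteristicIndex hjg ω
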